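/- Let $K$ be a field. A symmetric operad $\mathcal P$ over $K$ is a collection of $S_n$-modules $\mathcal P(n)$, $n\ge 1$, over $K$ with an identity $\mathrm{id}\in\mathcal P(1)$ and linear composition maps $\gamma:\mathcal P(m)\otimes\mathcal P(n_1)\otimes\dots\otimes\mathcal P(n_m)\to\mathcal P(n_1+\dots+n_m)$ that are associative, unital with respect to $\mathrm{id}$, and equivariant. It is called binary if $\mathrm{id}\neq 0$ and $\mathcal P$ is generated as an operad by $\mathcal P(2)$ (so $\mathcal P(1)=K\,\mathrm{id}$). A free product of $\mathcal O_1$ and $\mathcal O_2$ is an operad $\mathcal O$ with morphisms $\pi_i:\mathcal O_i\to\mathcal O$ ($i=1,2$) such that for every operad $\mathcal P$ and all morphisms $\psi_i:\mathcal O_i\to\mathcal P$ there is a unique morphism $\psi:\mathcal O\to\mathcal P$ with $\psi\pi_i=\psi_i$ for $i=1,2$. Let $\mathcal O_1,\mathcal O_2$ be binary symmetric operads over $K$. Define $S_n$-modules $\mathcal T(n)$, $n\ge1$, by induction. Let $\mathcal T(1)=\mathcal T(1)^\bullet=\mathcal T(1)^\circ=K$ be the span of an element $\mathrm{id}_{\mathcal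 T}$. For $n\ge 2$ and a partition $\lambda=(n_1\ge\dots\ge n_m\ge 1)$ of $n$ into $m\ge 2$ parts put $$\mathcal T_\lambda(n)^\bullet=\mathcal O_1(m)\otimes\mathcal T(n_1)^\circ\otimes\dots\otimes\mathcal T(n_m)^\circ,\qquad \mathcal T_\lambda(n)^\circ=\mathcal O_2(m)\otimes\mathcal T(n_1)^\bullet\otimes\dots\otimes\mathcal T(n_m)^\bullet .$$ Let $S(\lambda)\subseteq S_n$ be the subgroup of all permutations that map each of the consecutive blocks of sizes $n_1,\dots,n_m$ of $\{1,\dots,n\}$ onto one of these blocks; it acts on $\mathcal T_\lambda(n)^\bullet$ and $\mathcal T_\lambda(n)^\circ$ by acting on $\mathcal O_i(m)$ through the induced permutation of the blocks, permuting the factors $\mathcal T(n_j)$ of equal arity, and acting on $\mathcal T(n_j)$ through $S_{n_j}$. Put $$\mathcal T(n)^\bullet=\bigoplus_{\lambda}\mathrm{Ind}_{S(\lambda)}^{S_n}\mathcal T_\lambda(n)^\bullet,\qquad \mathcal T(n)^\circ=\bigoplus_{\lambda}\mathrm{Ind}_{S(\lambda)}^{S_n}\mathcal T_\lambda(n)^\circ,\qquad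 \mathcal T(n)=\mathcal T(n)^\bullet\oplus\mathcal T(n)^\circ .$$ Consider planar rooted trees with $n$ numbered leaves whose internal vertices have at least two branches and are coloured $\bullet$ or $\circ$, adjacent internal vertices having different colours, and in which each $\bullet$-vertex (resp. $\circ$-vertex) with $m$ branches is labelled by an element of $\mathcal O_1(m)$ (resp. $\mathcal O_2(m)$). Every such tree represents an element of $\mathcal T(n)$: the tree without internal vertices represents $\mathrm{id}_{\mathcal T}$, and a tree with root label $\nu$ and branches $t_1,\dots,t_m$ represents, up to the renumbering of its leaves, $\nu\otimes t_1\otimes\dots\otimes t_m$. These elements span $\mathcal T(n)$. The composition of trees is grafting with renumbering of the leaves, after which the edges that connect vertices of the same colour are suppressed and the labels of the vertices so merged are composed in $\mathcal O_1$ or $\mathcal O_2$. Theorem. There is a unique structure of a symmetric operad on the collection of $S_n$-modules $\mathcal T=\mathcal T(\mathcal O_1,\mathcal O_2)$ whose identity is $\mathrm{id}_{\mathcal T}$ and whose composition is given on trees by the composition of trees. There are morphisms of operads $\pi_i:\mathcal O_i\to\mathcal T$ that send $\nu\in\mathcal O_i(m)$, $m\ge 2$, to the tree with one internal vertex, of colour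 $\bullet$ for $i=1$ and $\circ$ for $i=2$, labelled by $\nu$, and $\mathcal T$ with $\pi_1,\pi_2$ is a free product of $\mathcal O_1$ and $\mathcal O_2$. Consequently, for every free product $(\mathcal F,j_1,j_2)$ of $\mathcal O_1$ and $\mathcal O_2$ there is an isomorphism of operads $f:\mathcal T\to\mathcal F$ with $f\pi_i=j_i$; that is, $\mathcal T(\mathcal O_1,\mathcal O_2)\cong\mathcal O_1*\mathcal O_2$. -/

import Mathlib

open scoped TensorProduct DirectSum

universe u v w

/-! ## Block numberings -/

/-- The leaves of `m` consecutive blocks of sizes `n 0, …, n (m - 1)` with `∑ n i = N`, numbered from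
left to right by `Fin N`. -/
def blockEquiv {m : ℕ} (n : Fin m → ℕ) (N : ℕ) (h : ∑ i, n i = N) :
    (Σ i : Fin m, Fin (n i)) ≃ Fin N :=
  finSigmaFinEquiv.trans (finCongr h)

theorem sum_blockEquiv {m : ℕ} (n : Fin m → ℕ) (N : ℕ) (h : ∑ i, n i = N) (f : Fin N → ℕ) :
    ∑ i, ∑ j, f (blockEquiv n N h ⟨i, j⟩) = ∑ x, f x := by
  rw [← Equiv.sum_comp (blockEquiv n N h) f, Fintype.sum_sigma]

theorem sigma_cast {m : ℕ} (f : Fin m → ℕ) (y : Σ i : Fin m, Fin (f i)) (j : Fin m)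
    (e : y.1 = j) : (⟨j, Fin.cast (congrArg f e) y.2⟩ : Σ i : Fin m, Fin (f i)) = y := by
  subst e
  rfl

theorem sum_comp_perm {m : ℕ} (n : Fin m → ℕ) (N : ℕ) (h : ∑ i, n i = N)
    (σ : Equiv.Perm (Fin m)) : ∑ i, n (σ i) = N :=
  (Equiv.sum_comp σ n).trans h

/-- The permutation of `Fin N` that carries the `i`-th block of the arrangement `n ∘ σ` to the
`σ i`-th block of the arrangement `n`, keeping the order inside the blocks. -/
def blockPerm {m : ℕ} (n : Fin m → ℕ) (N : ℕ) (h : ∑ i, n i = N) (σ : Equiv.Perm (Fin m)) :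
    Equiv.Perm (Fin N) :=
  (blockEquiv (fun i => n (σ i)) N (sum_comp_perm n N h σ)).symm.trans
    ((Equiv.sigmaCongrLeft (β := fun i => Fin (n i)) σ).trans (blockEquiv n N h))

/-! ## Symmetric operads -/

/-- A symmetric collection: an `S_n`-module for every arity `n ≥ 1`. Arities are indexed by `ℕ`,
with the zero module in arity `0`. The action is a left action; `σ` relabels input `i` as `σ i`. -/
structure SymCollection (K : Type u) [Field K] where
  obj : ∀ n : ℕ, Rep.{v} K (Equiv.Perm (Fin n))
  subsingleton_zero : Subsingleton (obj 0)

/-- The structure of a symmetric operad on a symmetric collection. The composition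
`γ : P(m) ⊗ P(n₁) ⊗ ⋯ ⊗ P(n_m) → P(n₁ + ⋯ + n_m)` is given as a linear map into multilinear maps;
the target arity `N` is a variable with a proof that `N = ∑ n i`. -/
@[ext]
structure OperadStructure {K : Type u} [Field K] (P : SymCollection.{u, v} K) where
  /-- the identity of the operad -/
  one : P.obj 1
  /-- the composition maps -/
  comp : ∀ {m : ℕ} (n : Fin m → ℕ) (N : ℕ), ∑ i, n i = N →
    (P.obj m →ₗ[K] MultilinearMap K (fun i => P.obj (n i)) (P.obj N))
  one_comp : ∀ (n : ℕ) (a : P.obj n),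
    comp (fun _ : Fin 1 => n) n (by simp) one (fun _ => a) = a
  comp_one : ∀ (n : ℕ) (a : P.obj n),
    comp (fun _ : Fin n => 1) n (by simp) a (fun _ => one) = a
  assoc : ∀ {m : ℕ} (n : Fin m → ℕ) (N : ℕ) (hN : ∑ i, n i = N)
    (k : Fin N → ℕ) (M : ℕ) (hM : ∑ x, k x = M)
    (a : P.obj m) (b : ∀ i, P.obj (n i)) (c : ∀ x, P.obj (k x)),
    comp k M hM (comp n N hN a b) c =
      comp (fun i => ∑ j, k (blockEquiv n N hN ⟨i, j⟩)) M
        ((sum_blockEquiv n N hN k).trans hM) a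
        (fun i => comp (fun j => k (blockEquiv n N hN ⟨i, j⟩)) _ rfl (b i)
          (fun j => c (blockEquiv n N hN ⟨i, j⟩)))
  /-- equivariance in the inner arguments -/
  comp_perm_right : ∀ {m : ℕ} (n : Fin m → ℕ) (N : ℕ) (h : ∑ i, n i = N)
    (σ : ∀ i, Equiv.Perm (Fin (n i))) (a : P.obj m) (b : ∀ i, P.obj (n i)),
    comp n N h a (fun i => (P.obj (n i)).ρ (σ i) (b i)) =
      (P.obj N).ρ ((blockEquiv n N h).permCongr (Equiv.sigmaCongrRight σ)) (comp n N h a b)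
  /-- equivariance in the outer argument -/
  comp_perm_left : ∀ {m : ℕ} (n : Fin m → ℕ) (N : ℕ) (h : ∑ i, n i = N)
    (σ : Equiv.Perm (Fin m)) (a : P.obj m) (b : ∀ i, P.obj (n i)),
    comp n N h ((P.obj m).ρ σ a) b =
      (P.obj N).ρ (blockPerm n N h σ)
        (comp (fun i => n (σ i)) N (sum_comp_perm n N h σ) a (fun i => b (σ i)))

/-- A symmetric operad over `K`. -/
structure SymOperad (K : Type u) [Field K] where
  coll : SymCollection.{u, v} K
  str : OperadStructure coll

namespace SymOperad

variable {K : Type u} [Field K]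

/-- The component `P(n)` of an operad. -/
abbrev obj (P : SymOperad.{u, v} K) (n : ℕ) : Rep.{v} K (Equiv.Perm (Fin n)) := P.coll.obj n

/-- Morphisms of operads. -/
structure Hom (P : SymOperad.{u, v} K) (Q : SymOperad.{u, w} K) where
  map : ∀ n : ℕ, P.obj n →ₗ[K] Q.obj n
  map_perm : ∀ (n : ℕ) (σ : Equiv.Perm (Fin n)) (a : P.obj n),
    map n ((P.obj n).ρ σ a) = (Q.obj n).ρ σ (map n a)
  map_one : map 1 P.str.one = Q.str.one
  map_comp : ∀ {m : ℕ} (n : Fin m → ℕ) (N : ℕ) (h : ∑ i, n i = N)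
    (a : P.obj m) (b : ∀ i, P.obj (n i)),
    map N (P.str.comp n N h a b) = Q.str.comp n N h (map m a) (fun i => map (n i) (b i))

/-- `IsFreeProduct π₁ π₂`: the operad `O`, with the morphisms `π₁ : O₁ → O` and `π₂ : O₂ → O`, is
the free product of `O₁` and `O₂`. -/
def IsFreeProduct {O₁ O₂ O : SymOperad.{u, v} K} (π₁ : Hom O₁ O) (π₂ : Hom O₂ O) : Prop :=
  ∀ (P : SymOperad.{u, w} K) (ψ₁ : Hom O₁ P) (ψ₂ : Hom O₂ P),
    ∃! ψ : Hom O P, (∀ (n : ℕ) (x : O₁.obj n), ψ.map n (π₁.map n x) = ψ₁.map n x) ∧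
      (∀ (n : ℕ) (x : O₂.obj n), ψ.map n (π₂.map n x) = ψ₂.map n x)

/-- A family of subspaces `Q(n) ⊆ P(n)` is a suboperad. -/
structure IsSuboperad (P : SymOperad.{u, v} K) (Q : ∀ n : ℕ, Submodule K (P.obj n)) : Prop where
  one_mem : P.str.one ∈ Q 1
  perm_mem : ∀ (n : ℕ) (σ : Equiv.Perm (Fin n)) (a : P.obj n), a ∈ Q n → (P.obj n).ρ σ a ∈ Q n
  comp_mem : ∀ {m : ℕ} (n : Fin m → ℕ) (N : ℕ) (h : ∑ i, n i = N)
    (a : P.obj m) (b : ∀ i, P.obj (n i)),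
    a ∈ Q m → (∀ i, b i ∈ Q (n i)) → P.str.comp n N h a b ∈ Q N

/-- A binary operad: it is not the zero operad, and it is generated by its component of arity `2`,
i.e. the only suboperad that contains `P(2)` is `P`. -/
structure IsBinary (P : SymOperad.{u, v} K) : Prop where
  one_ne_zero : P.str.one ≠ 0
  generated : ∀ Q : ∀ n : ℕ, Submodule K (P.obj n), P.IsSuboperad Q → Q 2 = ⊤ → ∀ n, Q n = ⊤

end SymOperad

/-! ## The symmetric collection `T(O₁, O₂)` -/

/-- The two colours `●` and `○` of internal vertices. -/
inductive Colour
  | black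
  | white

namespace Colour

/-- The opposite colour. -/
def swap : Colour → Colour
  | black => white
  | white => black

/-- The operad that labels the vertices of a given colour: `O₁` for `●` and `O₂` for `○`. -/
def label {K : Type u} [Field K] (O₁ O₂ : SymOperad.{u, v} K) : Colour → SymOperad.{u, v} K
  | black => O₁
  | white => O₂

end Colour

/-- A partition `n = n₁ + ⋯ + n_m` with `n₁ ≥ ⋯ ≥ n_m ≥ 1` into `m ≥ 2` parts. -/
structure DescPartition (n : ℕ) where
  m : ℕ
  two_le : 2 ≤ m
  part : Fin m → ℕ
  antitone : Antitone part
  pos : ∀ i, 0 < part i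
  sum_eq : ∑ i, part i = n

namespace DescPartition

variable {n : ℕ} (l : DescPartition n)

theorem part_lt (i : Fin l.m) : l.part i < n := by
  have hm := l.two_le
  obtain ⟨j, hj⟩ : ∃ j : Fin l.m, j ≠ i := by
    by_cases h : i = ⟨0, by omega⟩
    · exact ⟨⟨1, by omega⟩, by rw [h]; simp⟩
    · exact ⟨⟨0, by omega⟩, fun h' => h h'.symm⟩
  have h1 := Finset.add_le_sum (f := l.part) (s := Finset.univ) (fun k _ => Nat.zero_le _)
    (Finset.mem_univ i) (Finset.mem_univ j) hj.symm
  have h2 := l.pos j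
  have h3 := l.sum_eq
  omega

/-- The group `S(λ)`: permutations of the leaves that map blocks to blocks, together with the
permutation of the blocks that they induce. Its elements are the products of a permutation of
blocks of the same size (an element of `S(m, λ)`) and an element of `S_{n₁} × ⋯ × S_{n_m}`. -/
def blockGroup : Subgroup (Equiv.Perm (Fin l.m) × Equiv.Perm (Σ i : Fin l.m, Fin (l.part i))) where
  carrier := {g | ∀ x, (g.2 x).1 = g.1 x.1}
  mul_mem' := by
    intro g h hg hh x
    change (g.2 (h.2 x)).1 = g.1 (h.1 x.1)
    rw [hg, hh]
  one_mem' := fun _ => rfl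
  inv_mem' := by
    intro g hg x
    change (g.2.symm x).1 = g.1.symm x.1
    rw [Equiv.eq_symm_apply, ← hg, Equiv.apply_symm_apply]

/-- The embedding of `S(λ)` in `S_n`. -/
def blockHom : l.blockGroup →* Equiv.Perm (Fin n) :=
  ((blockEquiv l.part n l.sum_eq).permCongrHom.toMonoidHom.comp
    (MonoidHom.snd _ _)).comp l.blockGroup.subtype

theorem blockGroup_fst (g : l.blockGroup) (j : Fin l.m) (a : Fin (l.part (g.1.1.symm j))) :
    (g.1.2 ⟨g.1.1.symm j, a⟩).1 = j := by
  rw [g.2, Equiv.apply_symm_apply]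

theorem blockGroup_symm_fst (g : l.blockGroup) (j : Fin l.m) (b : Fin (l.part j)) :
    (g.1.2.symm ⟨j, b⟩).1 = g.1.1.symm j :=
  (g⁻¹).2 ⟨j, b⟩

/-- The bijection from the `σ⁻¹ j`-th block to the `j`-th block that underlies an element of
`S(λ)` with block permutation `σ`. -/
def blockBij (g : l.blockGroup) (j : Fin l.m) :
    Fin (l.part (g.1.1.symm j)) ≃ Fin (l.part j) where
  toFun a := Fin.cast (congrArg l.part (l.blockGroup_fst g j a)) (g.1.2 ⟨g.1.1.symm j, a⟩).2
  invFun b := Fin.cast (congrArg l.part (l.blockGroup_symm_fst g j b)) (g.1.2.symm ⟨j, b⟩).2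
  left_inv a := by
    apply Fin.ext
    simp only [Fin.val_cast]
    rw [sigma_cast l.part _ j (l.blockGroup_fst g j a), Equiv.symm_apply_apply]
  right_inv b := by
    apply Fin.ext
    simp only [Fin.val_cast]
    rw [sigma_cast l.part _ _ (l.blockGroup_symm_fst g j b), Equiv.apply_symm_apply]

theorem blockBij_one (j : Fin l.m) : l.blockBij 1 j = Equiv.refl _ := rfl

theorem blockBij_mul (g h : l.blockGroup) (j : Fin l.m) :
    l.blockBij (g * h) j = (l.blockBij h (g.1.1.symm j)).trans (l.blockBij g j) := by
  refine Equiv.ext fun a => Fin.ext ?_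
  exact congrArg (fun y => ((g.1.2 y).2 : ℕ))
    (sigma_cast l.part _ _ (l.blockGroup_fst h (g.1.1.symm j) a)).symm

end DescPartition

section TreeModules

variable {K : Type u} [Field K]

/-- The map `T(a) → T(b)` induced by a bijection `{1, …, a} → {1, …, b}` (so that `a = b`). -/
noncomputable def permMap {n : ℕ} (F : ∀ k, k < n → Rep.{u} K (Equiv.Perm (Fin k)))
    {a b : ℕ} (ha : a < n) (hb : b < n) (e : Fin a ≃ Fin b) : F a ha →ₗ[K] F b hb := by
  have h : a = b := Fin.equiv_iff_eq.mp ⟨e⟩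
  subst h
  exact (F a ha).ρ e

theorem permMap_refl {n : ℕ} (F : ∀ k, k < n → Rep.{u} K (Equiv.Perm (Fin k)))
    {a : ℕ} (ha : a < n) : permMap F ha ha (Equiv.refl _) = LinearMap.id :=
  (F a ha).ρ.map_one

theorem permMap_trans {n : ℕ} (F : ∀ k, k < n → Rep.{u} K (Equiv.Perm (Fin k)))
    {a b c : ℕ} (ha : a < n) (hb : b < n) (hc : c < n) (e : Fin a ≃ Fin b) (f : Fin b ≃ Fin c) :
    permMap F ha hc (e.trans f) = permMap F hb hc f ∘ₗ permMap F ha hb e := by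
  have h : a = b := Fin.equiv_iff_eq.mp ⟨e⟩
  have h' : b = c := Fin.equiv_iff_eq.mp ⟨f⟩
  subst h
  subst h'
  exact (F a ha).ρ.map_mul f e

/-- The action of `S(λ)` on `T(n₁) ⊗ ⋯ ⊗ T(n_m)`: the factors of equal arity are permuted, and
`S_{n_i}` acts on `T(n_i)`. -/
noncomputable def blockTensorRep {n : ℕ} (F : ∀ k, k < n → Rep.{u} K (Equiv.Perm (Fin k)))
    (l : DescPartition n) :
    Representation K l.blockGroup (⨂[K] i, F (l.part i) (l.part_lt i)) where
  toFun g :=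
    PiTensorProduct.map (fun j => permMap F (l.part_lt _) (l.part_lt _) (l.blockBij g j)) ∘ₗ
      (PiTensorProduct.reindex K (fun i => (F (l.part i) (l.part_lt i) : Type u))
        g.1.1).toLinearMap
  map_one' := by
    ext x
    simp only [LinearMap.compMultilinearMap_apply, LinearMap.comp_apply, LinearEquiv.coe_coe,
      PiTensorProduct.reindex_tprod, PiTensorProduct.map_tprod]
    refine congrArg _ (funext fun j => ?_)
    exact LinearMap.congr_fun (permMap_refl F (l.part_lt j)) (x j)
  map_mul' g h := by
    ext x
    simp only [LinearMap.compMultilinearMap_apply, Module.End.mul_apply, LinearMap.comp_apply,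
      LinearEquiv.coe_coe, PiTensorProduct.reindex_tprod, PiTensorProduct.map_tprod]
    refine congrArg _ (funext fun j => ?_)
    rw [l.blockBij_mul g h j]
    exact LinearMap.congr_fun (permMap_trans F _ (l.part_lt _) _ _ _) _

/-- The `S(λ)`-module `T_λ(n) = O(m) ⊗ T(n₁) ⊗ ⋯ ⊗ T(n_m)`, where the modules `T(k)`, `k < n`, are
given by `F`. -/
noncomputable def labelledBlockRep (O : SymOperad.{u, u} K) {n : ℕ}
    (F : ∀ k, k < n → Rep.{u} K (Equiv.Perm (Fin k))) (l : DescPartition n) :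
    Rep.{u} K l.blockGroup :=
  Rep.of (Representation.tprod
    ((O.obj l.m).ρ.comp ((MonoidHom.fst _ _).comp l.blockGroup.subtype)) (blockTensorRep F l))

/-- The direct sum over the partitions `λ` of `n` of the modules `Ind_{S(λ)}^{S_n} T_λ(n)`. -/
noncomputable def sumIndRep (O : SymOperad.{u, u} K) {n : ℕ}
    (F : ∀ k, k < n → Rep.{u} K (Equiv.Perm (Fin k))) : Rep.{u} K (Equiv.Perm (Fin n)) :=
  Rep.of (Representation.directSum
    (fun l : DescPartition n => (Rep.ind l.blockHom (labelledBlockRep O F l)).ρ))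

/-- One step of the induction that defines the modules `T(n)^●` and `T(n)^○`. -/
noncomputable def treeStep (O : SymOperad.{u, u} K) :
    ∀ n : ℕ, (∀ k, k < n → Rep.{u} K (Equiv.Perm (Fin k))) → Rep.{u} K (Equiv.Perm (Fin n))
  | 0, _ => Rep.trivial K _ PUnit
  | 1, _ => Rep.trivial K _ K
  | _ + 2, F => sumIndRep O F

/-- The `S_n`-module `T(n)^c`: spanned by the trees with root vertex of colour `c` if `n ≥ 2`. For
`n = 1` it is `T(1)`, the span of the identity, for both colours. -/
noncomputable def treeRep (O₁ O₂ : SymOperad.{u, u} K) (c : Colour) (n : ℕ) :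
    Rep.{u} K (Equiv.Perm (Fin n)) :=
  treeStep (c.label O₁ O₂) n (fun k _ => treeRep O₁ O₂ c.swap k)
termination_by n

theorem treeRep_eq (O₁ O₂ : SymOperad.{u, u} K) (c : Colour) (n : ℕ) :
    treeRep O₁ O₂ c n = treeStep (c.label O₁ O₂) n (fun k _ => treeRep O₁ O₂ c.swap k) := by
  rw [treeRep]

/-- Transport along an equality of representations. -/
def repCast {G : Type*} [Group G] {A B : Rep.{u} K G} (h : A = B) : A ≃ₗ[K] B := by
  subst h
  exact LinearEquiv.refl K A

/-- The collection `T(O₁, O₂)`: `T(1)` is the span of the identity and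
`T(n) = T(n)^● ⊕ T(n)^○` for `n ≥ 2`. -/
noncomputable def treeCollection (O₁ O₂ : SymOperad.{u, u} K) : SymCollection.{u, u} K where
  obj
    | 0 => Rep.trivial K _ PUnit
    | 1 => Rep.trivial K _ K
    | n + 2 => Rep.of ((treeRep O₁ O₂ Colour.black (n + 2)).ρ.prod
        (treeRep O₁ O₂ Colour.white (n + 2)).ρ)
  subsingleton_zero := inferInstanceAs (Subsingleton PUnit)

/-- The inclusion of `T(n)^c` in `T(n)`. -/
noncomputable def treeIncl (O₁ O₂ : SymOperad.{u, u} K) :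
    ∀ (c : Colour) (n : ℕ), treeRep O₁ O₂ c n →ₗ[K] (treeCollection O₁ O₂).obj n
  | _, 0 => 0
  | c, 1 => (repCast (treeRep_eq O₁ O₂ c 1)).toLinearMap
  | Colour.black, _ + 2 => LinearMap.inl K _ _
  | Colour.white, _ + 2 => LinearMap.inr K _ _

/-- The element of `T(n)^c` given by a generator `ν ⊗ x₁ ⊗ ⋯ ⊗ x_m` of `T_λ(n)^c`: the tree whose
root is labelled by `ν` and whose branches are `x₁, …, x_m`, with the leaves numbered from left
to right. -/
noncomputable def sortedVertex (O₁ O₂ : SymOperad.{u, u} K) (c : Colour) {n : ℕ}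
    (l : DescPartition n) (ν : (c.label O₁ O₂).obj l.m)
    (x : ∀ i, treeRep O₁ O₂ c.swap (l.part i)) : treeRep O₁ O₂ c n :=
  match n, l, x with
  | 0, l, x => 0
  | 1, l, x => 0
  | _ + 2, l, x => (repCast (treeRep_eq O₁ O₂ c _)).symm <| by
      classical
      exact DirectSum.lof K (DescPartition _)
        (fun l => (Rep.ind l.blockHom (labelledBlockRep (c.label O₁ O₂)
          (fun k _ => treeRep O₁ O₂ c.swap k) l) : Type u)) l
        (Representation.IndV.mk l.blockHom _ 1 (ν ⊗ₜ[K] PiTensorProduct.tprod K x))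

/-- The partition obtained by sorting the parts of a composition in descending order. -/
def sortedPartition {m : ℕ} (hm : 2 ≤ m) (n : Fin m → ℕ) (hn : ∀ i, 0 < n i) (N : ℕ)
    (hN : ∑ i, n i = N) : DescPartition N where
  m := m
  two_le := hm
  part i := n (Tuple.sort (fun i => OrderDual.toDual (n i)) i)
  antitone := fun _ _ h => Tuple.monotone_sort (fun i => OrderDual.toDual (n i)) h
  pos _ := hn _
  sum_eq := sum_comp_perm n N hN _

/-- The element of `T(N)^c` given by the tree whose root has colour `c` and label `ν ∈ O(m)` and
whose branches are, from left to right, `x₁, …, x_m`, with the leaves numbered from left to right;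
the arities of the branches need not be sorted. With `τ` the permutation that sorts the branches,
it is the tree with root label `τ⁻¹ ν` and branches `x_{τ 1}, …, x_{τ m}`, renumbered. -/
noncomputable def vertex (O₁ O₂ : SymOperad.{u, u} K) (c : Colour) {m : ℕ} (hm : 2 ≤ m)
    (n : Fin m → ℕ) (hn : ∀ i, 0 < n i) (N : ℕ) (hN : ∑ i, n i = N)
    (ν : (c.label O₁ O₂).obj m) (x : ∀ i, treeRep O₁ O₂ c.swap (n i)) : treeRep O₁ O₂ c N :=
  let τ : Equiv.Perm (Fin m) := Tuple.sort (fun i => OrderDual.toDual (n i))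
  (treeRep O₁ O₂ c N).ρ (blockPerm n N hN τ)
    (sortedVertex O₁ O₂ c (sortedPartition hm n hn N hN)
      (((c.label O₁ O₂).obj m).ρ τ⁻¹ ν) (fun i => x (τ i)))

end TreeModules

/-! ## Labelled trees and their composition -/

section Trees

variable {K : Type u} [Field K]

/-- Planar rooted trees with `n` leaves, numbered from left to right, whose internal vertices are
coloured `●` or `○`, have at least two branches, are labelled by elements of `O₁` (for `●`) or
`O₂` (for `○`) of the corresponding arity, and such that adjacent internal vertices have different
colours. `LTree O₁ O₂ c n` consists of the tree with one leaf and no internal vertex (for `n = 1`)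
and of the trees with root vertex of colour `c`. -/
inductive LTree (O₁ O₂ : SymOperad.{u, u} K) : Colour → ℕ → Type u
  | leaf {c : Colour} : LTree O₁ O₂ c 1
  | node {c : Colour} {m : ℕ} (hm : 2 ≤ m) (n : Fin m → ℕ) (N : ℕ) (hN : ∑ i, n i = N)
      (ν : (c.label O₁ O₂).obj m) (t : ∀ i, LTree O₁ O₂ c.swap (n i)) : LTree O₁ O₂ c N

namespace LTree

variable {O₁ O₂ : SymOperad.{u, u} K}

theorem pos {c : Colour} {n : ℕ} (t : LTree O₁ O₂ c n) : 0 < n := by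
  induction t with
  | leaf => exact Nat.one_pos
  | node hm n N hN ν t ih =>
    rw [← hN]
    exact Finset.sum_pos (fun i _ => ih i) ⟨⟨0, by omega⟩, Finset.mem_univ _⟩

/-- The element of `T(n)^c` represented by a tree. -/
noncomputable def eval {c : Colour} {n : ℕ} : LTree O₁ O₂ c n → treeRep O₁ O₂ c n
  | leaf => (repCast (treeRep_eq O₁ O₂ c 1)).symm (1 : K)
  | node hm n N hN ν t => vertex O₁ O₂ c hm n (fun i => (t i).pos) N hN ν (fun i => (t i).eval)

/-- The tree with a single internal vertex. -/
def corolla (O₁ O₂ : SymOperad.{u, u} K) (c : Colour) {m : ℕ} (hm : 2 ≤ m)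
    (ν : (c.label O₁ O₂).obj m) : LTree O₁ O₂ c m :=
  node hm (fun _ => 1) m (by simp) ν (fun _ => leaf)

/-- A tree with `n` leaves, presented as a root of colour `c` with label `ν` and branches that do
not have a root of colour `c`. Here the root may have a single branch. -/
structure Stem (O₁ O₂ : SymOperad.{u, u} K) (c : Colour) (n : ℕ) where
  r : ℕ
  r_pos : 0 < r
  part : Fin r → ℕ
  sum_eq : ∑ i, part i = n
  ν : (c.label O₁ O₂).obj r
  branch : ∀ i, LTree O₁ O₂ c.swap (part i)

/-- Adjoin a root of colour `c` labelled by the identity. -/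
def Stem.single {c : Colour} {n : ℕ} (t : LTree O₁ O₂ c.swap n) : Stem O₁ O₂ c n :=
  ⟨1, Nat.one_pos, fun _ => n, by simp, (c.label O₁ O₂).str.one, fun _ => t⟩

/-- Present a tree with a root of colour `c` by this root, and the tree without internal vertex by
the identity. -/
def Stem.root {c : Colour} : ∀ {n : ℕ}, LTree O₁ O₂ c n → Stem O₁ O₂ c n
  | _, leaf => Stem.single leaf
  | _, node (m := m) hm n _ hN ν t => ⟨m, by omega, n, hN, ν, t⟩

/-- Present an arbitrary tree by a root of colour `c`. -/
def Stem.ofTree (c : Colour) {n : ℕ} : (Σ d, LTree O₁ O₂ d n) → Stem O₁ O₂ c n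
  | ⟨d, t⟩ => match c, d, t with
    | .black, .black, t => Stem.root t
    | .black, .white, t => Stem.single t
    | .white, .black, t => Stem.single t
    | .white, .white, t => Stem.root t

/-- Graft trees on the leaves of a vertex of colour `c` labelled by `ν`. An edge between this
vertex and a root of the same colour is suppressed and the labels are composed. -/
def merge (c : Colour) {m : ℕ} (hm : 2 ≤ m) (n : Fin m → ℕ) (N : ℕ) (hN : ∑ i, n i = N)
    (ν : (c.label O₁ O₂).obj m) (t : ∀ i, Σ d, LTree O₁ O₂ d (n i)) : LTree O₁ O₂ c N :=
  let s : ∀ i, Stem O₁ O₂ c (n i) := fun i => Stem.ofTree c (t i)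
  let e := blockEquiv (fun i => (s i).r) _ rfl
  node (m := ∑ i, (s i).r)
    (hm.trans (by
      calc m = ∑ _i : Fin m, 1 := by simp
        _ ≤ ∑ i, (s i).r := Finset.sum_le_sum fun i _ => (s i).r_pos))
    (fun x => (s (e.symm x).1).part (e.symm x).2) N
    (by
      rw [Equiv.sum_comp e.symm (fun p => (s p.1).part p.2), Fintype.sum_sigma]
      simp only [(s _).sum_eq, hN])
    ((c.label O₁ O₂).str.comp (fun i => (s i).r) _ rfl ν (fun i => (s i).ν))
    (fun x => (s (e.symm x).1).branch (e.symm x).2)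

/-- The composition of trees: the tree `s x` is grafted on the leaf `x` of `t`, for all leaves `x`,
and the edges that connect vertices of the same colour are suppressed, the labels being composed. -/
def graft {c : Colour} {n : ℕ} (t : LTree O₁ O₂ c n) (k : Fin n → ℕ) (N : ℕ)
    (h : ∑ x, k x = N) (s : ∀ x, Σ d, LTree O₁ O₂ d (k x)) : Σ d, LTree O₁ O₂ d N :=
  match t with
  | leaf => ⟨(s 0).1, cast (congrArg _ ((Fin.sum_univ_one k).symm.trans h)) (s 0).2⟩
  | node (c := c) hm n _ hn ν t =>
    ⟨c, merge c hm (fun i => ∑ j, k (blockEquiv n _ hn ⟨i, j⟩)) N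
      ((sum_blockEquiv n _ hn k).trans h) ν
      (fun i => (t i).graft (fun j => k (blockEquiv n _ hn ⟨i, j⟩)) _ rfl
        (fun j => s (blockEquiv n _ hn ⟨i, j⟩)))⟩

/-- The element of `T(n)` represented by a tree with a root of arbitrary colour. -/
noncomputable def toT {n : ℕ} (t : Σ d, LTree O₁ O₂ d n) : (treeCollection O₁ O₂).obj n :=
  treeIncl O₁ O₂ t.1 n t.2.eval

end LTree

/-- The operad structure on `T(O₁, O₂)`: the identity is the tree without internal vertex, and
the composition is the composition of trees. (The trees numbered from left to right generate `T(n)`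
as an `S_n`-module, so that this determines the operad structure.) -/
structure IsTreeComposition {O₁ O₂ : SymOperad.{u, u} K}
    (S : OperadStructure (treeCollection O₁ O₂)) : Prop where
  one_eq : S.one = LTree.toT ⟨Colour.black, LTree.leaf⟩
  comp_eq : ∀ {c : Colour} {n : ℕ} (t : LTree O₁ O₂ c n) (k : Fin n → ℕ) (N : ℕ)
    (h : ∑ x, k x = N) (s : ∀ x, Σ d, LTree O₁ O₂ d (k x)),
    S.comp k N h (LTree.toT ⟨c, t⟩) (fun x => LTree.toT (s x)) = LTree.toT (t.graft k N h s)

end Trees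

/-! Since `O₁(1)` and `O₂(1)` consist of the multiples of the identity
(`SymOperad.IsBinary.exists_coef`), a tree can be read in two ways. For either colour `c` it is a
vertex of colour `c` whose branches have no root of colour `c`; if the root of the tree has the
other colour, this vertex is unary and labelled by the identity. So `T` is the composite of the
operad of labels of colour `c` with the trees of the opposite colour, for both choices of `c`
(`isComposite_treeT`). A composite of an operad with a collection is a left module over the operad,
by composing labels (`IsComposite.lmod`). Hence `O₁` and `O₂` both act on `T` (`treeMod`).

The central fact is that `T` with these two actions is free on its identity: for every collection
`R` with left actions of `O₁` and `O₂` and every `r` in `R(1)` there is a map from `T` to `R` that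
respects both actions and sends the identity to `r` (`treeT_free`). It is built by recursion on the
arity, because the branches of a vertex with at least two branches have smaller arity. The recursion
uses the universal property of the induced modules: linear maps on `T(n)^c`, `n ≥ 2`, are compatible
families of operations on a label and branches (`treeLift`, `treeLift_vertMap`, `treeRep_hom_ext`).
Such a map is unique, as `T` is generated by its identity under the two actions (`treeT_induction`).

The rest is deduced from freeness. The multilinear operations with arguments and values in `T` again
form a collection with actions of `O₁` and `O₂` (`homLMod`), and the map from `T` that sends the
identity to the identity operation is the composition (`treeComp`). In this way grafting need not be
shown by hand to respect the relations between trees. By construction the composition commutes with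
both actions in its outer argument (`treeComp_lact`), so right equivariance, the right unit law and
associativity follow by induction on the outer tree. The same recursion describes the grafting of
planar trees, whence `treeComp_toT`. Trees with numbered leaves span `T` (`span_numberedTree`), and
equivariance reduces their composition to that of planar trees; hence the structure is unique.

For the universal property, morphisms from `O₁` and `O₂` to an operad `P` make `P` a left module
over both (`SymOperad.Hom.lmod`). Freeness gives the map from `T` to `P`, and two further inductions
show that it is a morphism of operads and the only one (`existsUnique_treeOperad_hom`).

Throughout, operations are given for all numberings of the labels, not only for consecutive blocks
(`Fam`). Equivariance then becomes independence of the chosen bijections, and casts between equal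
arities become relabellings. -/

/-! ## Multilinear maps and spanning families -/

section Span

variable {K : Type*} [Field K] {ι : Type*} [Finite ι] {T : ι → Type*}
  [∀ i, AddCommGroup (T i)] [∀ i, Module K (T i)] {M : Type*} [AddCommGroup M] [Module K M]

/-- A function of generators that is linear in every slot extends to a multilinear map. -/
theorem MultilinearMap.exists_of_span [DecidableEq ι] {G : ι → Type*} (q : ∀ i, G i → T i)
    (hq : ∀ i, ⊤ ≤ Submodule.span K (Set.range (q i))) (F : (∀ i, G i) → M)
    (hF : ∀ (i : ι) (g : ∀ i, G i),
      ∃ L : T i →ₗ[K] M, ∀ y, L (q i y) = F (Function.update g i y)) :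
    ∃ f : MultilinearMap K T M, ∀ g : ∀ i, G i, f (fun i => q i (g i)) = F g := by
  -- A basis of each `T i` is selected among the generators. The map is prescribed on tuples of
  -- basis generators; its values on the other generators need an argument, since these may satisfy
  -- linear relations.
  classical
  have := Fintype.ofFinite ι
  choose κ a _ha hspan hli using fun i => exists_linearIndependent' K (q i)
  let B : ∀ i, Module.Basis (κ i) K (T i) := fun i =>
    Module.Basis.mk (hli i) (by rw [hspan i]; exact hq i)
  have hB : ∀ i k, B i k = q i (a i k) := fun i k => by simp [B]
  let f : MultilinearMap K T M :=
    ((Basis.piTensorProduct B).constr K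
      (fun p : ∀ i, κ i => F (fun i => a i (p i)))).compMultilinearMap (PiTensorProduct.tprod K)
  have hf : ∀ p : ∀ i, κ i, f (fun i => q i (a i (p i))) = F (fun i => a i (p i)) := by
    intro p
    have h1 : (fun i => q i (a i (p i))) = fun i => B i (p i) := funext fun i => (hB i _).symm
    rw [h1]
    change (Basis.piTensorProduct B).constr K _ (PiTensorProduct.tprod K fun i => B i (p i)) = _
    rw [← Basis.piTensorProduct_apply, Module.Basis.constr_basis]
  refine ⟨f, fun g => ?_⟩
  -- Induction on the set `s` of slots in which arbitrary generators are allowed. In a new slot `i`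
  -- both `f` and `F` are given by linear maps, which agree on the basis generators by the induction
  -- hypothesis.
  suffices h : ∀ (s : Finset ι) (g : ∀ i, G i), (∀ i ∉ s, g i ∈ Set.range (a i)) →
      f (fun i => q i (g i)) = F g from h Finset.univ g (by simp)
  intro s
  induction s using Finset.induction_on with
  | empty =>
    intro g hg
    choose p hp using fun i => hg i (by simp)
    obtain rfl : (fun i => a i (p i)) = g := funext hp
    exact hf p
  | insert i s _ ih =>
    intro g hg
    obtain ⟨L, hL⟩ := hF i g
    have hq' : ∀ y, Function.update (fun i => q i (g i)) i (q i y) =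
        fun j => q j (Function.update g i y j) := fun y => by
      funext j
      by_cases h : j = i
      · subst h; simp
      · simp [h]
    have hLf : f.toLinearMap (fun i => q i (g i)) i = L := by
      refine (B i).ext fun k => ?_
      rw [hB, hL, MultilinearMap.toLinearMap_apply, hq', ih]
      intro j hj
      by_cases h : j = i
      · subst h; simp
      · simpa [h] using hg j (by simp [h, hj])
    have h1 := hL (g i)
    rw [← hLf, MultilinearMap.toLinearMap_apply, hq'] at h1
    simpa using h1

/-- Multilinear maps that agree on spanning families agree. -/
theorem MultilinearMap.ext_span {G : ι → Type*} (q : ∀ i, G i → T i)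
    (hq : ∀ i, ⊤ ≤ Submodule.span K (Set.range (q i))) (f f' : MultilinearMap K T M)
    (h : ∀ g : ∀ i, G i, f (fun i => q i (g i)) = f' (fun i => q i (g i))) : f = f' := by
  classical
  choose κ a _ha hspan hli using fun i => exists_linearIndependent' K (q i)
  let B : ∀ i, Module.Basis (κ i) K (T i) := fun i =>
    Module.Basis.mk (hli i) (by rw [hspan i]; exact hq i)
  refine Module.Basis.ext_multilinear B fun p => ?_
  simpa [B] using h fun i => a i (p i)

/-- A multilinear map sends everything into a subspace if it does so on spanning families. -/
theorem MultilinearMap.mem_of_span {G : ι → Type*} (q : ∀ i, G i → T i)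
    (hq : ∀ i, ⊤ ≤ Submodule.span K (Set.range (q i))) (f : MultilinearMap K T M)
    (Q : Submodule K M) (h : ∀ g : ∀ i, G i, f (fun i => q i (g i)) ∈ Q) (x : ∀ i, T i) :
    f x ∈ Q := by
  have h0 : Q.mkQ.compMultilinearMap f = 0 :=
    MultilinearMap.ext_span q hq _ _ fun g => by simpa using h g
  simpa using congrArg (fun F : MultilinearMap K T (M ⧸ Q) => F x) h0

end Span

/-! ## Collections with relabelling -/

/-- A collection of `K`-modules indexed by arities, on which bijections of labels act. -/
structure Coll (K : Type u) [Field K] where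
  X : ℕ → Type v
  [acg : ∀ n, AddCommGroup (X n)]
  [mod : ∀ n, Module K (X n)]
  act : ∀ {a b : ℕ}, (Fin a ≃ Fin b) → (X a →ₗ[K] X b)
  act_refl : ∀ {a : ℕ} (x : X a), act (Equiv.refl (Fin a)) x = x
  act_trans : ∀ {a b c : ℕ} (e : Fin a ≃ Fin b) (f : Fin b ≃ Fin c) (x : X a),
    act (e.trans f) x = act f (act e x)

attribute [instance] Coll.acg Coll.mod

section Coll

variable {K : Type u} [Field K]

theorem Coll.act_act_eq (C : Coll.{u, v} K) {a b c : ℕ} (e : Fin a ≃ Fin b) (f : Fin b ≃ Fin c)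
    (g : Fin a ≃ Fin c) (h : ∀ z, g z = f (e z)) (x : C.X a) : C.act f (C.act e x) = C.act g x := by
  rw [← C.act_trans]
  congr 2
  exact Equiv.ext fun z => (h z).symm

theorem Coll.act_eq_self (C : Coll.{u, v} K) {a : ℕ} (e : Fin a ≃ Fin a) (h : ∀ z, e z = z)
    (x : C.X a) : C.act e x = x := by
  obtain rfl : e = Equiv.refl _ := Equiv.ext h
  exact C.act_refl x

/-- The map induced by a bijection `{1, …, a} → {1, …, b}`. -/
noncomputable def repAct (R : ∀ n : ℕ, Rep.{v} K (Equiv.Perm (Fin n))) {a b : ℕ}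
    (e : Fin a ≃ Fin b) : R a →ₗ[K] R b := by
  have h : a = b := Fin.equiv_iff_eq.mp ⟨e⟩
  subst h
  exact (R a).ρ e

/-- The collection given by a sequence of representations of the symmetric groups. -/
@[reducible] noncomputable def Coll.ofRep (R : ∀ n : ℕ, Rep.{v} K (Equiv.Perm (Fin n))) :
    Coll.{u, v} K where
  X n := R n
  act e := repAct R e
  act_refl {a} x := LinearMap.congr_fun (R a).ρ.map_one x
  act_trans {a b c} e f x := by
    obtain rfl : a = b := Fin.equiv_iff_eq.mp ⟨e⟩
    obtain rfl : a = c := Fin.equiv_iff_eq.mp ⟨f⟩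
    exact LinearMap.congr_fun ((R a).ρ.map_mul f e) x

/-- A compatible family of operations with one argument in `A(m)`, arguments in `X(n₁), …, X(n_m)`
and values in `M`, for every numbering of the labels by `Fin N`. -/
structure Fam (A : Coll.{u, v} K) (X : Coll.{u, w} K) (N : ℕ) (M : Type*) [AddCommGroup M]
    [Module K M] where
  toFun : ∀ {m : ℕ} {n : Fin m → ℕ}, ((Σ i, Fin (n i)) ≃ Fin N) →
    (A.X m →ₗ[K] MultilinearMap K (fun i => X.X (n i)) M)
  left : ∀ {m m' : ℕ} (σ : Fin m ≃ Fin m') {n : Fin m' → ℕ} (e : (Σ i, Fin (n i)) ≃ Fin N)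
    (e' : (Σ i, Fin (n (σ i))) ≃ Fin N), (∀ i z, e' ⟨i, z⟩ = e ⟨σ i, z⟩) →
    ∀ (a : A.X m) (x : ∀ i, X.X (n i)), toFun e (A.act σ a) x = toFun e' a (fun i => x (σ i))
  right : ∀ {m : ℕ} {n n' : Fin m → ℕ} (f : ∀ i, Fin (n i) ≃ Fin (n' i))
    (e : (Σ i, Fin (n' i)) ≃ Fin N) (e' : (Σ i, Fin (n i)) ≃ Fin N),
    (∀ i z, e' ⟨i, z⟩ = e ⟨i, f i z⟩) →
    ∀ (a : A.X m) (x : ∀ i, X.X (n i)),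
      toFun e a (fun i => X.act (f i) (x i)) = toFun e' a x

namespace Fam

variable {A : Coll.{u, v} K} {X : Coll.{u, w} K} {N : ℕ} {M : Type*} [AddCommGroup M] [Module K M]
  (F : Fam A X N M) {I J : Type*}

/-- The types of the arguments and of the numberings depend on the index map, so a pointwise
equality of index maps cannot be rewritten directly. Compatibility of the numberings is stated
through `Fin.cast`, after which substitution is possible. -/
theorem toFun_congr {m : ℕ} {n : I → ℕ} (f f' : Fin m → I) (hf : ∀ y, f y = f' y)
    (e : (Σ y, Fin (n (f y))) ≃ Fin N) (e' : (Σ y, Fin (n (f' y))) ≃ Fin N)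
    (he : ∀ y z, e ⟨y, z⟩ = e' ⟨y, Fin.cast (congrArg n (hf y)) z⟩) (a : A.X m)
    (x : ∀ i, X.X (n i)) :
    F.toFun e a (fun y => x (f y)) = F.toFun e' a (fun y => x (f' y)) := by
  obtain rfl : f = f' := funext hf
  obtain rfl : e = e' := Equiv.ext fun ⟨y, z⟩ => he y z
  rfl

/-- The operation with arguments indexed by an arbitrary finite type `I`, numbered by `b`. -/
def idx {m : ℕ} (b : I ≃ Fin m) {n : I → ℕ} (e : (Σ i, Fin (n i)) ≃ Fin N) (a : A.X m)
    (x : ∀ i, X.X (n i)) : M :=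
  F.toFun ((Equiv.sigmaCongrLeft (β := fun i => Fin (n i)) b.symm).trans e) a
    (fun y => x (b.symm y))

/-- Passing from `I` to `J` permutes the inputs of the operation by `τ`, and `left` moves this
permutation onto the first argument. -/
theorem idx_reindex {m m' : ℕ} (κ : J ≃ I) (b : I ≃ Fin m) (b' : J ≃ Fin m') (τ : Fin m' ≃ Fin m)
    (h : ∀ j, b (κ j) = τ (b' j)) {n : I → ℕ} (e : (Σ i, Fin (n i)) ≃ Fin N)
    (e' : (Σ j, Fin (n (κ j))) ≃ Fin N) (he : ∀ j z, e' ⟨j, z⟩ = e ⟨κ j, z⟩)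
    (a : A.X m') (x : ∀ i, X.X (n i)) :
    F.idx b' e' a (fun j => x (κ j)) = F.idx b e (A.act τ a) x := by
  unfold idx
  rw [F.left τ _ ((Equiv.sigmaCongrLeft (β := fun y => Fin (n (b.symm y))) τ).trans
    ((Equiv.sigmaCongrLeft (β := fun i => Fin (n i)) b.symm).trans e)) (fun i z => rfl)]
  refine F.toFun_congr (fun y => κ (b'.symm y)) (fun y => b.symm (τ y)) (fun y => ?_) _ _
    (fun y z => ?_) a x
  · rw [Equiv.eq_symm_apply, h, Equiv.apply_symm_apply]
  · change e' ⟨b'.symm y, z⟩ = e ⟨b.symm (τ y), _⟩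
    rw [he]
    congr 1
    have : κ (b'.symm y) = b.symm (τ y) := by
      rw [Equiv.eq_symm_apply, h, Equiv.apply_symm_apply]
    refine Sigma.ext this ?_
    rw [Fin.heq_ext_iff (congrArg n this)]
    rfl

theorem idx_refl {m : ℕ} {n : Fin m → ℕ} (e : (Σ i, Fin (n i)) ≃ Fin N) (a : A.X m)
    (x : ∀ i, X.X (n i)) : F.idx (Equiv.refl _) e a x = F.toFun e a x := by
  have : (Equiv.sigmaCongrLeft (β := fun i => Fin (n i)) (Equiv.refl (Fin m)).symm).trans e = e :=
    Equiv.ext fun ⟨i, z⟩ => rfl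
  unfold idx
  exact congrArg (fun e' => F.toFun (n := n) e' a x) this

theorem idx_right {m : ℕ} (b : I ≃ Fin m) {n n' : I → ℕ} (f : ∀ i, Fin (n i) ≃ Fin (n' i))
    (e : (Σ i, Fin (n' i)) ≃ Fin N) (e' : (Σ i, Fin (n i)) ≃ Fin N)
    (he : ∀ i z, e' ⟨i, z⟩ = e ⟨i, f i z⟩) (a : A.X m) (x : ∀ i, X.X (n i)) :
    F.idx b e a (fun i => X.act (f i) (x i)) = F.idx b e' a x :=
  F.right (fun y => f (b.symm y)) _ _ (fun _ _ => he _ _) a _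

end Fam

end Coll

/-- The numbering of the labels of consecutive blocks from left to right. -/
def sigmaNumbering {m : ℕ} (n : Fin m → ℕ) : (Σ i, Fin (n i)) ≃ Fin (∑ i, n i) :=
  blockEquiv n _ rfl

/-! ## Operads and left modules in labelled form -/

section LOperad

variable {K : Type u} [Field K]

/-- An operad, given by compositions for all numberings of the labels. -/
structure LOperad (K : Type u) [Field K] where
  C : Coll.{u, v} K
  zero : Subsingleton (C.X 0)
  one : C.X 1
  comp : ∀ N : ℕ, Fam C C N (C.X N)
  nat : ∀ {m : ℕ} {n : Fin m → ℕ} {N N' : ℕ} (e : (Σ i, Fin (n i)) ≃ Fin N) (g : Fin N ≃ Fin N')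
    (e' : (Σ i, Fin (n i)) ≃ Fin N'), (∀ i z, e' ⟨i, z⟩ = g (e ⟨i, z⟩)) →
    ∀ (a : C.X m) (x : ∀ i, C.X (n i)),
      C.act g ((comp N).toFun e a x) = (comp N').toFun e' a x
  one_comp : ∀ {n : Fin 1 → ℕ} {N : ℕ} (e : (Σ i, Fin (n i)) ≃ Fin N) (g : Fin (n 0) ≃ Fin N),
    (∀ z, g z = e ⟨0, z⟩) → ∀ x : ∀ i, C.X (n i), (comp N).toFun e one x = C.act g (x 0)
  comp_one : ∀ {m N : ℕ} (e : (Σ _ : Fin m, Fin 1) ≃ Fin N) (g : Fin m ≃ Fin N),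
    (∀ i, g i = e ⟨i, 0⟩) → ∀ a : C.X m, (comp N).toFun e a (fun _ => one) = C.act g a
  assoc : ∀ {m : ℕ} {n : Fin m → ℕ} {N : ℕ} (e : (Σ i, Fin (n i)) ≃ Fin N) {k : Fin N → ℕ} {M : ℕ}
    (e' : (Σ y, Fin (k y)) ≃ Fin M) {l : Fin m → ℕ}
    (d : ∀ i, (Σ j : Fin (n i), Fin (k (e ⟨i, j⟩))) ≃ Fin (l i)) (E : (Σ i, Fin (l i)) ≃ Fin M),
    (∀ i j z, E ⟨i, d i ⟨j, z⟩⟩ = e' ⟨e ⟨i, j⟩, z⟩) →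
    ∀ (a : C.X m) (b : ∀ i, C.X (n i)) (c : ∀ y, C.X (k y)),
      (comp M).toFun e' ((comp N).toFun e a b) c =
        (comp M).toFun E a (fun i => (comp (l i)).toFun (d i) (b i) (fun j => c (e ⟨i, j⟩)))

/-- A left module over an operad. -/
structure LMod (O : LOperad.{u, v} K) (R : Coll.{u, w} K) where
  lact : ∀ N : ℕ, Fam O.C R N (R.X N)
  nat : ∀ {m : ℕ} {n : Fin m → ℕ} {N N' : ℕ} (e : (Σ i, Fin (n i)) ≃ Fin N) (g : Fin N ≃ Fin N')
    (e' : (Σ i, Fin (n i)) ≃ Fin N'), (∀ i z, e' ⟨i, z⟩ = g (e ⟨i, z⟩)) →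
    ∀ (a : O.C.X m) (x : ∀ i, R.X (n i)),
      R.act g ((lact N).toFun e a x) = (lact N').toFun e' a x
  unit : ∀ {n : Fin 1 → ℕ} {N : ℕ} (e : (Σ i, Fin (n i)) ≃ Fin N) (g : Fin (n 0) ≃ Fin N),
    (∀ z, g z = e ⟨0, z⟩) → ∀ x : ∀ i, R.X (n i), (lact N).toFun e O.one x = R.act g (x 0)
  assoc : ∀ {m : ℕ} {n : Fin m → ℕ} {N : ℕ} (e : (Σ i, Fin (n i)) ≃ Fin N) {k : Fin N → ℕ} {M : ℕ}
    (e' : (Σ y, Fin (k y)) ≃ Fin M) {l : Fin m → ℕ}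
    (d : ∀ i, (Σ j : Fin (n i), Fin (k (e ⟨i, j⟩))) ≃ Fin (l i)) (E : (Σ i, Fin (l i)) ≃ Fin M),
    (∀ i j z, E ⟨i, d i ⟨j, z⟩⟩ = e' ⟨e ⟨i, j⟩, z⟩) →
    ∀ (a : O.C.X m) (b : ∀ i, O.C.X (n i)) (c : ∀ y, R.X (k y)),
      (lact M).toFun e' ((O.comp N).toFun e a b) c =
        (lact M).toFun E a (fun i => (lact (l i)).toFun (d i) (b i) (fun j => c (e ⟨i, j⟩)))

/-! ### Associativity of block numberings -/

theorem blockEquiv_val {m : ℕ} (n : Fin m → ℕ) (N : ℕ) (h : ∑ i, n i = N) (i : Fin m)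
    (z : Fin (n i)) :
    (blockEquiv n N h ⟨i, z⟩ : ℕ) = ∑ i' ∈ Finset.univ.filter (· < i), n i' + z := by
  change (finSigmaFinEquiv (n := n) ⟨i, z⟩ : ℕ) = _
  rw [finSigmaFinEquiv_apply]
  congr 1
  refine Finset.sum_bij (fun y _ => Fin.castLE i.2.le y) ?_ ?_ ?_ ?_
  · intro y _
    exact Finset.mem_filter.mpr ⟨Finset.mem_univ _, y.2⟩
  · intro y _ y' _ hy
    simpa [Fin.ext_iff] using hy
  · intro y hy
    exact ⟨⟨y, by simpa using hy⟩, Finset.mem_univ _, rfl⟩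
  · intro y _
    rfl

theorem blockEquiv_lt_of_lt {m : ℕ} (n : Fin m → ℕ) (N : ℕ) (h : ∑ i, n i = N) {i i' : Fin m}
    (hi : i < i') (z : Fin (n i)) (z' : Fin (n i')) :
    blockEquiv n N h ⟨i, z⟩ < blockEquiv n N h ⟨i', z'⟩ := by
  rw [Fin.lt_def, blockEquiv_val, blockEquiv_val]
  have h1 : ∑ x ∈ insert i (Finset.univ.filter (· < i)), n x ≤
      ∑ x ∈ Finset.univ.filter (· < i'), n x := by
    refine Finset.sum_le_sum_of_subset fun x hx => ?_
    simp only [Finset.mem_insert, Finset.mem_filter, Finset.mem_univ, true_and] at hx ⊢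
    rcases hx with rfl | hx
    · exact hi
    · exact hx.trans hi
  rw [Finset.sum_insert (by simp)] at h1
  have := z.2
  omega

theorem blockEquiv_lt_of_lt_right {m : ℕ} (n : Fin m → ℕ) (N : ℕ) (h : ∑ i, n i = N) {i : Fin m}
    {z z' : Fin (n i)} (hz : z < z') : blockEquiv n N h ⟨i, z⟩ < blockEquiv n N h ⟨i, z'⟩ := by
  rw [Fin.lt_def, blockEquiv_val, blockEquiv_val]
  exact Nat.add_lt_add_left hz _

/-- The bijection `A.symm.trans B` of `Fin M` is strictly increasing, and the identity is the only
order automorphism of `Fin M`. -/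
theorem Fin.equiv_eq_of_lt_imp_lt {α : Type*} {M : ℕ} (A B : α ≃ Fin M)
    (h : ∀ x y, A x < A y → B x < B y) : A = B := by
  have hm : StrictMono (A.symm.trans B) := fun x y hxy => h _ _ (by simpa using hxy)
  have h1 := Subsingleton.elim (hm.orderIsoOfSurjective _ (A.symm.trans B).surjective)
    (OrderIso.refl _)
  refine Equiv.ext fun x => ?_
  have h2 := congrArg (fun f : Fin M ≃o Fin M => f (A x)) h1
  simpa using h2.symm

/-- Both numberings list the triples `(i, j, z)` in lexicographic order, and a bijection onto `Fin
M` is determined by the order that it induces. -/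
theorem blockEquiv_assoc {m : ℕ} (n : Fin m → ℕ) (N : ℕ) (hN : ∑ i, n i = N) (k : Fin N → ℕ)
    (M : ℕ) (hM : ∑ x, k x = M) (i : Fin m) (j : Fin (n i))
    (z : Fin (k (blockEquiv n N hN ⟨i, j⟩))) :
    blockEquiv (fun i => ∑ j, k (blockEquiv n N hN ⟨i, j⟩)) M ((sum_blockEquiv n N hN k).trans hM)
        ⟨i, blockEquiv (fun j => k (blockEquiv n N hN ⟨i, j⟩)) _ rfl ⟨j, z⟩⟩ =
      blockEquiv k M hM ⟨blockEquiv n N hN ⟨i, j⟩, z⟩ := by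
  have hM' := (sum_blockEquiv n N hN k).trans hM
  let A : (Σ i, Σ j, Fin (k (blockEquiv n N hN ⟨i, j⟩))) ≃ Fin M :=
    (Equiv.sigmaCongrRight fun i => blockEquiv _ _ rfl).trans
      (blockEquiv (fun i => ∑ j, k (blockEquiv n N hN ⟨i, j⟩)) M
        ((sum_blockEquiv n N hN k).trans hM))
  let B : (Σ i, Σ j, Fin (k (blockEquiv n N hN ⟨i, j⟩))) ≃ Fin M :=
    ((Equiv.sigmaAssoc fun i j => Fin (k (blockEquiv n N hN ⟨i, j⟩))).symm.trans
      (Equiv.sigmaCongrLeft (β := fun y => Fin (k y)) (blockEquiv n N hN))).trans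
      (blockEquiv k M hM)
  suffices h : A = B from congrArg (fun f => f ⟨i, j, z⟩) h
  refine Fin.equiv_eq_of_lt_imp_lt A B ?_
  rintro ⟨i, j, z⟩ ⟨i', j', z'⟩ hlt
  rcases lt_trichotomy i i' with hi | rfl | hi
  · exact blockEquiv_lt_of_lt k M hM (blockEquiv_lt_of_lt n N hN hi _ _) _ _
  · rcases lt_trichotomy j j' with hj | rfl | hj
    · exact blockEquiv_lt_of_lt k M hM (blockEquiv_lt_of_lt_right n N hN hj) _ _
    · rcases lt_trichotomy z z' with hz | rfl | hz
      · exact blockEquiv_lt_of_lt_right k M hM hz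
      · exact absurd hlt (lt_irrefl _)
      · exact absurd hlt (lt_asymm (blockEquiv_lt_of_lt_right _ M hM'
          (blockEquiv_lt_of_lt_right _ _ _ hz)))
    · exact absurd hlt (lt_asymm (blockEquiv_lt_of_lt_right _ M hM'
        (blockEquiv_lt_of_lt _ _ _ hj _ _)))
  · exact absurd hlt (lt_asymm (blockEquiv_lt_of_lt _ M hM' hi _ _))

/-! ### The composition of an operad for arbitrary numberings -/

namespace SymOperad

variable (P : SymOperad.{u, v} K)

/-- The collection of an operad. -/
@[reducible] noncomputable def toColl : Coll.{u, v} K := Coll.ofRep P.coll.obj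

/-- The composition of an operad for an arbitrary numbering of the labels. -/
noncomputable def lcomp {m : ℕ} {n : Fin m → ℕ} {N : ℕ} (e : (Σ i, Fin (n i)) ≃ Fin N) :
    P.toColl.X m →ₗ[K] MultilinearMap K (fun i => P.toColl.X (n i)) (P.toColl.X N) :=
  (LinearMap.compMultilinearMapₗ K (P.toColl.act ((blockEquiv n _ rfl).symm.trans e))) ∘ₗ
    P.str.comp n _ rfl

/-- The arity `N` of the composite is free here, so that the equation `∑ i, n i = N` never has to be
used as a cast. -/
theorem lcomp_eq {m : ℕ} {n : Fin m → ℕ} {N N' : ℕ} (h : ∑ i, n i = N)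
    (e : (Σ i, Fin (n i)) ≃ Fin N') (g : Fin N ≃ Fin N')
    (hg : ∀ i z, e ⟨i, z⟩ = g (blockEquiv n N h ⟨i, z⟩)) (a : P.toColl.X m)
    (x : ∀ i, P.toColl.X (n i)) :
    P.lcomp e a x = P.toColl.act g (P.str.comp n N h a x) := by
  subst h
  obtain rfl : g = (blockEquiv n _ rfl).symm.trans e := Equiv.ext fun y => by
    obtain ⟨⟨i, z⟩, rfl⟩ := (blockEquiv n _ rfl).surjective y
    simp [hg]
  rfl

theorem lcomp_blockEquiv {m : ℕ} {n : Fin m → ℕ} {N : ℕ} (h : ∑ i, n i = N) (a : P.toColl.X m)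
    (x : ∀ i, P.toColl.X (n i)) : P.lcomp (blockEquiv n N h) a x = P.str.comp n N h a x := by
  rw [P.lcomp_eq h _ (Equiv.refl _) (fun _ _ => rfl)]
  exact P.toColl.act_refl _

theorem sum_eq_of_sigma_equiv {m : ℕ} {n : Fin m → ℕ} {N : ℕ} (e : (Σ i, Fin (n i)) ≃ Fin N) :
    ∑ i, n i = N :=
  Fin.equiv_iff_eq.mp ⟨(blockEquiv n _ rfl).symm.trans e⟩

theorem lcomp_nat {m : ℕ} {n : Fin m → ℕ} {N N' : ℕ} (e : (Σ i, Fin (n i)) ≃ Fin N)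
    (g : Fin N ≃ Fin N') (e' : (Σ i, Fin (n i)) ≃ Fin N')
    (he : ∀ i z, e' ⟨i, z⟩ = g (e ⟨i, z⟩)) (a : P.toColl.X m) (x : ∀ i, P.toColl.X (n i)) :
    P.toColl.act g (P.lcomp e a x) = P.lcomp e' a x := by
  rw [P.lcomp_eq rfl e ((blockEquiv n _ rfl).symm.trans e) (fun i z => by simp),
    P.lcomp_eq rfl e' ((blockEquiv n _ rfl).symm.trans e') (fun i z => by simp)]
  refine P.toColl.act_act_eq _ _ _ (fun z => ?_) _
  obtain ⟨⟨i, z⟩, rfl⟩ := (blockEquiv n _ rfl).surjective z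
  simp [he]

/-- Factor `e` as the block numbering followed by a relabelling. The claim is then `comp_perm_left`,
as `blockPerm` is the discrepancy between the two orders of the blocks. -/
theorem lcomp_left {m m' : ℕ} (σ : Fin m ≃ Fin m') {n : Fin m' → ℕ} {N : ℕ}
    (e : (Σ i, Fin (n i)) ≃ Fin N) (e' : (Σ i, Fin (n (σ i))) ≃ Fin N)
    (he : ∀ i z, e' ⟨i, z⟩ = e ⟨σ i, z⟩) (a : P.toColl.X m) (x : ∀ i, P.toColl.X (n i)) :
    P.lcomp e (P.toColl.act σ a) x = P.lcomp e' a (fun i => x (σ i)) := by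
  obtain rfl : m = m' := Fin.equiv_iff_eq.mp ⟨σ⟩
  have h := P.str.comp_perm_left n _ rfl σ a x
  rw [P.lcomp_eq rfl e ((blockEquiv n _ rfl).symm.trans e) (fun i z => by simp)]
  change P.toColl.act _ (P.str.comp n _ rfl ((P.coll.obj m).ρ σ a) x) = _
  rw [h]
  change P.toColl.act _ (P.toColl.act (blockPerm n _ rfl σ) _) = _
  rw [P.lcomp_eq (sum_comp_perm n _ rfl σ) e'
    ((blockPerm n _ rfl σ).trans ((blockEquiv n _ rfl).symm.trans e)) (fun i z => ?_)]
  · exact P.toColl.act_act_eq _ _ _ (fun z => rfl) _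
  · simp [blockPerm, he]

theorem lcomp_right {m : ℕ} {n n' : Fin m → ℕ} {N : ℕ} (f : ∀ i, Fin (n i) ≃ Fin (n' i))
    (e : (Σ i, Fin (n' i)) ≃ Fin N) (e' : (Σ i, Fin (n i)) ≃ Fin N)
    (he : ∀ i z, e' ⟨i, z⟩ = e ⟨i, f i z⟩) (a : P.toColl.X m) (x : ∀ i, P.toColl.X (n i)) :
    P.lcomp e a (fun i => P.toColl.act (f i) (x i)) = P.lcomp e' a x := by
  obtain rfl : n = n' := funext fun i => Fin.equiv_iff_eq.mp ⟨f i⟩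
  have h := P.str.comp_perm_right n _ rfl f a x
  rw [P.lcomp_eq rfl e ((blockEquiv n _ rfl).symm.trans e) (fun i z => by simp),
    P.lcomp_eq rfl e' ((blockEquiv n _ rfl).symm.trans e') (fun i z => by simp)]
  refine (congrArg _ h).trans ?_
  change P.toColl.act _ (P.toColl.act ((blockEquiv n _ rfl).permCongr
    (Equiv.sigmaCongrRight f)) _) = _
  refine P.toColl.act_act_eq _ _ _ (fun z => ?_) _
  obtain ⟨⟨i, z⟩, rfl⟩ := (blockEquiv n _ rfl).surjective z
  simp [he, Equiv.permCongr_apply]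

/-- The composition of an operad as a compatible family. -/
noncomputable def fam (N : ℕ) : Fam P.toColl P.toColl N (P.toColl.X N) where
  toFun := P.lcomp
  left := fun σ _ => P.lcomp_left σ
  right := fun f => P.lcomp_right f

/-- All numberings are reduced to consecutive ones. The relabelling `g` contained in `e` is absorbed
by `lcomp_left`, and each `d i` is a relabelling of the block numbering `q i`, absorbed by
`lcomp_right`. There remain the associativity axiom and `blockEquiv_assoc`. -/
theorem lcomp_assoc {m : ℕ} {n : Fin m → ℕ} {N : ℕ} (e : (Σ i, Fin (n i)) ≃ Fin N)
    {k : Fin N → ℕ} {M : ℕ} (e' : (Σ y, Fin (k y)) ≃ Fin M) {l : Fin m → ℕ}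
    (d : ∀ i, (Σ j : Fin (n i), Fin (k (e ⟨i, j⟩))) ≃ Fin (l i)) (E : (Σ i, Fin (l i)) ≃ Fin M)
    (hE : ∀ i j z, E ⟨i, d i ⟨j, z⟩⟩ = e' ⟨e ⟨i, j⟩, z⟩)
    (a : P.toColl.X m) (b : ∀ i, P.toColl.X (n i)) (c : ∀ y, P.toColl.X (k y)) :
    P.lcomp e' (P.lcomp e a b) c =
      P.lcomp E a (fun i => P.lcomp (d i) (b i) (fun j => c (e ⟨i, j⟩))) := by
  obtain rfl : ∑ i, n i = N := sum_eq_of_sigma_equiv e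
  obtain ⟨g, rfl⟩ : ∃ g, e = (blockEquiv n _ rfl).trans g :=
    ⟨(blockEquiv n _ rfl).symm.trans e, by ext; simp⟩
  rw [P.lcomp_eq rfl _ g (fun _ _ => rfl), P.lcomp_left g e'
    ((Equiv.sigmaCongrLeft (β := fun y => Fin (k y)) g).trans e') (fun _ _ => rfl),
    P.lcomp_eq rfl _ ((blockEquiv (fun y => k (g y)) _ rfl).symm.trans
      ((Equiv.sigmaCongrLeft (β := fun y => Fin (k y)) g).trans e')) (fun i z => by simp),
    P.str.assoc]
  let q (i : Fin m) : (Σ j : Fin (n i), Fin (k (g (blockEquiv n _ rfl ⟨i, j⟩)))) ≃ _ :=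
    blockEquiv _ _ rfl
  have hR : (fun i => P.lcomp (d i) (b i) (fun j => c (g (blockEquiv n _ rfl ⟨i, j⟩)))) =
      fun i => P.toColl.act ((q i).symm.trans (d i)) (P.str.comp
        (fun j => k (g (blockEquiv n _ rfl ⟨i, j⟩))) _ rfl (b i)
          (fun j => c (g (blockEquiv n _ rfl ⟨i, j⟩)))) :=
    funext fun i => P.lcomp_eq rfl _ _
      (fun j z => congrArg (d i) ((q i).symm_apply_apply ⟨j, z⟩).symm) _ _
  refine Eq.trans ?_ (congrArg (P.lcomp E a) hR.symm)
  rw [P.lcomp_right (fun i => (q i).symm.trans (d i)) E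
    ((Equiv.sigmaCongrRight fun i => (q i).symm.trans (d i)).trans E) (fun _ _ => rfl)]
  refine (P.lcomp_eq _ _ _ (fun i z => ?_) _ _).symm
  obtain ⟨⟨j, z⟩, rfl⟩ := (q i).surjective z
  have h1 : ((Equiv.sigmaCongrRight fun i => (q i).symm.trans (d i)).trans E) ⟨i, q i ⟨j, z⟩⟩ =
      e' ⟨g (blockEquiv n _ rfl ⟨i, j⟩), z⟩ := by
    refine Eq.trans ?_ (hE i j z)
    exact congrArg (fun y => E ⟨i, d i y⟩) ((q i).symm_apply_apply ⟨j, z⟩)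
  refine h1.trans ?_
  have h2 := blockEquiv_assoc n _ rfl (fun y => k (g y)) _ rfl i j z
  refine Eq.trans ?_ (congrArg _ h2.symm)
  simp only [Equiv.trans_apply, Equiv.symm_apply_apply]
  rfl

theorem lcomp_one_left {n : Fin 1 → ℕ} {N : ℕ} (e : (Σ i, Fin (n i)) ≃ Fin N)
    (g : Fin (n 0) ≃ Fin N) (hg : ∀ z, g z = e ⟨0, z⟩) (x : ∀ i, P.toColl.X (n i)) :
    P.lcomp e P.str.one x = P.toColl.act g (x 0) := by
  obtain ⟨k, rfl⟩ : ∃ k, n = fun _ => k := ⟨n 0, funext fun i => by rw [Subsingleton.elim i 0]⟩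
  obtain ⟨y, rfl⟩ : ∃ y : P.toColl.X k, x = fun _ => y :=
    ⟨x 0, funext fun i => by rw [Subsingleton.elim i 0]⟩
  rw [P.lcomp_eq (by simp) e g (fun i z => ?_)]
  · exact congrArg _ (P.str.one_comp k y)
  · obtain rfl := Subsingleton.elim i 0
    rw [← hg]
    congr 1
    refine Fin.ext ?_
    rw [blockEquiv_val]
    simp

theorem lcomp_one_right {m N : ℕ} (e : (Σ _ : Fin m, Fin 1) ≃ Fin N) (g : Fin m ≃ Fin N)
    (hg : ∀ i, g i = e ⟨i, 0⟩) (a : P.toColl.X m) :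
    P.lcomp e a (fun _ => P.str.one) = P.toColl.act g a := by
  rw [P.lcomp_eq (by simp) e g (fun i z => ?_)]
  · exact congrArg _ (P.str.comp_one m a)
  · obtain rfl := Subsingleton.elim z 0
    rw [← hg]
    congr 1
    refine Fin.ext ?_
    rw [blockEquiv_val]
    simp [Finset.filter_gt_eq_Iio]

/-- The labelled form of an operad. -/
@[reducible] noncomputable def toLOperad : LOperad.{u, v} K where
  C := P.toColl
  zero := P.coll.subsingleton_zero
  one := P.str.one
  comp := P.fam
  nat := P.lcomp_nat
  one_comp := P.lcomp_one_left
  comp_one := P.lcomp_one_right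
  assoc := P.lcomp_assoc

namespace Hom

variable {P} {Q : SymOperad.{u, w} K} (ψ : Hom P Q)

theorem map_act {a b : ℕ} (e : Fin a ≃ Fin b) (x : P.toColl.X a) :
    ψ.map b (P.toColl.act e x) = Q.toColl.act e (ψ.map a x) := by
  obtain rfl : a = b := Fin.equiv_iff_eq.mp ⟨e⟩
  exact ψ.map_perm a e x

theorem map_lcomp {m : ℕ} {n : Fin m → ℕ} {N : ℕ} (e : (Σ i, Fin (n i)) ≃ Fin N)
    (a : P.toColl.X m) (x : ∀ i, P.toColl.X (n i)) :
    ψ.map N (P.lcomp e a x) = Q.lcomp e (ψ.map m a) (fun i => ψ.map (n i) (x i)) := by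
  have he : ∀ i z, e ⟨i, z⟩ = ((blockEquiv n _ rfl).symm.trans e) (blockEquiv n _ rfl ⟨i, z⟩) :=
    fun i z => by simp
  rw [P.lcomp_eq rfl e _ he, Q.lcomp_eq rfl e _ he]
  exact (ψ.map_act _ _).trans (congrArg _ (ψ.map_comp n _ rfl a x))

/-- The target of a morphism of operads is a left module over the source. -/
noncomputable def lmod : LMod P.toLOperad Q.toColl where
  lact N :=
    { toFun := fun {_ _} (e : _ ≃ Fin N) => Q.lcomp e ∘ₗ ψ.map _
      left := fun σ _ e e' he a x =>
        (congrArg (fun y => Q.lcomp e y x) (ψ.map_act σ a)).trans (Q.lcomp_left σ e e' he _ x)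
      right := fun f e e' he _ x => Q.lcomp_right f e e' he _ x }
  nat e g e' he _ x := Q.lcomp_nat e g e' he _ x
  unit e g hg x := (congrArg (fun y => Q.lcomp e y x) ψ.map_one).trans (Q.lcomp_one_left e g hg x)
  assoc e _ _ e' _ d E hE a b c :=
    (congrArg (fun y => Q.lcomp e' y c) (ψ.map_lcomp e a b)).trans
      (Q.lcomp_assoc e e' d E hE _ _ c)

end Hom

end SymOperad

end LOperad

/-! ## The universal property of the modules `T(n)^c` -/

/-- Turns a transport between the types of `x p` and `x q` into a relabelling, to which the axioms
of a collection apply. -/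
theorem Coll.apply_eq_act {K : Type u} [Field K] (X : Coll.{u, v} K) {I : Type*} {n : I → ℕ}
    (x : ∀ i, X.X (n i)) {p q : I} (h : p = q) :
    x q = X.act (finCongr (congrArg n h)) (x p) := by
  subst h
  exact (X.act_eq_self _ (fun z => rfl) _).symm

theorem Fam.rel {K : Type u} [Field K] {A : Coll.{u, v} K} {X : Coll.{u, w} K} {N : ℕ} {M : Type*}
    [AddCommGroup M] [Module K M] (F : Fam A X N M) {m m' : ℕ} (σ : Fin m ≃ Fin m')
    {n : Fin m' → ℕ} {n' : Fin m → ℕ} (f : ∀ i, Fin (n' i) ≃ Fin (n (σ i)))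
    (e : (Σ i, Fin (n i)) ≃ Fin N) (e' : (Σ i, Fin (n' i)) ≃ Fin N)
    (he : ∀ i z, e' ⟨i, z⟩ = e ⟨σ i, f i z⟩) (a : A.X m) (x : ∀ i, X.X (n i))
    (x' : ∀ i, X.X (n' i)) (hx : ∀ i, x (σ i) = X.act (f i) (x' i)) :
    F.toFun e (A.act σ a) x = F.toFun e' a x' := by
  rw [F.left σ e ((Equiv.sigmaCongrLeft (β := fun i => Fin (n i)) σ).trans e) (fun _ _ => rfl)]
  rw [← F.right f ((Equiv.sigmaCongrLeft (β := fun i => Fin (n i)) σ).trans e) e' he]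
  exact congrArg _ (funext hx)

theorem DescPartition.two_le_card {N : ℕ} (l : DescPartition N) : 2 ≤ N := by
  have h := Finset.sum_le_sum (s := Finset.univ) fun i _ => Nat.succ_le_of_lt (l.pos i)
  have h2 := l.two_le
  rw [l.sum_eq] at h
  simp at h
  omega

/-- A finite family has only one arrangement in descending order. -/
theorem DescPartition.eq_of_equiv {N : ℕ} (l l' : DescPartition N) (σ : Fin l'.m ≃ Fin l.m)
    (h : ∀ i, l'.part i = l.part (σ i)) : l = l' := by
  obtain ⟨m, _, p, hp, _, _⟩ := l
  obtain ⟨m', _, p', hp', _, _⟩ := l'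
  obtain rfl : m' = m := Fin.equiv_iff_eq.mp ⟨σ⟩
  obtain rfl : p = p' := by
    have h1 : Monotone ((fun i => OrderDual.toDual (p i)) ∘ σ) := by
      have : (fun i => OrderDual.toDual (p i)) ∘ σ = fun i => OrderDual.toDual (p' i) :=
        funext fun i => congrArg _ (h i).symm
      rw [this]
      exact fun i j hij => hp' hij
    have h2 : Monotone ((fun i => OrderDual.toDual (p i)) ∘ (Equiv.refl _ : Equiv.Perm (Fin m'))) :=
      fun i j hij => hp hij
    have h3 := Tuple.unique_monotone h1 h2
    funext i
    exact ((h i).trans (congrFun h3 i)).symm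
  rfl

/-- The induced module is the space of coinvariants of `G` on `K[H] ⊗ A`, and the two elements come
from tensors that `s` maps to one another. -/
theorem indV_mk_mul {K G H A : Type*} [CommRing K] [Group G] [Group H] (φ : G →* H)
    [AddCommGroup A] [Module K A] (ρ : Representation K G A) (s : G) (h : H) {a b : A}
    (hab : ρ s a = b) :
    Representation.IndV.mk φ ρ (φ s * h) b = Representation.IndV.mk φ ρ h a := by
  subst hab
  have := Representation.Coinvariants.mk_self_apply
    (Representation.tprod ((Representation.leftRegular K H).comp φ) ρ) s
    ((MonoidAlgebra.single h (1 : K)) ⊗ₜ[K] a)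
  refine Eq.trans ?_ this
  simp

/-- A linear map on `K[G] ⊗ V` given by its values on the elements of `G`. -/
noncomputable def groupAlgebraLift {K G V M : Type*} [CommRing K] [AddCommGroup V]
    [Module K V] [AddCommGroup M] [Module K M] (f : G → V →ₗ[K] M) :
    MonoidAlgebra K G ⊗[K] V →ₗ[K] M :=
  TensorProduct.lift ((Finsupp.lift _ _ _ f) ∘ₗ (MonoidAlgebra.coeffLinearEquiv K).toLinearMap)

theorem groupAlgebraLift_apply {K G V M : Type*} [CommRing K] [AddCommGroup V]
    [Module K V] [AddCommGroup M] [Module K M] (f : G → V →ₗ[K] M) (g : G) (x : V) :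
    groupAlgebraLift f (MonoidAlgebra.single g 1 ⊗ₜ[K] x) = f g x := by
  simp [groupAlgebraLift]

section TreeModules

variable {K : Type u} [Field K]

theorem repCast_ρ {G : Type*} [Group G] {A B : Rep.{u} K G} (h : A = B) (g : G) (a : A) :
    repCast h (A.ρ g a) = B.ρ g (repCast h a) := by
  subst h
  rfl

theorem repCast_symm_ρ {G : Type*} [Group G] {A B : Rep.{u} K G} (h : A = B) (g : G) (b : B) :
    (repCast h).symm (B.ρ g b) = A.ρ g ((repCast h).symm b) := by
  subst h
  rfl

theorem permMap_eq_repAct {N : ℕ} (R : ∀ n : ℕ, Rep.{u} K (Equiv.Perm (Fin n))) {a b : ℕ}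
    (ha : a < N) (hb : b < N) (e : Fin a ≃ Fin b) :
    permMap (fun k _ => R k) ha hb e = repAct R e := by
  obtain rfl : a = b := Fin.equiv_iff_eq.mp ⟨e⟩
  rfl

variable (O₁ O₂ : SymOperad.{u, u} K)

/-- The modules `T(n)^c` as a collection. -/
@[reducible] noncomputable def treeColl (c : Colour) : Coll.{u, u} K :=
  Coll.ofRep (treeRep O₁ O₂ c)

/-- The operad of labels of the vertices of colour `c`, in labelled form. -/
@[reducible] noncomputable def labelOperad (c : Colour) : LOperad.{u, u} K :=
  (c.label O₁ O₂).toLOperad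

/-- `sortedVertex` as a multilinear map. -/
noncomputable def sortedMap (c : Colour) : ∀ {N : ℕ} (l : DescPartition N),
    (labelOperad O₁ O₂ c).C.X l.m →ₗ[K]
      MultilinearMap K (fun i => (treeColl O₁ O₂ c.swap).X (l.part i)) ((treeColl O₁ O₂ c).X N)
  | 0, _ => 0
  | 1, _ => 0
  | N + 2, l =>
    (LinearMap.compMultilinearMapₗ K ((repCast (treeRep_eq O₁ O₂ c (N + 2))).symm.toLinearMap ∘ₗ
      (by
        classical
        exact DirectSum.lof K (DescPartition _)
          (fun l => (Rep.ind l.blockHom (labelledBlockRep (c.label O₁ O₂)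
            (fun k _ => treeRep O₁ O₂ c.swap k) l) : Type u)) l) ∘ₗ
        (Representation.IndV.mk l.blockHom (labelledBlockRep (c.label O₁ O₂)
            (fun k _ => treeRep O₁ O₂ c.swap k) l).ρ 1))) ∘ₗ
      (PiTensorProduct.lift.symm.toLinearMap ∘ₗ TensorProduct.mk K ((c.label O₁ O₂).obj l.m)
        (⨂[K] i, treeRep O₁ O₂ c.swap (l.part i)))

theorem sortedMap_apply (c : Colour) {N : ℕ} (l : DescPartition N)
    (ν : (labelOperad O₁ O₂ c).C.X l.m) (x : ∀ i, (treeColl O₁ O₂ c.swap).X (l.part i)) :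
    sortedMap O₁ O₂ c l ν x = sortedVertex O₁ O₂ c l ν x :=
  match N, l, x with
  | 0, _, _ => rfl
  | 1, _, _ => rfl
  | _ + 2, _, _ => rfl

/-- The relabelling of a generator. -/
theorem act_sortedMap (c : Colour) {N : ℕ} (l : DescPartition (N + 2))
    (g : Fin (N + 2) ≃ Fin (N + 2))
    (ν : (labelOperad O₁ O₂ c).C.X l.m) (x : ∀ i, (treeColl O₁ O₂ c.swap).X (l.part i)) :
    (treeColl O₁ O₂ c).act g (sortedMap O₁ O₂ c l ν x) =
      (repCast (treeRep_eq O₁ O₂ c (N + 2))).symm (by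
        classical
        exact DirectSum.lof K (DescPartition _)
          (fun l => (Rep.ind l.blockHom (labelledBlockRep (c.label O₁ O₂)
            (fun k _ => treeRep O₁ O₂ c.swap k) l) : Type u)) l
          (Representation.IndV.mk l.blockHom (labelledBlockRep (c.label O₁ O₂)
            (fun k _ => treeRep O₁ O₂ c.swap k) l).ρ g⁻¹ (ν ⊗ₜ[K] PiTensorProduct.tprod K x))) := by
  classical
  refine (repCast_symm_ρ (treeRep_eq O₁ O₂ c (N + 2)) g _).symm.trans (congrArg _ ?_)
  refine (DirectSum.lmap_lof _ _ _).trans (congrArg _ ?_)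
  refine (Representation.ind_mk _ _ _ _ _).trans ?_
  rw [one_mul]
  rfl

theorem labelledBlockRep_apply (c : Colour) {N : ℕ} (l : DescPartition N) (s : l.blockGroup)
    (ν : (labelOperad O₁ O₂ c).C.X l.m) (x : ∀ i, (treeColl O₁ O₂ c.swap).X (l.part i)) :
    (labelledBlockRep (c.label O₁ O₂) (fun k _ => treeRep O₁ O₂ c.swap k) l).ρ s
        (ν ⊗ₜ[K] PiTensorProduct.tprod K x) =
      (labelOperad O₁ O₂ c).C.act s.1.1 ν ⊗ₜ[K] PiTensorProduct.tprod K
        (fun j => (treeColl O₁ O₂ c.swap).act (l.blockBij s j) (x (s.1.1.symm j))) := by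
  refine (TensorProduct.map_tmul _ _ _ _).trans (congrArg _ ?_)
  change PiTensorProduct.map _ (PiTensorProduct.reindex K
    (fun i => (treeRep O₁ O₂ c.swap (l.part i) : Type u)) s.1.1 (PiTensorProduct.tprod K x)) = _
  rw [PiTensorProduct.reindex_tprod, PiTensorProduct.map_tprod]
  refine congrArg _ (funext fun j => ?_)
  exact congrArg (fun f => f (x (s.1.1.symm j)))
    (permMap_eq_repAct (treeRep O₁ O₂ c.swap) (l.part_lt _) (l.part_lt _) (l.blockBij s j))

/-- Descending partitions with matching parts are equal, so the bijections `σ` of branches and `f`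
of labels together form an element `s` of `S(λ)`. The two sides are generators of the induced module
that differ by `s`, and the coinvariants identify them. -/
theorem sortedMap_rel (c : Colour) {N : ℕ} (l l' : DescPartition N) (σ : Fin l'.m ≃ Fin l.m)
    (f : ∀ i, Fin (l'.part i) ≃ Fin (l.part (σ i))) (g g' : Fin N ≃ Fin N)
    (hg : ∀ i z, g' (blockEquiv l'.part N l'.sum_eq ⟨i, z⟩) =
      g (blockEquiv l.part N l.sum_eq ⟨σ i, f i z⟩))
    (ν : (labelOperad O₁ O₂ c).C.X l'.m) (x : ∀ i, (treeColl O₁ O₂ c.swap).X (l.part i))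
    (x' : ∀ i, (treeColl O₁ O₂ c.swap).X (l'.part i))
    (hx : ∀ i, x (σ i) = (treeColl O₁ O₂ c.swap).act (f i) (x' i)) :
    (treeColl O₁ O₂ c).act g (sortedMap O₁ O₂ c l ((labelOperad O₁ O₂ c).C.act σ ν) x) =
      (treeColl O₁ O₂ c).act g' (sortedMap O₁ O₂ c l' ν x') := by
  obtain rfl := l.eq_of_equiv l' σ fun i => Fin.equiv_iff_eq.mp ⟨f i⟩
  obtain ⟨k, rfl⟩ : ∃ k, N = k + 2 := ⟨N - 2, by have := l.two_le_card; omega⟩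
  let p : Equiv.Perm (Σ i : Fin l.m, Fin (l.part i)) :=
    (Equiv.sigmaCongrRight f).trans (Equiv.sigmaCongrLeft (β := fun i => Fin (l.part i)) σ)
  let s : l.blockGroup := ⟨(σ, p), fun _ => rfl⟩
  rw [act_sortedMap, act_sortedMap]
  have h1 := labelledBlockRep_apply O₁ O₂ c l s ν x'
  have h2 : (fun j => (treeColl O₁ O₂ c.swap).act (l.blockBij s j) (x' (s.1.1.symm j))) = x := by
    funext j
    obtain ⟨i, rfl⟩ := σ.surjective j
    rw [hx, (treeColl O₁ O₂ c.swap).apply_eq_act x' (σ.symm_apply_apply i).symm]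
    refine (treeColl O₁ O₂ c.swap).act_act_eq _ _ _ (fun z => ?_) _
    refine Fin.ext ?_
    exact congrArg (fun y => ((p y).2 : ℕ))
      (sigma_cast l.part ⟨i, z⟩ _ (σ.symm_apply_apply i).symm).symm
  rw [h2] at h1
  refine congrArg _ (congrArg _ ?_)
  -- A relabelling by `g` becomes the group element `g⁻¹` in `act_sortedMap`, so the relation
  -- between `g` and `g'` is needed in inverted form.
  have hs : g⁻¹ = l.blockHom s * g'⁻¹ := by
    rw [eq_mul_inv_iff_mul_eq, inv_mul_eq_iff_eq_mul]
    refine Equiv.ext fun y => ?_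
    obtain ⟨⟨i, z⟩, rfl⟩ := (blockEquiv l.part _ l.sum_eq).surjective y
    refine (hg i z).trans (congrArg g ?_)
    change _ = blockEquiv l.part _ l.sum_eq
      (p ((blockEquiv l.part _ l.sum_eq).symm (blockEquiv l.part _ l.sum_eq ⟨i, z⟩)))
    rw [Equiv.symm_apply_apply]
    rfl
  rw [hs]
  exact indV_mk_mul l.blockHom _ s g'⁻¹ h1

/-- The numbering used in the definition of `vertex`. -/
def sortedNumbering {m : ℕ} {n : Fin m → ℕ} {N : ℕ} (e : (Σ i, Fin (n i)) ≃ Fin N)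
    (τ : Equiv.Perm (Fin m)) : Fin N ≃ Fin N :=
  (blockEquiv (fun i => n (τ i)) N
    (sum_comp_perm n N (SymOperad.sum_eq_of_sigma_equiv e) τ)).symm.trans
    ((Equiv.sigmaCongrLeft (β := fun i => Fin (n i)) τ).trans e)

theorem sortedNumbering_apply {m : ℕ} {n : Fin m → ℕ} {N : ℕ} (e : (Σ i, Fin (n i)) ≃ Fin N)
    (τ : Equiv.Perm (Fin m)) (i : Fin m) (z : Fin (n (τ i))) (h : ∑ i, n (τ i) = N) :
    sortedNumbering e τ (blockEquiv (fun i => n (τ i)) N h ⟨i, z⟩) = e ⟨τ i, z⟩ := by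
  simp [sortedNumbering]

/-- The permutation that sorts the parts of a composition in descending order. -/
def sortPerm {m : ℕ} (n : Fin m → ℕ) : Equiv.Perm (Fin m) :=
  Tuple.sort (fun i => OrderDual.toDual (n i))

open Classical in
/-- The tree with root label `ν ∈ O(m)`, `m ≥ 2`, and branches `x₁, …, x_m`, the leaves being
numbered by `e`; it is zero in the excluded degenerate cases. -/
noncomputable def vertMap (c : Colour) {m : ℕ} {n : Fin m → ℕ} {N : ℕ}
    (e : (Σ i, Fin (n i)) ≃ Fin N) :
    (labelOperad O₁ O₂ c).C.X m →ₗ[K]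
      MultilinearMap K (fun i => (treeColl O₁ O₂ c.swap).X (n i)) ((treeColl O₁ O₂ c).X N) :=
  if h : 2 ≤ m ∧ ∀ i, 0 < n i then
    (LinearMap.compMultilinearMapₗ K ((treeColl O₁ O₂ c).act (sortedNumbering e (sortPerm n))) ∘ₗ
      (MultilinearMap.domDomCongrLinearEquiv' K K
        (fun i => (treeColl O₁ O₂ c.swap).X (n i)) _ (sortPerm n).symm).symm.toLinearMap) ∘ₗ
      (sortedMap O₁ O₂ c
        (sortedPartition h.1 n h.2 N (SymOperad.sum_eq_of_sigma_equiv e)) ∘ₗ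
        (labelOperad O₁ O₂ c).C.act (sortPerm n).symm)
  else 0

theorem vertMap_apply (c : Colour) {m : ℕ} {n : Fin m → ℕ} {N : ℕ}
    (e : (Σ i, Fin (n i)) ≃ Fin N) (hm : 2 ≤ m) (hn : ∀ i, 0 < n i)
    (ν : (labelOperad O₁ O₂ c).C.X m) (x : ∀ i, (treeColl O₁ O₂ c.swap).X (n i)) :
    vertMap O₁ O₂ c e ν x = (treeColl O₁ O₂ c).act (sortedNumbering e (sortPerm n))
      (sortedMap O₁ O₂ c (sortedPartition hm n hn N (SymOperad.sum_eq_of_sigma_equiv e))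
        ((labelOperad O₁ O₂ c).C.act (sortPerm n).symm ν) (fun i => x (sortPerm n i))) := by
  rw [vertMap, dif_pos ⟨hm, hn⟩]
  rfl

theorem vertMap_blockEquiv (c : Colour) {m : ℕ} (n : Fin m → ℕ) (N : ℕ) (h : ∑ i, n i = N)
    (hm : 2 ≤ m) (hn : ∀ i, 0 < n i)
    (ν : (labelOperad O₁ O₂ c).C.X m) (x : ∀ i, (treeColl O₁ O₂ c.swap).X (n i)) :
    vertMap O₁ O₂ c (blockEquiv n N h) ν x = vertex O₁ O₂ c hm n hn N h ν x := by
  rw [vertMap_apply O₁ O₂ c _ hm hn]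
  exact congrArg _ (sortedMap_apply O₁ O₂ c _ _ _)

/-- Numberings of the branches of a tree may be changed by bijections of branches and labels. -/
theorem vertMap_rel (c : Colour) {N m m' : ℕ} (σ : Fin m ≃ Fin m')
    {n : Fin m' → ℕ} {n' : Fin m → ℕ} (f : ∀ i, Fin (n' i) ≃ Fin (n (σ i)))
    (e : (Σ i, Fin (n i)) ≃ Fin N) (e' : (Σ i, Fin (n' i)) ≃ Fin N)
    (he : ∀ i z, e' ⟨i, z⟩ = e ⟨σ i, f i z⟩) (ν : (labelOperad O₁ O₂ c).C.X m)
    (x : ∀ i, (treeColl O₁ O₂ c.swap).X (n i)) (x' : ∀ i, (treeColl O₁ O₂ c.swap).X (n' i))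
    (hx : ∀ i, x (σ i) = (treeColl O₁ O₂ c.swap).act (f i) (x' i)) :
    vertMap O₁ O₂ c e ((labelOperad O₁ O₂ c).C.act σ ν) x = vertMap O₁ O₂ c e' ν x' := by
  obtain rfl : m = m' := Fin.equiv_iff_eq.mp ⟨σ⟩
  have hnn : ∀ i, n' i = n (σ i) := fun i => Fin.equiv_iff_eq.mp ⟨f i⟩
  by_cases h : 2 ≤ m ∧ ∀ i, 0 < n i
  · have h' : ∀ i, 0 < n' i := fun i => (h.2 (σ i)).trans_eq (hnn i).symm
    rw [vertMap_apply O₁ O₂ c e h.1 h.2, vertMap_apply O₁ O₂ c e' h.1 h']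
    let τ := sortPerm n
    let τ' := sortPerm n'
    -- The bijection of branches that `σ` induces after the branches on both sides have been sorted.
    let π : Fin m ≃ Fin m := (τ'.trans σ).trans τ.symm
    have hπ : ∀ i, σ (τ' i) = τ (π i) := fun i => (τ.apply_symm_apply _).symm
    have h1 : (labelOperad O₁ O₂ c).C.act τ.symm ((labelOperad O₁ O₂ c).C.act σ ν) =
        (labelOperad O₁ O₂ c).C.act π ((labelOperad O₁ O₂ c).C.act τ'.symm ν) := by
      rw [(labelOperad O₁ O₂ c).C.act_act_eq σ τ.symm (σ.trans τ.symm) (fun _ => rfl),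
        (labelOperad O₁ O₂ c).C.act_act_eq τ'.symm π (σ.trans τ.symm) (fun z => ?_)]
      change τ.symm (σ z) = τ.symm (σ (τ' (τ'.symm z)))
      rw [τ'.apply_symm_apply]
    refine (congrArg (fun a => (treeColl O₁ O₂ c).act (sortedNumbering e τ)
      (sortedMap O₁ O₂ c (sortedPartition h.1 n h.2 N (SymOperad.sum_eq_of_sigma_equiv e)) a
        (fun i => x (τ i)))) h1).trans ?_
    refine sortedMap_rel O₁ O₂ c
      (sortedPartition h.1 n h.2 N (SymOperad.sum_eq_of_sigma_equiv e))
      (sortedPartition h.1 n' h' N (SymOperad.sum_eq_of_sigma_equiv e')) π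
      (fun i => (f (τ' i)).trans (finCongr (congrArg n (hπ i)))) _ _ (fun i z => ?_) _ _ _
      (fun i => ?_)
    · refine (sortedNumbering_apply e' τ' i z _).trans (Eq.trans ?_
        (sortedNumbering_apply e τ _ _ _).symm)
      refine (he (τ' i) z).trans ?_
      congr 1
      refine Sigma.ext (hπ i) ?_
      rw [Fin.heq_ext_iff (congrArg n (hπ i))]
      rfl
    · change x (τ (π i)) = (treeColl O₁ O₂ c.swap).act _ (x' (τ' i))
      rw [(treeColl O₁ O₂ c.swap).apply_eq_act x (hπ i), hx]
      exact (treeColl O₁ O₂ c.swap).act_act_eq _ _ _ (fun z => rfl) _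
  -- The degenerate cases correspond under `σ` and `f`, and there both sides are zero by definition.
  · have h' : ¬ (2 ≤ m ∧ ∀ i, 0 < n' i) := fun h1 => h ⟨h1.1, fun i => by
      obtain ⟨i, rfl⟩ := σ.surjective i
      exact (h1.2 i).trans_eq (hnn i)⟩
    rw [vertMap, vertMap, dif_neg h, dif_neg h']
    rfl

theorem vertMap_act (c : Colour) {N N' m : ℕ} {n : Fin m → ℕ} (e : (Σ i, Fin (n i)) ≃ Fin N)
    (g : Fin N ≃ Fin N') (e' : (Σ i, Fin (n i)) ≃ Fin N') (he : ∀ i z, e' ⟨i, z⟩ = g (e ⟨i, z⟩))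
    (ν : (labelOperad O₁ O₂ c).C.X m) (x : ∀ i, (treeColl O₁ O₂ c.swap).X (n i)) :
    (treeColl O₁ O₂ c).act g (vertMap O₁ O₂ c e ν x) = vertMap O₁ O₂ c e' ν x := by
  obtain rfl : e' = e.trans g := Equiv.ext fun ⟨i, z⟩ => he i z
  by_cases h : 2 ≤ m ∧ ∀ i, 0 < n i
  · obtain rfl : N = N' := Fin.equiv_iff_eq.mp ⟨g⟩
    rw [vertMap_apply O₁ O₂ c e h.1 h.2, vertMap_apply O₁ O₂ c _ h.1 h.2]
    exact (treeColl O₁ O₂ c).act_act_eq _ _ _ (fun _ => rfl) _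
  · rw [vertMap, vertMap, dif_neg h, dif_neg h]
    exact map_zero _

/-- The trees with root of colour `c` as a compatible family. -/
noncomputable def vertFam (c : Colour) (N : ℕ) :
    Fam (labelOperad O₁ O₂ c).C (treeColl O₁ O₂ c.swap) N ((treeColl O₁ O₂ c).X N) where
  toFun e := vertMap O₁ O₂ c e
  left σ n e e' he a x := vertMap_rel O₁ O₂ c σ (n := n) (n' := fun i => n (σ i))
    (fun _ => Equiv.refl _) e e' he a x _
    (fun _ => ((treeColl O₁ O₂ c.swap).act_refl _).symm)
  right {m n n'} f e e' he a x := by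
    have h := vertMap_rel O₁ O₂ c (Equiv.refl (Fin m)) f e e' he a
      (fun i => (treeColl O₁ O₂ c.swap).act (f i) (x i)) x (fun _ => rfl)
    rwa [(labelOperad O₁ O₂ c).C.act_refl] at h

/-- A generator is a tree. -/
theorem act_sortedMap_eq_vertMap (c : Colour) {N : ℕ} (l : DescPartition N) (g : Fin N ≃ Fin N)
    (ν : (labelOperad O₁ O₂ c).C.X l.m) (x : ∀ i, (treeColl O₁ O₂ c.swap).X (l.part i)) :
    (treeColl O₁ O₂ c).act g (sortedMap O₁ O₂ c l ν x) =
      vertMap O₁ O₂ c ((blockEquiv l.part N l.sum_eq).trans g) ν x := by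
  rw [vertMap_apply O₁ O₂ c _ l.two_le l.pos]
  have h := sortedMap_rel O₁ O₂ c l (sortedPartition l.two_le l.part l.pos N l.sum_eq)
    (sortPerm l.part) (fun i => Equiv.refl _) g
    (sortedNumbering ((blockEquiv l.part N l.sum_eq).trans g) (sortPerm l.part))
    (fun i z => sortedNumbering_apply _ (sortPerm l.part) i z _)
    ((labelOperad O₁ O₂ c).C.act (sortPerm l.part).symm ν) x (fun i => x (sortPerm l.part i))
    (fun i => ((treeColl O₁ O₂ c.swap).act_refl _).symm)
  refine Eq.trans ?_ h
  refine congrArg (fun a => (treeColl O₁ O₂ c).act g (sortedMap O₁ O₂ c l a x)) ?_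
  refine (((labelOperad O₁ O₂ c).C.act_act_eq _ _ (Equiv.refl _) (fun z => ?_) ν).trans
    ((labelOperad O₁ O₂ c).C.act_refl ν)).symm
  exact ((sortPerm l.part).apply_symm_apply z).symm

/-- Linear maps on `T(N)^c` are determined by their values on trees. -/
theorem treeRep_hom_ext (c : Colour) {N : ℕ} {M : Type*} [AddCommGroup M] [Module K M]
    (f f' : (treeColl O₁ O₂ c).X (N + 2) →ₗ[K] M)
    (h : ∀ {m : ℕ} {n : Fin m → ℕ} (e : (Σ i, Fin (n i)) ≃ Fin (N + 2)) (_hm : 2 ≤ m)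
      (_hn : ∀ i, 0 < n i) (ν : (labelOperad O₁ O₂ c).C.X m)
      (x : ∀ i, (treeColl O₁ O₂ c.swap).X (n i)),
      f (vertMap O₁ O₂ c e ν x) = f' (vertMap O₁ O₂ c e ν x)) : f = f' := by
  classical
  suffices h1 : f ∘ₗ (repCast (treeRep_eq O₁ O₂ c (N + 2))).symm.toLinearMap =
      f' ∘ₗ (repCast (treeRep_eq O₁ O₂ c (N + 2))).symm.toLinearMap by
    refine LinearMap.ext fun y => ?_
    obtain ⟨y, rfl⟩ := (repCast (treeRep_eq O₁ O₂ c (N + 2))).symm.surjective y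
    exact LinearMap.congr_fun h1 y
  refine DirectSum.linearMap_ext K fun l => ?_
  refine Representation.IndV.hom_ext _ _ fun g => ?_
  refine TensorProduct.ext (LinearMap.ext fun ν => PiTensorProduct.ext
    (MultilinearMap.ext fun x => ?_))
  -- The generator with group element `g` is the relabelling by `g⁻¹` of a sorted vertex, hence a
  -- tree.
  have h2 := act_sortedMap O₁ O₂ c l g⁻¹ ν x
  rw [inv_inv] at h2
  have h3 := h ((blockEquiv l.part _ l.sum_eq).trans g⁻¹) l.two_le l.pos ν x
  rw [← act_sortedMap_eq_vertMap, h2] at h3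
  exact h3

/-- A compatible family as a linear map on `K[S_N] ⊗ O(m) ⊗ T(n₁) ⊗ ⋯ ⊗ T(n_m)`. -/
noncomputable def blockPreLift (c : Colour) {N : ℕ} {M : Type*} [AddCommGroup M] [Module K M]
    (F : Fam (labelOperad O₁ O₂ c).C (treeColl O₁ O₂ c.swap) N M) (l : DescPartition N) :
    MonoidAlgebra K (Equiv.Perm (Fin N)) ⊗[K] (labelledBlockRep (c.label O₁ O₂)
      (fun k _ => treeRep O₁ O₂ c.swap k) l) →ₗ[K] M :=
  groupAlgebraLift fun g : Equiv.Perm (Fin N) =>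
    TensorProduct.lift (PiTensorProduct.lift.toLinearMap ∘ₗ
      F.toFun ((blockEquiv l.part N l.sum_eq).trans g.symm))

theorem blockPreLift_apply (c : Colour) {N : ℕ} {M : Type*} [AddCommGroup M] [Module K M]
    (F : Fam (labelOperad O₁ O₂ c).C (treeColl O₁ O₂ c.swap) N M) (l : DescPartition N)
    (g : Equiv.Perm (Fin N)) (ν : (labelOperad O₁ O₂ c).C.X l.m)
    (x : ∀ i, (treeColl O₁ O₂ c.swap).X (l.part i)) :
    blockPreLift O₁ O₂ c F l (MonoidAlgebra.single g 1 ⊗ₜ[K] (ν ⊗ₜ[K] PiTensorProduct.tprod K x)) =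
      F.toFun ((blockEquiv l.part N l.sum_eq).trans g.symm) ν x := by
  refine (groupAlgebraLift_apply _ _ _).trans ?_
  refine (TensorProduct.lift.tmul _ _).trans ?_
  exact PiTensorProduct.lift.tprod x

/-- Compatible families give linear maps on the induced modules. -/
noncomputable def blockLift (c : Colour) {N : ℕ} {M : Type*} [AddCommGroup M] [Module K M]
    (F : Fam (labelOperad O₁ O₂ c).C (treeColl O₁ O₂ c.swap) N M) (l : DescPartition N) :
    Rep.ind l.blockHom (labelledBlockRep (c.label O₁ O₂)
      (fun k _ => treeRep O₁ O₂ c.swap k) l) →ₗ[K] M :=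
  Representation.Coinvariants.lift _ (blockPreLift O₁ O₂ c F l) (fun s => by
      refine TensorProduct.ext (MonoidAlgebra.lhom_ext' fun g => LinearMap.ext_ring ?_)
      refine TensorProduct.ext (LinearMap.ext fun ν => PiTensorProduct.ext
        (MultilinearMap.ext fun x => ?_))
      refine Eq.trans ?_ (blockPreLift_apply O₁ O₂ c F l g ν x).symm
      have h1 := labelledBlockRep_apply O₁ O₂ c l s ν x
      have h2 := blockPreLift_apply O₁ O₂ c F l (l.blockHom s * g)
        ((labelOperad O₁ O₂ c).C.act s.1.1 ν)
        (fun j => (treeColl O₁ O₂ c.swap).act (l.blockBij s j) (x (s.1.1.symm j)))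
      rw [← h1] at h2
      have h3 : ((Representation.leftRegular K (Equiv.Perm (Fin N))).comp l.blockHom s)
          (MonoidAlgebra.single g (1 : K)) = MonoidAlgebra.single (l.blockHom s * g) 1 := by
        simp
      rw [← h3] at h2
      -- An element of `S(λ)` consists of a bijection of branches and bijections of labels, so
      -- invariance under it is an instance of the compatibility of the family.
      refine h2.trans (F.rel s.1.1 (fun i => (finCongr (congrArg l.part
        (s.1.1.symm_apply_apply i).symm)).trans (l.blockBij s (s.1.1 i))) _ _
        (fun i z => ?_) ν _ x (fun i => ?_))
      · change g.symm (blockEquiv l.part N l.sum_eq ⟨i, z⟩) =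
          g.symm ((l.blockHom s).symm (blockEquiv l.part N l.sum_eq _))
        congr 1
        rw [Equiv.eq_symm_apply]
        change blockEquiv l.part N l.sum_eq (s.1.2 ((blockEquiv l.part N l.sum_eq).symm
          (blockEquiv l.part N l.sum_eq ⟨i, z⟩))) = _
        rw [Equiv.symm_apply_apply]
        congr 1
        refine (sigma_cast l.part (s.1.2 ⟨i, z⟩) (s.1.1 i) (s.2 ⟨i, z⟩)).symm.trans ?_
        congr 1
        refine Fin.ext ?_
        exact congrArg (fun y => ((s.1.2 y).2 : ℕ))
          (sigma_cast l.part ⟨i, z⟩ _ (s.1.1.symm_apply_apply i).symm).symm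
      · rw [(treeColl O₁ O₂ c.swap).apply_eq_act x (s.1.1.symm_apply_apply i).symm]
        exact (treeColl O₁ O₂ c.swap).act_act_eq _ _ _ (fun _ => rfl) _)

theorem blockLift_mk (c : Colour) {N : ℕ} {M : Type*} [AddCommGroup M] [Module K M]
    (F : Fam (labelOperad O₁ O₂ c).C (treeColl O₁ O₂ c.swap) N M) (l : DescPartition N)
    (g : Equiv.Perm (Fin N)) (ν : (labelOperad O₁ O₂ c).C.X l.m)
    (x : ∀ i, (treeColl O₁ O₂ c.swap).X (l.part i)) :
    blockLift O₁ O₂ c F l (Representation.IndV.mk l.blockHom (labelledBlockRep (c.label O₁ O₂)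
      (fun k _ => treeRep O₁ O₂ c.swap k) l).ρ g (ν ⊗ₜ[K] PiTensorProduct.tprod K x)) =
    F.toFun ((blockEquiv l.part N l.sum_eq).trans g.symm) ν x :=
  blockPreLift_apply O₁ O₂ c F l g ν x

/-- The linear map on `T(N)^c`, `N ≥ 2`, given by a compatible family. -/
noncomputable def treeLift (c : Colour) {N : ℕ} {M : Type*} [AddCommGroup M] [Module K M]
    (F : Fam (labelOperad O₁ O₂ c).C (treeColl O₁ O₂ c.swap) (N + 2) M) :
    (treeColl O₁ O₂ c).X (N + 2) →ₗ[K] M :=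
  (by
    classical
    exact DirectSum.toModule K (DescPartition (N + 2)) M (fun l => blockLift O₁ O₂ c F l) :
      sumIndRep (c.label O₁ O₂) (fun k (_ : k < N + 2) => treeRep O₁ O₂ c.swap k) →ₗ[K] M) ∘ₗ
    (repCast (treeRep_eq O₁ O₂ c (N + 2))).toLinearMap

/-- The definition of `vertMap` sorts the branches, and the lift is known on sorted generators;
`F.left` undoes the sorting in the value. -/
theorem treeLift_vertMap (c : Colour) {N : ℕ} {M : Type*} [AddCommGroup M] [Module K M]
    (F : Fam (labelOperad O₁ O₂ c).C (treeColl O₁ O₂ c.swap) (N + 2) M)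
    {m : ℕ} {n : Fin m → ℕ} (e : (Σ i, Fin (n i)) ≃ Fin (N + 2)) (hm : 2 ≤ m)
    (hn : ∀ i, 0 < n i) (ν : (labelOperad O₁ O₂ c).C.X m)
    (x : ∀ i, (treeColl O₁ O₂ c.swap).X (n i)) :
    treeLift O₁ O₂ c F (vertMap O₁ O₂ c e ν x) = F.toFun e ν x := by
  classical
  rw [vertMap_apply O₁ O₂ c e hm hn]
  have h1 := act_sortedMap O₁ O₂ c (sortedPartition hm n hn _ (SymOperad.sum_eq_of_sigma_equiv e))
    (sortedNumbering e (sortPerm n)) ((labelOperad O₁ O₂ c).C.act (sortPerm n).symm ν)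
    (fun i => x (sortPerm n i))
  refine (congrArg (treeLift O₁ O₂ c F) h1).trans ?_
  refine (congrArg (DirectSum.toModule K (DescPartition (N + 2)) M
    (fun l => blockLift O₁ O₂ c F l))
    ((repCast (treeRep_eq O₁ O₂ c (N + 2))).apply_symm_apply _)).trans ?_
  refine (DirectSum.toModule_lof K _ _).trans ?_
  refine (blockLift_mk O₁ O₂ c F _ _ _ _).trans ?_
  have h2 : (labelOperad O₁ O₂ c).C.act (sortPerm n)
      ((labelOperad O₁ O₂ c).C.act (sortPerm n).symm ν) = ν := by
    refine ((labelOperad O₁ O₂ c).C.act_act_eq _ _ (Equiv.refl _) (fun z => ?_) ν).trans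
      ((labelOperad O₁ O₂ c).C.act_refl ν)
    exact ((sortPerm n).apply_symm_apply z).symm
  refine Eq.trans ?_ (congrArg (fun a => F.toFun e a x) h2)
  exact (F.left (sortPerm n) e _ (fun i z => sortedNumbering_apply e _ i z _) _ x).symm

end TreeModules

/-! ## Functions that are linear in every slot -/

section SlotLinear

variable {K : Type*} [Field K] {ι : Type*} {T : ι → Type*} [∀ i, AddCommGroup (T i)]
  [∀ i, Module K (T i)] {M : Type*} [AddCommGroup M] [Module K M]

open Classical in
/-- A function of several arguments that is linear in every argument. -/
def SlotLinear (K : Type*) [Field K] {ι : Type*} {T : ι → Type*} [∀ i, AddCommGroup (T i)]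
    [∀ i, Module K (T i)] {M : Type*} [AddCommGroup M] [Module K M] (f : (∀ i, T i) → M) : Prop :=
  ∀ (c : ∀ i, T i) (i : ι), ∃ L : T i →ₗ[K] M, ∀ z, L z = f (Function.update c i z)

theorem SlotLinear.exists_update [DecidableEq ι] {f : (∀ i, T i) → M} (hf : SlotLinear K f)
    (c : ∀ i, T i) (i : ι) : ∃ L : T i →ₗ[K] M, ∀ z, L z = f (Function.update c i z) := by
  obtain ⟨L, hL⟩ := hf c i
  exact ⟨L, fun z => by rw [hL]; congr!⟩

theorem MultilinearMap.slotLinear (f : MultilinearMap K T M) : SlotLinear K (fun x => f x) :=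
  fun c i => by
    classical
    exact ⟨f.toLinearMap c i, fun z => by
      rw [MultilinearMap.toLinearMap_apply]⟩

/-- Nested compositions are visibly linear in every argument, and this alone allows an identity to
be extended from generators, one slot at a time. The nested expressions need not be packaged as
multilinear maps. -/
theorem SlotLinear.ext_span [Finite ι] {G : ι → Type*} (q : ∀ i, G i → T i)
    (hq : ∀ i, ⊤ ≤ Submodule.span K (Set.range (q i))) {f f' : (∀ i, T i) → M}
    (hf : SlotLinear K f) (hf' : SlotLinear K f')
    (h : ∀ g : ∀ i, G i, f (fun i => q i (g i)) = f' (fun i => q i (g i))) (x : ∀ i, T i) :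
    f x = f' x := by
  classical
  have := Fintype.ofFinite ι
  suffices H : ∀ (s : Finset ι) (x : ∀ i, T i), (∀ i ∉ s, x i ∈ Set.range (q i)) →
      f x = f' x from H Finset.univ x (by simp)
  intro s
  induction s using Finset.induction_on with
  | empty =>
    intro x hx
    choose g hg using fun i => hx i (by simp)
    obtain rfl : (fun i => q i (g i)) = x := funext hg
    exact h g
  | insert i s _ ih =>
    intro x hx
    obtain ⟨L, hL⟩ := hf x i
    obtain ⟨L', hL'⟩ := hf' x i
    have hLL : L = L' := by
      refine LinearMap.ext_on_range (v := q i) (eq_top_iff.mpr (hq i)) fun g => ?_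
      rw [hL, hL']
      have := ih (Function.update x i (q i g)) fun j hj => by
        by_cases hji : j = i
        · subst hji; simp
        · simpa [hji] using hx j (by simp [hji, hj])
      convert this
    have h1 := hL (x i)
    rw [hLL, hL'] at h1
    simpa using h1.symm

theorem SlotLinear.postcomp {M' : Type*} [AddCommGroup M'] [Module K M'] {f : (∀ i, T i) → M}
    (hf : SlotLinear K f) (g : M →ₗ[K] M') : SlotLinear K (fun x => g (f x)) := fun c i => by
  obtain ⟨L, hL⟩ := hf c i
  exact ⟨g ∘ₗ L, fun z => congrArg g (hL z)⟩

theorem SlotLinear.precomp {T' : ι → Type*} [∀ i, AddCommGroup (T' i)] [∀ i, Module K (T' i)]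
    {f : (∀ i, T' i) → M} (hf : SlotLinear K f) (g : ∀ i, T i →ₗ[K] T' i) :
    SlotLinear K (fun x : ∀ i, T i => f (fun i => g i (x i))) := fun c i => by
  classical
  obtain ⟨L, hL⟩ := hf (fun i => g i (c i)) i
  refine ⟨L ∘ₗ g i, fun z => (hL _).trans (congrArg f (funext fun j => ?_))⟩
  by_cases h : j = i
  · subst h; simp
  · simp [h]

theorem SlotLinear.reindex {κ : Type*} (σ : κ ≃ ι) {f : (∀ k, T (σ k)) → M}
    (hf : SlotLinear K f) : SlotLinear K (fun x : ∀ i, T i => f (fun k => x (σ k))) := fun c i => by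
  classical
  obtain ⟨k, rfl⟩ := σ.surjective i
  obtain ⟨L, hL⟩ := hf (fun k => c (σ k)) k
  refine ⟨L, fun z => (hL z).trans (congrArg f ?_)⟩
  refine Eq.trans ?_ ((Function.update_comp_eq_of_injective' c σ.injective k z).symm.trans ?_)
  · congr!
  · congr!

/-- The argument with index `(i, k)` enters only through `g i`, so in this slot the function is a
composite of two linear maps. -/
theorem SlotLinear.sigma {κ : ι → Type*} {S : ∀ i, κ i → Type*} [∀ i k, AddCommGroup (S i k)]
    [∀ i k, Module K (S i k)] {f : (∀ i, T i) → M} (hf : SlotLinear K f)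
    {g : ∀ i, (∀ k, S i k) → T i} (hg : ∀ i, SlotLinear K (g i)) :
    SlotLinear K (fun x : (∀ p : (Σ i, κ i), S p.1 p.2) => f (fun i => g i (fun k => x ⟨i, k⟩))) :=
  fun c p => by
    classical
    obtain ⟨i, k⟩ := p
    obtain ⟨L, hL⟩ := hf (fun i => g i (fun k => c ⟨i, k⟩)) i
    obtain ⟨L', hL'⟩ := hg i (fun k => c ⟨i, k⟩) k
    refine ⟨L ∘ₗ L', fun z => (hL _).trans (congrArg f (funext fun j => ?_))⟩
    rw [hL']
    by_cases h : j = i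
    · subst h
      rw [Function.update_self]
      refine congrArg (g j) (funext fun k' => ?_)
      by_cases h' : k' = k
      · subst h'; simp
      · have h3 : (⟨j, k'⟩ : Σ i, κ i) ≠ ⟨j, k⟩ := fun h4 => h' (by simpa using h4)
        simp [h']
    · rw [Function.update_of_ne h]
      refine congrArg (g j) (funext fun k' => ?_)
      have h3 : (⟨j, k'⟩ : Σ i, κ i) ≠ ⟨i, k⟩ := fun h4 => h (congrArg Sigma.fst h4)
      simp [h3]

theorem SlotLinear.eval_unique [Unique ι] {g : T default →ₗ[K] M} :
    SlotLinear K (fun x : ∀ i, T i => g (x default)) := fun c i => by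
  obtain rfl := Unique.eq_default i
  exact ⟨g, fun z => by simp⟩

end SlotLinear

/-! ### Generators of a composite of two collections -/

section Composite

variable {K : Type u} [Field K]

/-- A generator `(a; x₁, …, x_m)` with a numbering of the labels. -/
structure FamGen (A : Coll.{u, v} K) (X : Coll.{u, w} K) (N : ℕ) where
  m : ℕ
  n : Fin m → ℕ
  e : (Σ i, Fin (n i)) ≃ Fin N
  a : A.X m
  x : ∀ i, X.X (n i)

variable {A : Coll.{u, v} K} {X : Coll.{u, w} K} {N : ℕ}

/-- Two generators that differ by bijections of branches and of labels. -/
def FamGen.Rel (s s' : FamGen A X N) : Prop :=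
  ∃ (σ : Fin s'.m ≃ Fin s.m) (f : ∀ i, Fin (s'.n i) ≃ Fin (s.n (σ i))),
    s.a = A.act σ s'.a ∧ (∀ i z, s'.e ⟨i, z⟩ = s.e ⟨σ i, f i z⟩) ∧
      ∀ i, s.x (σ i) = X.act (f i) (s'.x i)

theorem FamGen.Rel.refl (s : FamGen A X N) : s.Rel s :=
  ⟨Equiv.refl _, fun _ => Equiv.refl _, (A.act_refl _).symm, fun _ _ => rfl,
    fun _ => (X.act_refl _).symm⟩

variable {M : Type*} [AddCommGroup M] [Module K M]

/-- The value of a family on a generator. -/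
def Fam.val (F : Fam A X N M) (s : FamGen A X N) : M := F.toFun s.e s.a s.x

/-- A function of generators that is linear in all arguments and respects relabelling is a
compatible family. -/
theorem Fam.exists_of_fun (Φ : FamGen A X N → M)
    (ha : ∀ s : FamGen A X N, ∃ L : A.X s.m →ₗ[K] M, ∀ a, L a = Φ { s with a := a })
    (hx : ∀ s : FamGen A X N, SlotLinear K (fun x => Φ { s with x := x }))
    (hr : ∀ s s' : FamGen A X N, s.Rel s' → Φ s = Φ s') :
    ∃ F : Fam A X N M, ∀ s, F.val s = Φ s := by
  classical
  choose L hL using ha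
  choose P hP using hx
  let mu : ∀ {m : ℕ} {n : Fin m → ℕ} (e : (Σ i, Fin (n i)) ≃ Fin N) (a : A.X m),
      MultilinearMap K (fun i => X.X (n i)) M := fun {m n} e a =>
    MultilinearMap.mk' (fun x => Φ ⟨m, n, e, a, x⟩)
      (fun x i y z => by
        have h := hP ⟨m, n, e, a, x⟩ x i
        have h1 := (P ⟨m, n, e, a, x⟩ x i).map_add y z
        rw [h, h, h] at h1
        convert h1)
      (fun x i c y => by
        have h := hP ⟨m, n, e, a, x⟩ x i
        have h1 := (P ⟨m, n, e, a, x⟩ x i).map_smul c y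
        rw [h, h] at h1
        convert h1)
  refine ⟨{ toFun := fun {m n} e =>
              { toFun := mu e
                map_add' := fun a b => ?_
                map_smul' := fun c a => ?_ }
            left := ?_
            right := ?_ }, fun s => rfl⟩
  · refine MultilinearMap.ext fun x => ?_
    have h := hL ⟨m, n, e, a, x⟩
    have h1 := (L ⟨m, n, e, a, x⟩).map_add a b
    rwa [h, h, h] at h1
  · refine MultilinearMap.ext fun x => ?_
    have h := hL ⟨m, n, e, a, x⟩
    have h1 := (L ⟨m, n, e, a, x⟩).map_smul c a
    rwa [h, h] at h1
  · intro m m' σ n e e' he a x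
    exact hr ⟨m', n, e, A.act σ a, x⟩ ⟨m, fun i => n (σ i), e', a, fun i => x (σ i)⟩
      ⟨σ, fun i => Equiv.refl _, rfl, he, fun i => (X.act_refl _).symm⟩
  · intro m n n' f e e' he a x
    exact hr ⟨m, n', e, a, fun i => X.act (f i) (x i)⟩ ⟨m, n, e', a, x⟩
      ⟨Equiv.refl _, f, (A.act_refl _).symm, he, fun i => rfl⟩

theorem Fam.idx_slotLinear (F : Fam A X N M) {I : Type*} {m : ℕ} (b : I ≃ Fin m) {n : I → ℕ}
    (e : (Σ i, Fin (n i)) ≃ Fin N) (a : A.X m) :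
    SlotLinear K (fun x : ∀ i, X.X (n i) => F.idx b e a x) :=
  SlotLinear.reindex (T := fun i => X.X (n i)) b.symm
    (MultilinearMap.slotLinear (F.toFun _ a))

/-- `T` is the composite of `A` and `X`, with structure maps `stem`. -/
structure IsComposite (A : Coll.{u, u} K) (X : Coll.{u, u} K) (T : Coll.{u, u} K)
    (stem : ∀ N, Fam A X N (T.X N)) : Prop where
  nat : ∀ {m : ℕ} {n : Fin m → ℕ} {N N' : ℕ} (e : (Σ i, Fin (n i)) ≃ Fin N) (g : Fin N ≃ Fin N')
    (e' : (Σ i, Fin (n i)) ≃ Fin N'), (∀ i z, e' ⟨i, z⟩ = g (e ⟨i, z⟩)) →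
    ∀ (a : A.X m) (x : ∀ i, X.X (n i)),
      T.act g ((stem N).toFun e a x) = (stem N').toFun e' a x
  span : ∀ N, ⊤ ≤ Submodule.span K (Set.range (stem N).val)
  lift : ∀ {N N' : ℕ} (F : Fam A X N (T.X N')),
    ∃ L : T.X N →ₗ[K] T.X N', ∀ s, L ((stem N).val s) = F.val s

end Composite

/-! ### The left action of an operad on a composite -/

section Composite

variable {K : Type u} [Field K]

theorem Fam.idx_rel {A : Coll.{u, v} K} {X : Coll.{u, w} K} {N : ℕ} {M : Type*} [AddCommGroup M]
    [Module K M] (F : Fam A X N M) {I J : Type*} {m m' : ℕ} (κ : J ≃ I) (b : I ≃ Fin m)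
    (b' : J ≃ Fin m') (τ : Fin m' ≃ Fin m) (h : ∀ j, b (κ j) = τ (b' j)) {n : I → ℕ} {n' : J → ℕ}
    (f : ∀ j, Fin (n' j) ≃ Fin (n (κ j))) (e : (Σ i, Fin (n i)) ≃ Fin N)
    (e' : (Σ j, Fin (n' j)) ≃ Fin N) (he : ∀ j z, e' ⟨j, z⟩ = e ⟨κ j, f j z⟩)
    (a : A.X m') (x : ∀ i, X.X (n i)) (x' : ∀ j, X.X (n' j))
    (hx : ∀ j, x (κ j) = X.act (f j) (x' j)) :
    F.idx b e (A.act τ a) x = F.idx b' e' a x' := by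
  rw [← F.idx_reindex κ b b' τ h e ((Equiv.sigmaCongrLeft (β := fun i => Fin (n i)) κ).trans e)
    (fun _ _ => rfl), ← F.idx_right b' f
    ((Equiv.sigmaCongrLeft (β := fun i => Fin (n i)) κ).trans e) e' he]
  exact congrArg _ (funext hx)

/-- `Fam.idx` as a linear map of its first argument. -/
def Fam.idxLin {A : Coll.{u, v} K} {X : Coll.{u, w} K} {N : ℕ} {M : Type*} [AddCommGroup M]
    [Module K M] (F : Fam A X N M) {I : Type*} {m : ℕ} (b : I ≃ Fin m) {n : I → ℕ}
    (e : (Σ i, Fin (n i)) ≃ Fin N) (x : ∀ i, X.X (n i)) : A.X m →ₗ[K] M where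
  toFun a := F.idx b e a x
  map_add' a a' := by simp [Fam.idx]
  map_smul' c a := by simp [Fam.idx]

variable {O : LOperad.{u, u} K} {X T : Coll.{u, u} K}

/-- The numbering of the labels of `m` generators that are grafted on a vertex. -/
def mergeNum {A : Coll.{u, v} K} {m : ℕ} {n : Fin m → ℕ} {N : ℕ} (e : (Σ i, Fin (n i)) ≃ Fin N)
    (g : ∀ i, FamGen A X (n i)) :
    (Σ p : (Σ i, Fin (g i).m), Fin ((g p.1).n p.2)) ≃ Fin N :=
  (Equiv.sigmaAssoc (fun i j => Fin ((g i).n j))).trans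
    ((Equiv.sigmaCongrRight fun i => (g i).e).trans e)

/-- Generators are grafted on a vertex and the labels are composed. -/
def mergeGen {M : Type*} [AddCommGroup M] [Module K M] {N : ℕ} (F : Fam O.C X N M) {m : ℕ}
    {n : Fin m → ℕ} (e : (Σ i, Fin (n i)) ≃ Fin N) (ν : O.C.X m)
    (g : ∀ i, FamGen O.C X (n i)) : M :=
  F.idx (sigmaNumbering fun i => (g i).m) (mergeNum e g)
    ((O.comp _).toFun (sigmaNumbering fun i => (g i).m) ν (fun i => (g i).a))
    (fun p => (g p.1).x p.2)

variable {M : Type*} [AddCommGroup M] [Module K M] {N : ℕ} (F : Fam O.C X N M)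

/-- The bijections `σ i` assemble to a bijection `τ` of all branches. Its effect on the composed
label is given by `right` and `nat` of the operad, and `Fam.idx_rel` absorbs it together with the
relabellings of the branches. -/
theorem mergeGen_rel {m : ℕ} {n : Fin m → ℕ} (e : (Σ i, Fin (n i)) ≃ Fin N) (ν : O.C.X m)
    (g g' : ∀ i, FamGen O.C X (n i)) (h : ∀ i, (g i).Rel (g' i)) :
    mergeGen F e ν g = mergeGen F e ν g' := by
  choose σ f ha he hx using h
  unfold mergeGen
  let b := sigmaNumbering fun i => (g i).m
  let b' := sigmaNumbering fun i => (g' i).m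
  let κ : (Σ i, Fin (g' i).m) ≃ (Σ i, Fin (g i).m) := Equiv.sigmaCongrRight σ
  let τ : Fin (∑ i, (g' i).m) ≃ Fin (∑ i, (g i).m) := b'.symm.trans (κ.trans b)
  have hτ : ∀ p, b (κ p) = τ (b' p) := fun p => by simp [τ]
  have h1 : (O.comp _).toFun b ν (fun i => (g i).a) =
      O.C.act τ ((O.comp _).toFun b' ν (fun i => (g' i).a)) := by
    rw [O.nat b' τ (κ.trans b) (fun i z => hτ ⟨i, z⟩), ← (O.comp _).right σ b (κ.trans b)
      (fun _ _ => rfl)]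
    exact congrArg _ (funext ha)
  rw [h1]
  let f' : ∀ p : (Σ i, Fin (g' i).m), Fin ((g' p.1).n p.2) ≃ Fin ((g (κ p).1).n (κ p).2) :=
    fun p => f p.1 p.2
  refine F.idx_rel κ b b' τ hτ f' _ _ (fun p z => ?_) _
    (fun p => (g p.1).x p.2) (fun p => (g' p.1).x p.2) (fun p => ?_)
  rotate_left
  · exact hx p.1 p.2
  change e ⟨p.1, (g' p.1).e ⟨p.2, z⟩⟩ = e ⟨p.1, (g p.1).e ⟨σ p.1 p.2, f p.1 p.2 z⟩⟩
  rw [he]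

/-- With all generators but the `i`-th fixed, grafting is a compatible family in the `i`-th one. The
universal property of the composite can therefore be applied slot by slot, as
`MultilinearMap.exists_of_span` requires. -/
theorem mergeGen_update {m : ℕ} {n : Fin m → ℕ} (e : (Σ i, Fin (n i)) ≃ Fin N) (ν : O.C.X m)
    (g : ∀ i, FamGen O.C X (n i)) (i : Fin m) :
    ∃ G : Fam O.C X (n i) M, ∀ s, G.val s = mergeGen F e ν (Function.update g i s) := by
  refine Fam.exists_of_fun _ ?_ ?_ ?_
  · intro s
    -- After substituting `s = g i`, the updates change only a field of `g i`; the numbers of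
    -- branches, and with them all numberings, stay the same.
    suffices H : ∀ g : ∀ i, FamGen O.C X (n i), ∀ s, g i = s → ∃ L : O.C.X s.m →ₗ[K] M,
        ∀ a, L a = mergeGen F e ν (Function.update g i { s with a := a }) by
      obtain ⟨L, hL⟩ := H (Function.update g i s) s (by simp)
      exact ⟨L, fun a => by rw [hL, Function.update_idem]⟩
    rintro g _ rfl
    obtain ⟨L, hL⟩ := (MultilinearMap.slotLinear ((O.comp _).toFun
      (sigmaNumbering fun i => (g i).m) ν)).exists_update (fun i => (g i).a) i
    refine ⟨F.idxLin (sigmaNumbering fun i => (g i).m) (mergeNum e g) (fun p => (g p.1).x p.2) ∘ₗ L,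
      fun a => ?_⟩
    have h1 : Function.update g i { g i with a := a } =
        fun j => { g j with a := Function.update (fun j => (g j).a) i a j } := by
      funext j
      by_cases hj : j = i
      · subst hj; simp
      · simp [hj]
    rw [h1, LinearMap.comp_apply, hL]
    rfl
  · intro s
    suffices H : ∀ g : ∀ i, FamGen O.C X (n i), ∀ s, g i = s → SlotLinear K
        fun x => mergeGen F e ν (Function.update g i { s with x := x }) by
      have h1 := H (Function.update g i s) s (by simp)
      simpa only [Function.update_idem] using h1
    rintro g _ rfl
    have h1 : ∀ x, Function.update g i { g i with x := x } =
        fun j => { g j with x := Function.update (fun j => (g j).x) i x j } := by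
      intro x
      funext j
      by_cases hj : j = i
      · subst hj; simp
      · simp [hj]
    intro c k
    obtain ⟨L, hL⟩ := (F.idx_slotLinear (sigmaNumbering fun i => (g i).m) (mergeNum e g)
      ((O.comp _).toFun (sigmaNumbering fun i => (g i).m) ν (fun i => (g i).a))).exists_update
      (fun p => Function.update (fun j => (g j).x) i c p.1 p.2) ⟨i, k⟩
    refine ⟨L, fun z => (hL z).trans ?_⟩
    refine Eq.trans ?_ (congrArg (mergeGen F e ν) (h1 _).symm)
    refine congrArg (F.idx (sigmaNumbering fun i => (g i).m) (mergeNum e g)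
      ((O.comp _).toFun (sigmaNumbering fun i => (g i).m) ν (fun i => (g i).a))) (funext fun p => ?_)
    obtain ⟨j, k'⟩ := p
    by_cases hj : j = i
    · subst hj
      by_cases hk : k' = k
      · subst hk; simp
      · have h3 : (⟨j, k'⟩ : Σ i, Fin (g i).m) ≠ ⟨j, k⟩ := fun h4 => hk (by simpa using h4)
        simp [hk]
    · have h3 : (⟨j, k'⟩ : Σ i, Fin (g i).m) ≠ ⟨i, k⟩ := fun h4 => hj (congrArg Sigma.fst h4)
      simp [h3, hj]
  · intro s s' h
    refine mergeGen_rel F e ν _ _ fun j => ?_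
    by_cases hj : j = i
    · subst hj; simpa using h
    · simpa [hj] using FamGen.Rel.refl (g j)

variable {stem : ∀ N, Fam O.C X N (T.X N)}

/-- A new vertex acts by composing its label with the labels of the stems. The universal property
gives well-definedness in every slot, and linearity in the new label is seen on generators. -/
theorem IsComposite.exists_lact (h : IsComposite O.C X T stem) {m : ℕ} {n : Fin m → ℕ} {N : ℕ}
    (e : (Σ i, Fin (n i)) ≃ Fin N) :
    ∃ L : O.C.X m →ₗ[K] MultilinearMap K (fun i => T.X (n i)) (T.X N),
      ∀ ν (g : ∀ i, FamGen O.C X (n i)),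
        L ν (fun i => (stem (n i)).val (g i)) = mergeGen (stem N) e ν g := by
  have key : ∀ ν : O.C.X m, ∃ f : MultilinearMap K (fun i => T.X (n i)) (T.X N),
      ∀ g : ∀ i, FamGen O.C X (n i), f (fun i => (stem (n i)).val (g i)) =
        mergeGen (stem N) e ν g := fun ν => by
    refine MultilinearMap.exists_of_span (fun i => (stem (n i)).val) (fun i => h.span _) _ ?_
    intro i g
    obtain ⟨G, hG⟩ := mergeGen_update (stem N) e ν g i
    obtain ⟨L, hL⟩ := h.lift G
    exact ⟨L, fun s => (hL s).trans (hG s)⟩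
  choose f hf using key
  refine ⟨{ toFun := f, map_add' := fun ν ν' => ?_, map_smul' := fun c ν => ?_ }, hf⟩
  · refine MultilinearMap.ext_span (fun i => (stem (n i)).val) (fun i => h.span _) _ _ fun g => ?_
    rw [add_apply, hf, hf, hf]
    simp [mergeGen, Fam.idx]
  · refine MultilinearMap.ext_span (fun i => (stem (n i)).val) (fun i => h.span _) _ _ fun g => ?_
    rw [smul_apply, hf, hf]
    simp [mergeGen, Fam.idx]

namespace IsComposite

variable (h : IsComposite O.C X T stem)

/-- The action of `O` on the composite of `O` and `X`. -/
noncomputable def lactMap {m : ℕ} {n : Fin m → ℕ} {N : ℕ} (e : (Σ i, Fin (n i)) ≃ Fin N) :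
    O.C.X m →ₗ[K] MultilinearMap K (fun i => T.X (n i)) (T.X N) :=
  (h.exists_lact e).choose

theorem lactMap_val {m : ℕ} {n : Fin m → ℕ} {N : ℕ} (e : (Σ i, Fin (n i)) ≃ Fin N) (ν : O.C.X m)
    (g : ∀ i, FamGen O.C X (n i)) :
    h.lactMap e ν (fun i => (stem (n i)).val (g i)) = mergeGen (stem N) e ν g :=
  (h.exists_lact e).choose_spec ν g

/-- Iterated grafting produces branches indexed by nested sigma types. This version of `lactMap_val`
accepts such index types and any compatible numberings, the difference being a permutation `τ` of
the branches. -/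
theorem lactMap_idx {m : ℕ} {n : Fin m → ℕ} {N : ℕ} (e : (Σ i, Fin (n i)) ≃ Fin N) (ν : O.C.X m)
    {I : Fin m → Type*} {r : Fin m → ℕ} (b : ∀ i, I i ≃ Fin (r i)) {p : ∀ i, I i → ℕ}
    (d : ∀ i, (Σ j, Fin (p i j)) ≃ Fin (n i)) (μ : ∀ i, O.C.X (r i)) (x : ∀ i j, X.X (p i j))
    {R : ℕ} (B' : (Σ i, Fin (r i)) ≃ Fin R) (B : (Σ i, I i) ≃ Fin R)
    (hB : ∀ i j, B ⟨i, j⟩ = B' ⟨i, b i j⟩)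
    (E : (Σ q : (Σ i, I i), Fin (p q.1 q.2)) ≃ Fin N)
    (hE : ∀ i j z, E ⟨⟨i, j⟩, z⟩ = e ⟨i, d i ⟨j, z⟩⟩) :
    h.lactMap e ν (fun i => (stem (n i)).idx (b i) (d i) (μ i) (x i)) =
      (stem N).idx B E ((O.comp R).toFun B' ν μ) (fun q => x q.1 q.2) := by
  let g : ∀ i, FamGen O.C X (n i) := fun i => ⟨r i, fun y => p i ((b i).symm y),
    (Equiv.sigmaCongrLeft (β := fun j => Fin (p i j)) (b i).symm).trans (d i), μ i,
    fun y => x i ((b i).symm y)⟩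
  refine (h.lactMap_val e ν g).trans ?_
  let κ : (Σ i, Fin (r i)) ≃ (Σ i, I i) := Equiv.sigmaCongrRight fun i => (b i).symm
  let τ : Fin (∑ i, r i) ≃ Fin R := (sigmaNumbering r).symm.trans B'
  have h1 : (O.comp R).toFun B' ν μ = O.C.act τ ((O.comp _).toFun (sigmaNumbering r) ν μ) :=
    (O.nat _ τ B' (fun i z => by simp [τ]) ν μ).symm
  rw [h1]
  refine (stem N).idx_reindex κ B (sigmaNumbering r) τ (fun q => ?_) E _ (fun q z => ?_) _
    (fun q => x q.1 q.2)
  · obtain ⟨i, j⟩ := q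
    change B ⟨i, (b i).symm j⟩ = _
    simp [hB, τ]
  · exact (hE q.1 ((b q.1).symm q.2) z).symm

theorem lactMap_act {m : ℕ} {n : Fin m → ℕ} {N N' : ℕ} (e : (Σ i, Fin (n i)) ≃ Fin N)
    (g : Fin N ≃ Fin N') (e' : (Σ i, Fin (n i)) ≃ Fin N')
    (he : ∀ i z, e' ⟨i, z⟩ = g (e ⟨i, z⟩)) (ν : O.C.X m) (t : ∀ i, T.X (n i)) :
    T.act g (h.lactMap e ν t) = h.lactMap e' ν t := by
  refine SlotLinear.ext_span (fun i => (stem (n i)).val) (fun i => h.span _)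
    ((h.lactMap e ν).slotLinear.postcomp (T.act g)) (h.lactMap e' ν).slotLinear (fun s => ?_) t
  rw [h.lactMap_val, h.lactMap_val]
  let b := sigmaNumbering fun i => (s i).m
  exact h.nat ((Equiv.sigmaCongrLeft b.symm).trans (mergeNum e s)) g
    ((Equiv.sigmaCongrLeft b.symm).trans (mergeNum e' s))
    (fun i z => he (b.symm i).1 ((s (b.symm i).1).e ⟨(b.symm i).2, z⟩)) _ _

theorem lactMap_left {m m' : ℕ} (σ : Fin m ≃ Fin m') {n : Fin m' → ℕ} {N : ℕ}
    (e : (Σ i, Fin (n i)) ≃ Fin N) (e' : (Σ i, Fin (n (σ i))) ≃ Fin N)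
    (he : ∀ i z, e' ⟨i, z⟩ = e ⟨σ i, z⟩) (ν : O.C.X m) (t : ∀ i, T.X (n i)) :
    h.lactMap e (O.C.act σ ν) t = h.lactMap e' ν (fun i => t (σ i)) := by
  refine SlotLinear.ext_span (fun i => (stem (n i)).val) (fun i => h.span _)
    (h.lactMap e _).slotLinear
    (SlotLinear.reindex (T := fun i => T.X (n i)) σ (h.lactMap e' ν).slotLinear) (fun s => ?_) t
  rw [h.lactMap_val, h.lactMap_val e' ν (fun i => s (σ i))]
  let b := sigmaNumbering fun i => (s i).m
  let b' := sigmaNumbering fun i => (s (σ i)).m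
  let κ : (Σ i, Fin (s (σ i)).m) ≃ (Σ i, Fin (s i).m) :=
    Equiv.sigmaCongrLeft (β := fun i => Fin (s i).m) σ
  let τ : Fin (∑ i, (s (σ i)).m) ≃ Fin (∑ i, (s i).m) := b'.symm.trans (κ.trans b)
  have hτ : ∀ p, b (κ p) = τ (b' p) := fun p => by simp [τ]
  have h1 : (O.comp _).toFun b (O.C.act σ ν) (fun i => (s i).a) =
      O.C.act τ ((O.comp _).toFun b' ν (fun i => (s (σ i)).a)) := by
    rw [O.nat b' τ (κ.trans b) (fun i z => hτ ⟨i, z⟩)]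
    exact (O.comp _).left σ b (κ.trans b) (fun _ _ => rfl) ν _
  unfold mergeGen
  rw [h1]
  exact ((stem N).idx_reindex κ b b' τ hτ (mergeNum e s) (mergeNum e' fun i => s (σ i))
    (fun q z => he q.1 ((s (σ q.1)).e ⟨q.2, z⟩)) _ (fun p => (s p.1).x p.2)).symm

theorem lactMap_right {m : ℕ} {n n' : Fin m → ℕ} {N : ℕ} (f : ∀ i, Fin (n i) ≃ Fin (n' i))
    (e : (Σ i, Fin (n' i)) ≃ Fin N) (e' : (Σ i, Fin (n i)) ≃ Fin N)
    (he : ∀ i z, e' ⟨i, z⟩ = e ⟨i, f i z⟩) (ν : O.C.X m) (t : ∀ i, T.X (n i)) :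
    h.lactMap e ν (fun i => T.act (f i) (t i)) = h.lactMap e' ν t := by
  refine SlotLinear.ext_span (fun i => (stem (n i)).val) (fun i => h.span _)
    ((h.lactMap e ν).slotLinear.precomp fun i => T.act (f i)) (h.lactMap e' ν).slotLinear
    (fun s => ?_) t
  let s' : ∀ i, FamGen O.C X (n' i) := fun i => { s i with e := (s i).e.trans (f i) }
  have h1 : (fun i => T.act (f i) ((stem (n i)).val (s i))) = fun i => (stem (n' i)).val (s' i) :=
    funext fun i => h.nat _ _ _ (fun _ _ => rfl) _ _
  rw [h1, h.lactMap_val, h.lactMap_val]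
  have h2 : mergeNum e s' = mergeNum e' s :=
    Equiv.ext fun ⟨q, z⟩ => (he q.1 ((s q.1).e ⟨q.2, z⟩)).symm
  exact congrArg (fun E => (stem N).idx (n := fun q : (Σ i, Fin (s i).m) => (s q.1).n q.2)
    (sigmaNumbering fun i => (s i).m) E
    ((O.comp _).toFun (sigmaNumbering fun i => (s i).m) ν (fun i => (s i).a))
    (fun p => (s p.1).x p.2)) h2

theorem lactMap_one {n : Fin 1 → ℕ} {N : ℕ} (e : (Σ i, Fin (n i)) ≃ Fin N)
    (g : Fin (n 0) ≃ Fin N) (hg : ∀ z, g z = e ⟨0, z⟩) (t : ∀ i, T.X (n i)) :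
    h.lactMap e O.one t = T.act g (t 0) := by
  refine SlotLinear.ext_span (fun i => (stem (n i)).val) (fun i => h.span _)
    (h.lactMap e _).slotLinear
    (SlotLinear.eval_unique (T := fun i => T.X (n i)) (g := T.act g)) (fun s => ?_) t
  rw [h.lactMap_val]
  unfold mergeGen
  let b := sigmaNumbering fun i => (s i).m
  let κ : Fin (s 0).m ≃ (Σ i, Fin (s i).m) := (Equiv.uniqueSigma fun i => Fin (s i).m).symm
  rw [O.one_comp b (κ.trans b) (fun _ => rfl)]
  refine ((stem N).idx_reindex κ b (Equiv.refl _) (κ.trans b) (fun _ => rfl) (mergeNum e s)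
    ((s 0).e.trans g) (fun _ _ => hg _) (s 0).a (fun p => (s p.1).x p.2)).symm.trans ?_
  refine ((stem N).idx_refl ((s 0).e.trans g) (s 0).a (s 0).x).trans ?_
  exact (h.nat (s 0).e g _ (fun _ _ => rfl) _ _).symm

/-- For generators `s`, both sides have the same branches, indexed by a leaf `y` and a branch of `s
y` on the left and by triples on the right; `κ` matches the two indexings. The labels are the two
ways to compose three levels in `O`, so associativity of `O` applies. -/
theorem lactMap_assoc {m : ℕ} {n : Fin m → ℕ} {N : ℕ} (e : (Σ i, Fin (n i)) ≃ Fin N)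
    {k : Fin N → ℕ} {M : ℕ} (e' : (Σ y, Fin (k y)) ≃ Fin M) {l : Fin m → ℕ}
    (d : ∀ i, (Σ j : Fin (n i), Fin (k (e ⟨i, j⟩))) ≃ Fin (l i)) (E : (Σ i, Fin (l i)) ≃ Fin M)
    (hE : ∀ i j z, E ⟨i, d i ⟨j, z⟩⟩ = e' ⟨e ⟨i, j⟩, z⟩)
    (a : O.C.X m) (b : ∀ i, O.C.X (n i)) (c : ∀ y, T.X (k y)) :
    h.lactMap e' ((O.comp N).toFun e a b) c =
      h.lactMap E a (fun i => h.lactMap (d i) (b i) (fun j => c (e ⟨i, j⟩))) := by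
  refine SlotLinear.ext_span (fun i => (stem (k i)).val) (fun i => h.span _)
    (h.lactMap e' _).slotLinear
    (SlotLinear.reindex (T := fun y => T.X (k y)) e
      (SlotLinear.sigma (S := fun i j => T.X (k (e ⟨i, j⟩))) (h.lactMap E a).slotLinear
        fun i => (h.lactMap (d i) (b i)).slotLinear)) (fun s => ?_) c
  rw [h.lactMap_val]
  let β := sigmaNumbering fun y => (s y).m
  let r : Fin m → ℕ := fun i => ∑ j, (s (e ⟨i, j⟩)).m
  let βi : ∀ i, (Σ j : Fin (n i), Fin (s (e ⟨i, j⟩)).m) ≃ Fin (r i) := fun i =>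
    sigmaNumbering fun j => (s (e ⟨i, j⟩)).m
  let B' := sigmaNumbering r
  let B : (Σ i, Σ j : Fin (n i), Fin (s (e ⟨i, j⟩)).m) ≃ Fin (∑ i, r i) :=
    (Equiv.sigmaCongrRight βi).trans B'
  let κ : (Σ i, Σ j : Fin (n i), Fin (s (e ⟨i, j⟩)).m) ≃ (Σ y, Fin (s y).m) :=
    (Equiv.sigmaAssoc fun i j => Fin (s (e ⟨i, j⟩)).m).symm.trans
      (Equiv.sigmaCongrLeft (β := fun y => Fin (s y).m) e)
  let τ : Fin (∑ i, r i) ≃ Fin (∑ y, (s y).m) := B.symm.trans (κ.trans β)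
  have hτ : ∀ q, β (κ q) = τ (B q) := fun q => by simp [τ]
  have h1 : (fun i => h.lactMap (d i) (b i) (fun j => (stem _).val (s (e ⟨i, j⟩)))) =
      fun i => mergeGen (stem (l i)) (d i) (b i) (fun j => s (e ⟨i, j⟩)) :=
    funext fun i => h.lactMap_val (d i) (b i) (fun j => s (e ⟨i, j⟩))
  rw [h1]
  let E2 : (Σ q : (Σ i, Σ j : Fin (n i), Fin (s (e ⟨i, j⟩)).m),
      Fin ((s (e ⟨q.1, q.2.1⟩)).n q.2.2)) ≃ Fin M :=
    (Equiv.sigmaAssoc fun i (p : (Σ j : Fin (n i), Fin (s (e ⟨i, j⟩)).m)) =>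
      Fin ((s (e ⟨i, p.1⟩)).n p.2)).trans
      ((Equiv.sigmaCongrRight fun i => mergeNum (d i) fun j => s (e ⟨i, j⟩)).trans E)
  refine Eq.trans ?_ (h.lactMap_idx E a βi (fun i => mergeNum (d i) fun j => s (e ⟨i, j⟩))
    (fun i => (O.comp (r i)).toFun (βi i) (b i) (fun j => (s (e ⟨i, j⟩)).a))
    (fun i p => (s (e ⟨i, p.1⟩)).x p.2) B' B (fun _ _ => rfl) E2 (fun _ _ _ => rfl)).symm
  have h2 : (O.comp _).toFun β ((O.comp N).toFun e a b) (fun y => (s y).a) = O.C.act τ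
      ((O.comp _).toFun B' a
        (fun i => (O.comp (r i)).toFun (βi i) (b i) (fun j => (s (e ⟨i, j⟩)).a))) := by
    rw [O.nat B' τ (B'.trans τ) (fun _ _ => rfl)]
    exact O.assoc e β βi (B'.trans τ) (fun i j z => (hτ ⟨i, j, z⟩).symm) a b _
  unfold mergeGen
  rw [h2]
  exact ((stem M).idx_reindex κ β B τ hτ (mergeNum e' s) E2
    (fun q z => hE q.1 q.2.1 ((s (e ⟨q.1, q.2.1⟩)).e ⟨q.2.2, z⟩)) _ (fun p => (s p.1).x p.2)).symm

/-- The composite of `O` and `X` is a left module over `O`. -/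
noncomputable def lmod : LMod O T where
  lact N :=
    { toFun := fun {_ _} (e : _ ≃ Fin N) => h.lactMap e
      left := fun σ _ e e' he a x => h.lactMap_left σ e e' he a x
      right := fun f e e' he a x => h.lactMap_right f e e' he a x }
  nat := h.lactMap_act
  unit := h.lactMap_one
  assoc := h.lactMap_assoc

end IsComposite

end Composite

/-! ### Branches below a unary vertex -/

section Families

variable {K : Type u} [Field K]

/-- The numbering of the labels of a single branch. -/
def soloNum (n : Fin 1 → ℕ) : (Σ i, Fin (n i)) ≃ Fin (n 0) := Equiv.uniqueSigma fun i => Fin (n i)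

/-- An element of `X` sits in the composite below an identity label. Acting on such elements
composes `ν` with identities, so the action restricted to `X` is `stem` itself. -/
theorem IsComposite.lactMap_solo {O : LOperad.{u, u} K} {X T : Coll.{u, u} K}
    {stem : ∀ N, Fam O.C X N (T.X N)} (h : IsComposite O.C X T stem) {m : ℕ} {n : Fin m → ℕ}
    {N : ℕ} (e : (Σ i, Fin (n i)) ≃ Fin N) (ν : O.C.X m) (x : ∀ i, X.X (n i)) :
    h.lactMap e ν (fun i => (stem (n i)).toFun (soloNum fun _ => n i) O.one (fun _ => x i)) =
      (stem N).toFun e ν x := by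
  let g : ∀ i, FamGen O.C X (n i) := fun i => ⟨1, fun _ => n i, soloNum _, O.one, fun _ => x i⟩
  refine (h.lactMap_val e ν g).trans ?_
  unfold mergeGen
  let b : (Σ _ : Fin m, Fin 1) ≃ Fin (∑ _ : Fin m, 1) := sigmaNumbering fun _ => 1
  let κ : Fin m ≃ (Σ _ : Fin m, Fin 1) := (Equiv.sigmaUnique (Fin m) fun _ => Fin 1).symm
  have h1 := O.comp_one b (κ.trans b) (fun _ => rfl) ν
  refine (congrArg (fun a => (stem N).idx b (mergeNum e g) a (fun p => (g p.1).x p.2)) h1).trans ?_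
  refine ((stem N).idx_reindex κ b (Equiv.refl _) (κ.trans b) (fun _ => rfl) (mergeNum e g)
    e (fun _ _ => rfl) ν (fun p => (g p.1).x p.2)).symm.trans ?_
  exact (stem N).idx_refl e ν x

/-- Composition of a family with a linear map. -/
def Fam.postcomp {A : Coll.{u, v} K} {X : Coll.{u, w} K} {N : ℕ} {M M' : Type*} [AddCommGroup M]
    [Module K M] [AddCommGroup M'] [Module K M'] (L : M →ₗ[K] M') (F : Fam A X N M) :
    Fam A X N M' where
  toFun e := LinearMap.compMultilinearMapₗ K L ∘ₗ F.toFun e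
  left σ _ e e' he a x := congrArg L (F.left σ e e' he a x)
  right f e e' he a x := congrArg L (F.right f e e' he a x)

/-- The sum of two families. -/
def Fam.add {A : Coll.{u, v} K} {X : Coll.{u, w} K} {N : ℕ} {M : Type*} [AddCommGroup M]
    [Module K M] (F G : Fam A X N M) : Fam A X N M where
  toFun e := F.toFun e + G.toFun e
  left σ _ e e' he a x := congrArg₂ (· + ·) (F.left σ e e' he a x) (G.left σ e e' he a x)
  right f e e' he a x := congrArg₂ (· + ·) (F.right f e e' he a x) (G.right f e e' he a x)

/-- A linear map of the only argument as a multilinear map. -/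
def soloMultilinear {T : Fin 1 → Type*} [∀ i, AddCommGroup (T i)] [∀ i, Module K (T i)]
    {M : Type*} [AddCommGroup M] [Module K M] (L : T 0 →ₗ[K] M) : MultilinearMap K T M :=
  MultilinearMap.mk' (fun x => L (x 0))
    (fun x i y z => by obtain rfl := Subsingleton.elim i 0; simp)
    (fun x i c y => by obtain rfl := Subsingleton.elim i 0; simp)

/-- The family with only unary operations, through which `A(1)` acts by scalars. -/
def soloMap {A : Coll.{u, v} K} {X : Coll.{u, w} K} (coef : A.X 1 →ₗ[K] K) :
    ∀ {m : ℕ} {n : Fin m → ℕ} {N : ℕ} (_ : (Σ i, Fin (n i)) ≃ Fin N),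
      A.X m →ₗ[K] MultilinearMap K (fun i => X.X (n i)) (X.X N)
  | 0, _, _, _ => 0
  | 1, n, _, e => coef.smulRight (soloMultilinear (X.act ((soloNum n).symm.trans e)))
  | _ + 2, _, _, _ => 0

theorem soloMap_one {A : Coll.{u, v} K} {X : Coll.{u, w} K} (coef : A.X 1 →ₗ[K] K)
    {n : Fin 1 → ℕ} {N : ℕ} (e : (Σ i, Fin (n i)) ≃ Fin N) (g : Fin (n 0) ≃ Fin N)
    (hg : ∀ z, g z = e ⟨0, z⟩) (a : A.X 1) (x : ∀ i, X.X (n i)) :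
    soloMap coef e a x = coef a • X.act g (x 0) := by
  obtain rfl : g = (soloNum n).symm.trans e := Equiv.ext hg
  rfl

theorem soloMap_of_two_le {A : Coll.{u, v} K} {X : Coll.{u, w} K} (coef : A.X 1 →ₗ[K] K)
    {m : ℕ} (hm : 2 ≤ m) {n : Fin m → ℕ} {N : ℕ} (e : (Σ i, Fin (n i)) ≃ Fin N) (a : A.X m)
    (x : ∀ i, X.X (n i)) : soloMap coef e a x = 0 := by
  obtain ⟨m, rfl⟩ : ∃ k, m = k + 2 := ⟨m - 2, by omega⟩
  rfl

/-- The operations `soloMap` as a compatible family. -/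
def soloFam {A : Coll.{u, v} K} (X : Coll.{u, w} K) (coef : A.X 1 →ₗ[K] K) (N : ℕ) :
    Fam A X N (X.X N) where
  toFun e := soloMap coef e
  left {m m'} σ n e e' he a x := by
    obtain rfl : m = m' := Fin.equiv_iff_eq.mp ⟨σ⟩
    match m, σ, n, e, e', he, a, x with
    | 0, _, _, _, _, _, _, _ => rfl
    | 1, σ, n, e, e', he, a, x =>
      obtain rfl : σ = Equiv.refl _ := Subsingleton.elim _ _
      rw [A.act_refl, soloMap_one coef e ((soloNum n).symm.trans e) (fun _ => rfl)]
      exact (soloMap_one coef e' _ (fun z => (he 0 z).symm) a x).symm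
    | _ + 2, _, _, _, _, _, _, _ => rfl
  right {m n n'} f e e' he a x := by
    match m, n, n', f, e, e', he, a, x with
    | 0, _, _, _, _, _, _, _, _ => rfl
    | 1, n, n', f, e, e', he, a, x =>
      rw [soloMap_one coef e ((soloNum n').symm.trans e) (fun _ => rfl),
        soloMap_one coef e' ((soloNum n).symm.trans e') (fun _ => rfl)]
      congr 1
      exact X.act_act_eq _ _ _ (fun z => he 0 z) _
    | _ + 2, _, _, _, _, _, _, _, _ => rfl

/-- A family evaluated on the identity and one argument. -/
def Fam.solo {A : Coll.{u, v} K} {X : Coll.{u, w} K} {N : ℕ} {M : Type*} [AddCommGroup M]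
    [Module K M] (F : Fam A X N M) (one : A.X 1) : X.X N →ₗ[K] M where
  toFun y := F.toFun (soloNum fun _ => N) one (fun _ => y)
  map_add' y z := by
    have hu : ∀ z : X.X N, Function.update (fun _ : Fin 1 => y) 0 z = fun _ => z :=
      fun z => funext fun i => by rw [Subsingleton.elim i 0, Function.update_self]
    have h := (F.toFun (soloNum fun _ => N) one).map_update_add (fun _ => y) 0 y z
    rwa [hu, hu, hu] at h
  map_smul' c y := by
    have hu : ∀ z : X.X N, Function.update (fun _ : Fin 1 => y) 0 z = fun _ => z :=
      fun z => funext fun i => by rw [Subsingleton.elim i 0, Function.update_self]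
    have h := (F.toFun (soloNum fun _ => N) one).map_update_smul (fun _ => y) 0 c y
    rwa [hu, hu] at h

theorem Fam.solo_act {A : Coll.{u, v} K} {X : Coll.{u, w} K} {N : ℕ} {M : Type*} [AddCommGroup M]
    [Module K M] (F : Fam A X N M) (one : A.X 1) {n : Fin 1 → ℕ} (e : (Σ i, Fin (n i)) ≃ Fin N)
    (g : Fin (n 0) ≃ Fin N) (hg : ∀ z, g z = e ⟨0, z⟩) (x : ∀ i, X.X (n i)) :
    F.solo one (X.act g (x 0)) = F.toFun e one x := by
  obtain ⟨k, rfl⟩ : ∃ k, n = fun _ => k := ⟨n 0, funext fun i => by rw [Subsingleton.elim i 0]⟩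
  obtain ⟨y, rfl⟩ : ∃ y : X.X k, x = fun _ => y :=
    ⟨x 0, funext fun i => by rw [Subsingleton.elim i 0]⟩
  exact F.right (n := fun _ => k) (n' := fun _ => N) (fun _ => g) (soloNum fun _ => N) e
    (fun i z => by obtain rfl := Subsingleton.elim i 0; exact (hg z).symm) one (fun _ => y)

end Families

/-! ### `T(O₁, O₂)` as a composite, for each of the two colours -/

section TreeModules

variable {K : Type u} [Field K] (O₁ O₂ : SymOperad.{u, u} K)

/-- The collection `T(O₁, O₂)`. -/
@[reducible] noncomputable def treeT : Coll.{u, u} K := Coll.ofRep (treeCollection O₁ O₂).obj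

/-- The inclusion of `T(n)^c` in `T(n)`. -/
noncomputable def inc (c : Colour) (N : ℕ) : (treeColl O₁ O₂ c).X N →ₗ[K] (treeT O₁ O₂).X N :=
  treeIncl O₁ O₂ c N

theorem inc_act (c : Colour) {a b : ℕ} (g : Fin a ≃ Fin b) (y : (treeColl O₁ O₂ c).X a) :
    (treeT O₁ O₂).act g (inc O₁ O₂ c a y) = inc O₁ O₂ c b ((treeColl O₁ O₂ c).act g y) := by
  obtain rfl : a = b := Fin.equiv_iff_eq.mp ⟨g⟩
  match a, c, g, y with
  | 0, _, _, _ => exact map_zero _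
  | 1, c, g, y => exact (repCast_ρ (treeRep_eq O₁ O₂ c 1) g y).symm
  | a + 2, .black, g, y => exact Prod.ext rfl (map_zero ((treeRep O₁ O₂ .white (a + 2)).ρ g))
  | a + 2, .white, g, y => exact Prod.ext (map_zero ((treeRep O₁ O₂ .black (a + 2)).ρ g)) rfl

instance treeT_zero : Subsingleton ((treeT O₁ O₂).X 0) := (treeCollection O₁ O₂).subsingleton_zero

instance treeColl_zero (c : Colour) : Subsingleton ((treeColl O₁ O₂ c).X 0) :=
  (repCast (treeRep_eq O₁ O₂ c 0)).injective.subsingleton (β := PUnit)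

/-- `T(1)^c` is one-dimensional. -/
noncomputable def treeOneEquiv (c : Colour) : (treeColl O₁ O₂ c).X 1 ≃ₗ[K] K :=
  repCast (treeRep_eq O₁ O₂ c 1)

/-- The tree without internal vertices. -/
noncomputable def treeOne (c : Colour) : (treeColl O₁ O₂ c).X 1 := (treeOneEquiv O₁ O₂ c).symm 1

theorem exists_smul_treeOne (c : Colour) (y : (treeColl O₁ O₂ c).X 1) :
    ∃ k : K, y = k • treeOne O₁ O₂ c := by
  refine ⟨treeOneEquiv O₁ O₂ c y, (treeOneEquiv O₁ O₂ c).injective ?_⟩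
  rw [treeOne, map_smul, LinearEquiv.apply_symm_apply, smul_eq_mul, mul_one]

theorem inc_treeOne (c : Colour) : inc O₁ O₂ c 1 (treeOne O₁ O₂ c) = (1 : K) :=
  (treeOneEquiv O₁ O₂ c).apply_symm_apply _

/-- Expresses `T(n)^● ⊕ T(n)^○` through a colour and its opposite, so that later arguments treat
both colours at once. -/
theorem exists_tree_elim (c : Colour) {N : ℕ} {M : Type*} [AddCommGroup M] [Module K M]
    (f : (treeColl O₁ O₂ c).X (N + 2) →ₗ[K] M) (f' : (treeColl O₁ O₂ c.swap).X (N + 2) →ₗ[K] M) :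
    ∃ L : (treeT O₁ O₂).X (N + 2) →ₗ[K] M, (∀ y, L (inc O₁ O₂ c _ y) = f y) ∧
      ∀ y, L (inc O₁ O₂ c.swap _ y) = f' y :=
  match c, f, f' with
  | .black, f, f' => ⟨LinearMap.coprod f f', fun y => LinearMap.congr_fun (LinearMap.coprod_inl _ _) y,
      fun y => LinearMap.congr_fun (LinearMap.coprod_inr _ _) y⟩
  | .white, f, f' => ⟨LinearMap.coprod f' f, fun y => LinearMap.congr_fun (LinearMap.coprod_inr _ _) y,
      fun y => LinearMap.congr_fun (LinearMap.coprod_inl _ _) y⟩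

theorem treeT_hom_ext (c : Colour) {N : ℕ} {M : Type*} [AddCommGroup M] [Module K M]
    (L L' : (treeT O₁ O₂).X N →ₗ[K] M)
    (h : ∀ y, L (inc O₁ O₂ c _ y) = L' (inc O₁ O₂ c _ y))
    (h' : ∀ y, L (inc O₁ O₂ c.swap _ y) = L' (inc O₁ O₂ c.swap _ y)) : L = L' :=
  match N, c, L, L', h, h' with
  | 0, _, L, L', _, _ => LinearMap.ext fun y => by
      rw [Subsingleton.elim y 0, map_zero, map_zero]
  | 1, c, L, L', h, _ => LinearMap.ext fun y => by
      obtain ⟨y, rfl⟩ := (repCast (treeRep_eq O₁ O₂ c 1)).surjective y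
      exact h y
  | N + 2, .black, L, L', h, h' => LinearMap.prod_ext (LinearMap.ext h) (LinearMap.ext h')
  | N + 2, .white, L, L', h, h' => LinearMap.prod_ext (LinearMap.ext h') (LinearMap.ext h)

variable (coef : ∀ c, (labelOperad O₁ O₂ c).C.X 1 →ₗ[K] K)

/-- The trees with a root of colour `c`, where the root may have a single branch. -/
noncomputable def stemFam (c : Colour) (N : ℕ) :
    Fam (labelOperad O₁ O₂ c).C (treeColl O₁ O₂ c.swap) N ((treeT O₁ O₂).X N) :=
  ((vertFam O₁ O₂ c N).postcomp (inc O₁ O₂ c N)).add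
    ((soloFam _ (coef c) N).postcomp (inc O₁ O₂ c.swap N))

theorem stemFam_of_two_le (c : Colour) {N : ℕ} {m : ℕ} (hm : 2 ≤ m) {n : Fin m → ℕ}
    (e : (Σ i, Fin (n i)) ≃ Fin N) (ν : (labelOperad O₁ O₂ c).C.X m)
    (x : ∀ i, (treeColl O₁ O₂ c.swap).X (n i)) :
    (stemFam O₁ O₂ coef c N).toFun e ν x = inc O₁ O₂ c N (vertMap O₁ O₂ c e ν x) := by
  refine (congrArg (_ + ·) ((congrArg _ (soloMap_of_two_le (coef c) hm e ν x)).trans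
    (map_zero (inc O₁ O₂ c.swap N)))).trans (add_zero _)

theorem stemFam_one (c : Colour) {N : ℕ} {n : Fin 1 → ℕ} (e : (Σ i, Fin (n i)) ≃ Fin N)
    (g : Fin (n 0) ≃ Fin N) (hg : ∀ z, g z = e ⟨0, z⟩) (ν : (labelOperad O₁ O₂ c).C.X 1)
    (x : ∀ i, (treeColl O₁ O₂ c.swap).X (n i)) :
    (stemFam O₁ O₂ coef c N).toFun e ν x =
      coef c ν • inc O₁ O₂ c.swap N ((treeColl O₁ O₂ c.swap).act g (x 0)) := by
  have h1 : vertMap O₁ O₂ c e ν x = 0 := by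
    rw [vertMap, dif_neg (fun h => by omega)]
    rfl
  refine (congrArg₂ (· + ·) ((congrArg _ h1).trans (map_zero (inc O₁ O₂ c N)))
    (congrArg _ (soloMap_one (coef c) e g hg ν x))).trans
    ((zero_add _).trans (map_smul (inc O₁ O₂ c.swap N) _ _))

theorem stemFam_nat (c : Colour) {m : ℕ} {n : Fin m → ℕ} {N N' : ℕ} (e : (Σ i, Fin (n i)) ≃ Fin N)
    (g : Fin N ≃ Fin N') (e' : (Σ i, Fin (n i)) ≃ Fin N') (he : ∀ i z, e' ⟨i, z⟩ = g (e ⟨i, z⟩))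
    (ν : (labelOperad O₁ O₂ c).C.X m) (x : ∀ i, (treeColl O₁ O₂ c.swap).X (n i)) :
    (treeT O₁ O₂).act g ((stemFam O₁ O₂ coef c N).toFun e ν x) =
      (stemFam O₁ O₂ coef c N').toFun e' ν x := by
  match m, n, e, e', he, ν, x with
  | 0, n, e, e', he, ν, x =>
    have : Subsingleton ((labelOperad O₁ O₂ c).C.X 0) := (labelOperad O₁ O₂ c).zero
    rw [Subsingleton.elim ν 0]
    simp
  | 1, n, e, e', he, ν, x =>
    rw [stemFam_one O₁ O₂ coef c e ((soloNum n).symm.trans e) (fun _ => rfl),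
      stemFam_one O₁ O₂ coef c e' ((soloNum n).symm.trans e') (fun _ => rfl), map_smul, inc_act,
      (treeColl O₁ O₂ c.swap).act_act_eq ((soloNum n).symm.trans e) g
        ((soloNum n).symm.trans e') (fun z => he 0 z)]
  | m + 2, n, e, e', he, ν, x =>
    rw [stemFam_of_two_le O₁ O₂ coef c (by omega), stemFam_of_two_le O₁ O₂ coef c (by omega),
      inc_act, vertMap_act O₁ O₂ c e g e' he]

/-- Components of arity `0` are zero, so a branch without leaves annihilates the value. This matches
the convention that `vertMap` is zero on degenerate data. -/
theorem toFun_eq_zero_of_part_eq_zero (c : Colour) {N : ℕ} {M : Type*} [AddCommGroup M] [Module K M]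
    (F : Fam (labelOperad O₁ O₂ c).C (treeColl O₁ O₂ c.swap) N M) {m : ℕ} {n : Fin m → ℕ}
    (e : (Σ i, Fin (n i)) ≃ Fin N) (ν : (labelOperad O₁ O₂ c).C.X m)
    (x : ∀ i, (treeColl O₁ O₂ c.swap).X (n i)) {i : Fin m} (hi : n i = 0) :
    F.toFun e ν x = 0 := by
  have : Subsingleton ((treeColl O₁ O₂ c.swap).X (n i)) := by
    rw [hi]; exact treeColl_zero O₁ O₂ c.swap
  exact MultilinearMap.map_coord_zero _ i (Subsingleton.elim _ _)

theorem two_le_of_parts {m N : ℕ} (hm : 2 ≤ m) {n : Fin m → ℕ} (e : (Σ i, Fin (n i)) ≃ Fin N)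
    (hn : ∀ i, 0 < n i) : 2 ≤ N := by
  have h := Finset.sum_le_sum (s := Finset.univ) fun i _ => Nat.succ_le_of_lt (hn i)
  rw [SymOperad.sum_eq_of_sigma_equiv e] at h
  simp at h
  omega

/-- For `N ≥ 2`, `T(N)` is the sum of the trees with root of colour `c`, on which `F` is lifted by
`treeLift`, and of those with root of the opposite colour, which are stems with a unary identity
vertex and on which `F.solo` is used. By `hcoef` every unary label is a multiple of the identity, so
the remaining unary stems impose no further condition. -/
theorem exists_stem_lift (hcoef : ∀ c a, coef c a • (labelOperad O₁ O₂ c).one = a)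
    (c : Colour) {N : ℕ} {M : Type*} [AddCommGroup M] [Module K M]
    (F : Fam (labelOperad O₁ O₂ c).C (treeColl O₁ O₂ c.swap) N M) :
    ∃ L : (treeT O₁ O₂).X N →ₗ[K] M, ∀ s, L ((stemFam O₁ O₂ coef c N).val s) = F.val s := by
  have key : ∃ L : (treeT O₁ O₂).X N →ₗ[K] M,
      (∀ y, L (inc O₁ O₂ c.swap N y) = F.solo (labelOperad O₁ O₂ c).one y) ∧
      ∀ {m : ℕ} {n : Fin m → ℕ} (e : (Σ i, Fin (n i)) ≃ Fin N) (_ : 2 ≤ m) (_ : ∀ i, 0 < n i)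
        (ν : (labelOperad O₁ O₂ c).C.X m) (x : ∀ i, (treeColl O₁ O₂ c.swap).X (n i)),
        L (inc O₁ O₂ c N (vertMap O₁ O₂ c e ν x)) = F.toFun e ν x := by
    match N, F with
    | 0, F =>
      refine ⟨0, fun y => ?_, fun e hm hn => absurd (two_le_of_parts hm e hn) (by omega)⟩
      rw [Subsingleton.elim y 0, map_zero]
      exact (map_zero (F.solo _)).symm
    | 1, F =>
      refine ⟨F.solo (labelOperad O₁ O₂ c).one ∘ₗ
        (repCast (treeRep_eq O₁ O₂ c.swap 1)).symm.toLinearMap, fun y => ?_,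
        fun e hm hn => absurd (two_le_of_parts hm e hn) (by omega)⟩
      exact congrArg (F.solo (labelOperad O₁ O₂ c).one)
        ((repCast (treeRep_eq O₁ O₂ c.swap 1)).symm_apply_apply y)
    | N + 2, F =>
      obtain ⟨L, hL, hL'⟩ := exists_tree_elim O₁ O₂ c (treeLift O₁ O₂ c F)
        (F.solo (labelOperad O₁ O₂ c).one)
      exact ⟨L, hL', fun e hm hn ν x => (hL _).trans (treeLift_vertMap O₁ O₂ c F e hm hn ν x)⟩
  obtain ⟨L, hL', hL⟩ := key
  refine ⟨L, fun s => ?_⟩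
  obtain ⟨m, n, e, ν, x⟩ := s
  unfold Fam.val
  match m, n, e, ν, x with
  | 0, n, e, ν, x =>
    have : Subsingleton ((labelOperad O₁ O₂ c).C.X 0) := (labelOperad O₁ O₂ c).zero
    rw [Subsingleton.elim ν 0]
    simp
  | 1, n, e, ν, x =>
    dsimp only
    rw [stemFam_one O₁ O₂ coef c e ((soloNum n).symm.trans e) (fun _ => rfl), map_smul, hL',
      F.solo_act _ e _ (fun _ => rfl)]
    -- The unary label `ν` is replaced by its multiple of the identity, on which `F.solo` is
    -- defined.
    conv_rhs => rw [← hcoef c ν, map_smul, smul_apply]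
  | m + 2, n, e, ν, x =>
    dsimp only
    rw [stemFam_of_two_le O₁ O₂ coef c (by omega)]
    by_cases hn : ∀ i, 0 < n i
    · exact hL e (by omega) hn ν x
    · push Not at hn
      obtain ⟨i, hi⟩ := hn
      have h1 : vertMap O₁ O₂ c e ν x = 0 :=
        toFun_eq_zero_of_part_eq_zero O₁ O₂ c (vertFam O₁ O₂ c N) e ν x (Nat.le_zero.mp hi)
      rw [h1, toFun_eq_zero_of_part_eq_zero O₁ O₂ c F e ν x (Nat.le_zero.mp hi), map_zero, map_zero]

theorem stemFam_solo (hone : ∀ c, coef c (labelOperad O₁ O₂ c).one = 1)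
    (c : Colour) (N : ℕ) (y : (treeColl O₁ O₂ c.swap).X N) :
    (stemFam O₁ O₂ coef c N).toFun (soloNum fun _ => N) (labelOperad O₁ O₂ c).one (fun _ => y) =
      inc O₁ O₂ c.swap N y := by
  refine (stemFam_one O₁ O₂ coef c (n := fun _ => N) _ (Equiv.refl _) (fun _ => rfl) _ _).trans ?_
  rw [hone, one_smul, (treeColl O₁ O₂ c.swap).act_refl]

/-- Unary stems with the identity label give the trees of the opposite colour; in arity at least
`2`, the stems with at least two branches give those of colour `c`. -/
theorem stem_hom_ext (hone : ∀ c, coef c (labelOperad O₁ O₂ c).one = 1)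
    (c : Colour) {N : ℕ} {M : Type*} [AddCommGroup M] [Module K M]
    (L L' : (treeT O₁ O₂).X N →ₗ[K] M) (h : ∀ s, L ((stemFam O₁ O₂ coef c N).val s) =
      L' ((stemFam O₁ O₂ coef c N).val s)) : L = L' := by
  have h1 : ∀ y, L (inc O₁ O₂ c.swap _ y) = L' (inc O₁ O₂ c.swap _ y) := fun y => by
    have := h ⟨1, fun _ => N, soloNum _, (labelOperad O₁ O₂ c).one, fun _ => y⟩
    unfold Fam.val at this
    rwa [stemFam_solo O₁ O₂ coef hone] at this
  match N, L, L', h, h1 with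
  | 0, L, L', _, _ =>
    refine LinearMap.ext fun y => ?_
    rw [Subsingleton.elim y 0, map_zero, map_zero]
  | 1, L, L', _, h1 =>
      refine LinearMap.ext fun y => ?_
      obtain ⟨y, rfl⟩ := (repCast (treeRep_eq O₁ O₂ c.swap 1)).surjective y
      exact h1 y
  | N + 2, L, L', h, h1 =>
    refine treeT_hom_ext O₁ O₂ c L L' (fun y => ?_) h1
    refine LinearMap.congr_fun (treeRep_hom_ext O₁ O₂ c (L ∘ₗ inc O₁ O₂ c _) (L' ∘ₗ inc O₁ O₂ c _)
      fun e hm hn ν x => ?_) y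
    have := h ⟨_, _, e, ν, x⟩
    unfold Fam.val at this
    rwa [stemFam_of_two_le O₁ O₂ coef c hm] at this

/-- The same space `T` is a composite for both colours, as any tree may be read as starting with a
vertex of a prescribed colour. This is the source of the two commensurate actions of `O₁` and `O₂`.
-/
theorem isComposite_treeT (hcoef : ∀ c a, coef c a • (labelOperad O₁ O₂ c).one = a)
    (hone : ∀ c, coef c (labelOperad O₁ O₂ c).one = 1)
    (c : Colour) : IsComposite (labelOperad O₁ O₂ c).C
    (treeColl O₁ O₂ c.swap) (treeT O₁ O₂) (stemFam O₁ O₂ coef c) where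
  nat := stemFam_nat O₁ O₂ coef c
  span N := by
    -- The quotient map by the span of the stems vanishes on all stems, hence is zero.
    rw [top_le_iff, ← Submodule.ker_mkQ (Submodule.span K _), LinearMap.ker_eq_top]
    refine stem_hom_ext O₁ O₂ coef hone c _ _ fun s => ?_
    rw [LinearMap.zero_apply, Submodule.mkQ_apply, Submodule.Quotient.mk_eq_zero]
    exact Submodule.subset_span ⟨s, rfl⟩
  lift F := exists_stem_lift O₁ O₂ coef hcoef c F

end TreeModules

/-! ### `T(O₁, O₂)` as the free collection with two actions on one generator -/

section Modules

variable {K : Type u} [Field K]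

/-- This is associativity of the action for branches indexed by pairs. The work lies in `b.symm (b
⟨i, j⟩) = ⟨i, j⟩`, which enters the types of the arguments and holds only propositionally. -/
theorem LMod.lact_idx {O : LOperad.{u, v} K} {R : Coll.{u, w} K} (B : LMod O R) {m : ℕ}
    {n : Fin m → ℕ} {N : ℕ} (e : (Σ i, Fin (n i)) ≃ Fin N) (ν : O.C.X m) {r : Fin m → ℕ}
    {p : ∀ i, Fin (r i) → ℕ} (d : ∀ i, (Σ j, Fin (p i j)) ≃ Fin (n i)) (μ : ∀ i, O.C.X (r i))
    (x : ∀ i j, R.X (p i j)) {M : ℕ} (b : (Σ i, Fin (r i)) ≃ Fin M)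
    (E : (Σ q : (Σ i, Fin (r i)), Fin (p q.1 q.2)) ≃ Fin N)
    (hE : ∀ i j z, E ⟨⟨i, j⟩, z⟩ = e ⟨i, d i ⟨j, z⟩⟩) :
    (B.lact N).idx b E ((O.comp M).toFun b ν μ) (fun q => x q.1 q.2) =
      (B.lact N).toFun e ν (fun i => (B.lact (n i)).toFun (d i) (μ i) (x i)) := by
  have hb : ∀ i j, b.symm (b ⟨i, j⟩) = ⟨i, j⟩ := fun i j => b.symm_apply_apply _
  let P : (Σ i, Fin (r i)) → ℕ := fun q => p q.1 q.2
  let c : ∀ i, (Σ j, Fin (P (b.symm (b ⟨i, j⟩)))) ≃ (Σ j, Fin (p i j)) := fun i =>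
    Equiv.sigmaCongrRight fun j => finCongr (congrArg P (hb i j))
  refine (B.assoc b ((Equiv.sigmaCongrLeft (β := fun q => Fin (P q)) b.symm).trans E)
    (k := fun y => P (b.symm y)) (fun i => (c i).trans (d i)) e (fun i j z => ?_) ν μ
    (fun y => x (b.symm y).1 (b.symm y).2)).trans ?_
  · refine (hE i j (finCongr (congrArg P (hb i j)) z)).symm.trans ?_
    refine congrArg E (Sigma.ext (hb i j).symm ?_)
    exact (Fin.heq_ext_iff (congrArg P (hb i j).symm)).mpr rfl
  · refine congrArg _ (funext fun i => ?_)
    exact (B.lact (n i)).toFun_congr (n := P) (fun j => b.symm (b ⟨i, j⟩)) (fun j => ⟨i, j⟩)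
      (hb i) ((c i).trans (d i)) (d i) (fun _ _ => rfl) (μ i) (fun q => x q.1 q.2)

end Modules

section TreeModules

variable {K : Type u} [Field K] (O₁ O₂ : SymOperad.{u, u} K)

theorem part_lt_of_parts {m N : ℕ} (hm : 2 ≤ m) {n : Fin m → ℕ} (e : (Σ i, Fin (n i)) ≃ Fin N)
    (hn : ∀ i, 0 < n i) (i : Fin m) : n i < N := by
  have h := (sortedPartition hm n hn N (SymOperad.sum_eq_of_sigma_equiv e)).part_lt
    ((sortPerm n).symm i)
  change n (sortPerm n ((sortPerm n).symm i)) < N at h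
  rwa [Equiv.apply_symm_apply] at h

section Eval

variable {R : Coll.{u, w} K} (B : ∀ c : Colour, LMod (labelOperad O₁ O₂ c) R) (r : R.X 1)

/-- Equivariant linear maps from the modules `T(n)^c` to a collection. -/
structure TreeEval (R : Coll.{u, w} K) where
  map : ∀ c k, (treeColl O₁ O₂ c).X k →ₗ[K] R.X k
  map_act : ∀ (c : Colour) {a b : ℕ} (g : Fin a ≃ Fin b) (y : (treeColl O₁ O₂ c).X a),
    R.act g (map c a y) = map c b ((treeColl O₁ O₂ c).act g y)

variable {O₁ O₂}

/-- The action on a collection, applied to the values of branches. -/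
noncomputable def TreeEval.fam (ev : TreeEval O₁ O₂ R) (c : Colour) (N : ℕ) :
    Fam (labelOperad O₁ O₂ c).C (treeColl O₁ O₂ c.swap) N (R.X N) where
  toFun {_ n} e := MultilinearMap.compLinearMapₗ (fun i => ev.map c.swap (n i)) ∘ₗ
    ((B c).lact N).toFun e
  left σ _ e e' he a x := ((B c).lact N).left σ e e' he a fun i => ev.map c.swap _ (x i)
  right f e e' he a x :=
    (congrArg (((B c).lact N).toFun e a) (funext fun i => (ev.map_act c.swap (f i) (x i)).symm)).trans
      (((B c).lact N).right f e e' he a fun i => ev.map c.swap _ (x i))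

/-- The extension of an evaluation to arity `N`. -/
noncomputable def TreeEval.step (ev : TreeEval O₁ O₂ R) (c : Colour) :
    ∀ N, (treeColl O₁ O₂ c).X N →ₗ[K] R.X N
  | 0 => 0
  | 1 => (treeOneEquiv O₁ O₂ c).toLinearMap.smulRight r
  | N + 2 => treeLift O₁ O₂ c (ev.fam B c (N + 2))

theorem TreeEval.step_act (ev : TreeEval O₁ O₂ R) (c : Colour) {N : ℕ} (g : Fin N ≃ Fin N)
    (y : (treeColl O₁ O₂ c).X N) :
    R.act g (ev.step B r c N y) = ev.step B r c N ((treeColl O₁ O₂ c).act g y) := by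
  match N, g, y with
  | 0, g, y => exact map_zero _
  | 1, g, y =>
    obtain rfl : g = Equiv.refl _ := Subsingleton.elim _ _
    rw [R.act_refl, (treeColl O₁ O₂ c).act_refl]
  | N + 2, g, y =>
    refine LinearMap.congr_fun (treeRep_hom_ext O₁ O₂ c (R.act g ∘ₗ ev.step B r c (N + 2))
      (ev.step B r c (N + 2) ∘ₗ (treeColl O₁ O₂ c).act g) fun e hm hn ν x => ?_) y
    rw [LinearMap.comp_apply, LinearMap.comp_apply,
      vertMap_act O₁ O₂ c e g (e.trans g) (fun _ _ => rfl)]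
    refine (congrArg _ (treeLift_vertMap O₁ O₂ c (ev.fam B c (N + 2)) e hm hn ν x)).trans
      (Eq.trans ?_ (treeLift_vertMap O₁ O₂ c (ev.fam B c (N + 2)) (e.trans g) hm hn ν x).symm)
    exact (B c).nat e g (e.trans g) (fun _ _ => rfl) ν _

/-- The evaluation in arities less than `N`, extended by zero. -/
noncomputable def treeEvalBelow : ℕ → TreeEval O₁ O₂ R
  | 0 => ⟨fun _ _ => 0, fun _ _ _ _ _ => map_zero _⟩
  | N + 1 =>
    -- The recursion runs over a bound for the arity: each step needs an equivariant evaluation in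
    -- all smaller arities, for both colours, and leaves these values untouched.
    { map := fun c k => if k = N then (treeEvalBelow N).step B r c k else (treeEvalBelow N).map c k
      map_act := fun c a b g y => by
        obtain rfl : a = b := Fin.equiv_iff_eq.mp ⟨g⟩
        by_cases h : a = N
        · simp only [if_pos h]
          exact (treeEvalBelow N).step_act B r c g y
        · simp only [if_neg h]
          exact (treeEvalBelow N).map_act c g y }

theorem treeEvalBelow_self (c : Colour) (N : ℕ) :
    (treeEvalBelow B r (N + 1)).map c N = (treeEvalBelow B r N).step B r c N := by
  simp [treeEvalBelow]

theorem treeEvalBelow_of_lt (c : Colour) {k N : ℕ} (h : k < N) :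
    (treeEvalBelow B r N).map c k = (treeEvalBelow B r (k + 1)).map c k := by
  induction N with
  | zero => omega
  | succ N ih =>
    by_cases hk : k = N
    · rw [hk]
    · rw [← ih (by omega)]
      simp [treeEvalBelow, hk]

/-- The evaluation of trees in a module. -/
noncomputable def treeEval : TreeEval O₁ O₂ R where
  map c k := (treeEvalBelow B r (k + 1)).map c k
  map_act c a b g y := by
    obtain rfl : a = b := Fin.equiv_iff_eq.mp ⟨g⟩
    exact (treeEvalBelow B r (a + 1)).map_act c g y

theorem treeEval_one (c : Colour) : (treeEval B r).map c 1 (treeOne O₁ O₂ c) = r := by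
  change (treeEvalBelow B r 2).map c 1 _ = r
  rw [treeEvalBelow_self]
  change (treeOneEquiv O₁ O₂ c) (treeOne O₁ O₂ c) • r = r
  rw [treeOne, LinearEquiv.apply_symm_apply, one_smul]

/-- The branches have smaller arity than the tree, so their values are already final at the stage at
which the tree is evaluated. -/
theorem treeEval_vertMap (c : Colour) {N m : ℕ} {n : Fin m → ℕ} (e : (Σ i, Fin (n i)) ≃ Fin N)
    (hm : 2 ≤ m) (hn : ∀ i, 0 < n i) (ν : (labelOperad O₁ O₂ c).C.X m)
    (x : ∀ i, (treeColl O₁ O₂ c.swap).X (n i)) :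
    (treeEval B r).map c N (vertMap O₁ O₂ c e ν x) =
      ((B c).lact N).toFun e ν (fun i => (treeEval B r).map c.swap (n i) (x i)) := by
  obtain ⟨N, rfl⟩ : ∃ k, N = k + 2 := ⟨N - 2, by have := two_le_of_parts hm e hn; omega⟩
  change (treeEvalBelow B r (N + 2 + 1)).map c (N + 2) _ = _
  rw [treeEvalBelow_self]
  refine (treeLift_vertMap O₁ O₂ c _ e hm hn ν x).trans ?_
  refine congrArg (((B c).lact _).toFun e ν) (funext fun i => ?_)
  exact congrArg (fun f => f (x i)) (treeEvalBelow_of_lt B r c.swap (part_lt_of_parts hm e hn i))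

theorem exists_treeEval : ∃ ev : ∀ N, (treeT O₁ O₂).X N →ₗ[K] R.X N,
    ∀ c N y, ev N (inc O₁ O₂ c N y) = (treeEval B r).map c N y := by
  have key : ∀ N, ∃ ev : (treeT O₁ O₂).X N →ₗ[K] R.X N,
      ∀ c y, ev (inc O₁ O₂ c N y) = (treeEval B r).map c N y := by
    intro N
    match N with
    | 0 =>
      refine ⟨0, fun c y => ?_⟩
      rw [Subsingleton.elim y 0, map_zero, map_zero, map_zero]
    | 1 =>
      refine ⟨(LinearMap.id (R := K) (M := K)).smulRight r, fun c y => ?_⟩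
      change treeOneEquiv O₁ O₂ c y • r = _
      obtain ⟨k, rfl⟩ := exists_smul_treeOne O₁ O₂ c y
      rw [map_smul, map_smul, treeEval_one, treeOne, LinearEquiv.apply_symm_apply, smul_eq_mul,
        mul_one]
    | N + 2 =>
      obtain ⟨L, h, h'⟩ := exists_tree_elim O₁ O₂ .black ((treeEval B r).map .black (N + 2))
        ((treeEval B r).map .white (N + 2))
      exact ⟨L, fun c y => match c, y with
        | .black, y => h y
        | .white, y => h' y⟩
  choose ev hev using key
  exact ⟨ev, fun c N y => hev N c y⟩

end Eval

variable (coef : ∀ c, (labelOperad O₁ O₂ c).C.X 1 →ₗ[K] K)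
  (hcoef : ∀ c a, coef c a • (labelOperad O₁ O₂ c).one = a)
  (hone : ∀ c, coef c (labelOperad O₁ O₂ c).one = 1)

/-- The action of `O₁` and `O₂` on `T(O₁, O₂)`. -/
noncomputable def treeMod (c : Colour) : LMod (labelOperad O₁ O₂ c) (treeT O₁ O₂) :=
  (isComposite_treeT O₁ O₂ coef hcoef hone c).lmod

/-- Elements of `T(n)^{c.swap}` are stems of colour `c` with an identity label, so the action of `ν`
on them merges nothing and just adds a vertex. -/
theorem treeMod_inc (c : Colour) {N m : ℕ} {n : Fin m → ℕ} (e : (Σ i, Fin (n i)) ≃ Fin N)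
    (ν : (labelOperad O₁ O₂ c).C.X m) (x : ∀ i, (treeColl O₁ O₂ c.swap).X (n i)) :
    ((treeMod O₁ O₂ coef hcoef hone c).lact N).toFun e ν (fun i => inc O₁ O₂ c.swap (n i) (x i)) =
      (stemFam O₁ O₂ coef c N).toFun e ν x := by
  refine Eq.trans (congrArg _ (funext fun i => ?_))
    ((isComposite_treeT O₁ O₂ coef hcoef hone c).lactMap_solo e ν x)
  exact (stemFam_solo O₁ O₂ coef hone c (n i) (x i)).symm

/-- The identity of `T(O₁, O₂)`. -/
noncomputable def treeId : (treeT O₁ O₂).X 1 := inc O₁ O₂ .black 1 (treeOne O₁ O₂ .black)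

theorem inc_treeOne_eq (c : Colour) : inc O₁ O₂ c 1 (treeOne O₁ O₂ c) = treeId O₁ O₂ :=
  (inc_treeOne O₁ O₂ c).trans (inc_treeOne O₁ O₂ .black).symm

/-- Induction on trees: the branches of a root with at least two branches have smaller arity. -/
theorem treeT_induction_of_top (Q : ∀ N, Submodule K ((treeT O₁ O₂).X N)) (h1 : treeId O₁ O₂ ∈ Q 1)
    (hQ : ∀ (c : Colour) {N m : ℕ} {n : Fin m → ℕ} (e : (Σ i, Fin (n i)) ≃ Fin N)
      (ν : (labelOperad O₁ O₂ c).C.X m) (t : ∀ i, (treeT O₁ O₂).X (n i)), 2 ≤ m →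
        (∀ i y, y ∈ Q (n i)) →
        ((treeMod O₁ O₂ coef hcoef hone c).lact N).toFun e ν t ∈ Q N)
    (N : ℕ) (t : (treeT O₁ O₂).X N) : t ∈ Q N := by
  induction N using Nat.strong_induction_on with
  | _ N ih =>
    have key : ∀ c (y : (treeColl O₁ O₂ c).X N), inc O₁ O₂ c N y ∈ Q N := by
      intro c y
      match N, ih, y with
      | 0, _, y => rw [Subsingleton.elim y 0, map_zero]; exact zero_mem _
      | 1, _, y =>
        obtain ⟨k, rfl⟩ := exists_smul_treeOne O₁ O₂ c y
        rw [map_smul, inc_treeOne_eq]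
        exact Submodule.smul_mem _ _ h1
      | N + 2, ih, y =>
        -- It suffices that the quotient map by `Q (N + 2)` vanishes on trees, and a tree is the
        -- action of its root on branches of smaller arity.
        have h := LinearMap.congr_fun (treeRep_hom_ext O₁ O₂ c
          ((Q (N + 2)).mkQ ∘ₗ inc O₁ O₂ c (N + 2)) 0 fun e hm hn ν x => ?_) y
        · simpa using h
        · rw [LinearMap.zero_apply, LinearMap.comp_apply, Submodule.mkQ_apply,
            Submodule.Quotient.mk_eq_zero, ← stemFam_of_two_le O₁ O₂ coef c hm,
            ← treeMod_inc O₁ O₂ coef hcoef hone]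
          exact hQ c e ν _ hm fun i => ih _ (part_lt_of_parts hm e hn i)
    have h := LinearMap.congr_fun (treeT_hom_ext O₁ O₂ .black (Q N).mkQ 0
      (fun y => by simpa using key _ y) (fun y => by simpa using key _ y)) t
    simpa using h

/-- `T` is generated by its identity under the two actions. The preceding form has the stronger
inductive assumption that the whole spaces `Q (n i)` are known. -/
theorem treeT_induction (Q : ∀ N, Submodule K ((treeT O₁ O₂).X N)) (h1 : treeId O₁ O₂ ∈ Q 1)
    (hQ : ∀ (c : Colour) {N m : ℕ} {n : Fin m → ℕ} (e : (Σ i, Fin (n i)) ≃ Fin N)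
      (ν : (labelOperad O₁ O₂ c).C.X m) (t : ∀ i, (treeT O₁ O₂).X (n i)), (∀ i, t i ∈ Q (n i)) →
        ((treeMod O₁ O₂ coef hcoef hone c).lact N).toFun e ν t ∈ Q N)
    (N : ℕ) (t : (treeT O₁ O₂).X N) : t ∈ Q N :=
  treeT_induction_of_top O₁ O₂ coef hcoef hone Q h1
    (fun c _ _ _ e ν t _ ht => hQ c e ν t fun i => ht i _) N t

/-- The evaluation lets the root act on the values of its branches, so it sends a stem of colour `c`
to the action of its label (`hstem`). The action of `ν` on stems composes `ν` with their labels, and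
associativity of `B c` makes the merged vertex act as the two vertices in succession. -/
theorem treeT_free {R : Coll.{u, w} K} (B : ∀ c : Colour, LMod (labelOperad O₁ O₂ c) R)
    (r : R.X 1) : ∃ ev : ∀ N, (treeT O₁ O₂).X N →ₗ[K] R.X N, ev 1 (treeId O₁ O₂) = r ∧
      ∀ (c : Colour) {N m : ℕ} {n : Fin m → ℕ} (e : (Σ i, Fin (n i)) ≃ Fin N)
        (ν : (labelOperad O₁ O₂ c).C.X m) (t : ∀ i, (treeT O₁ O₂).X (n i)),
        ev N (((treeMod O₁ O₂ coef hcoef hone c).lact N).toFun e ν t) =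
          ((B c).lact N).toFun e ν (fun i => ev (n i) (t i)) := by
  obtain ⟨ev, hev⟩ := exists_treeEval B r
  refine ⟨ev, (hev _ _ _).trans (treeEval_one B r .black), fun c N m n e ν t => ?_⟩
  let h := isComposite_treeT O₁ O₂ coef hcoef hone c
  have hstem : ∀ (N m : ℕ) (n : Fin m → ℕ) (e : (Σ i, Fin (n i)) ≃ Fin N)
      (ν : (labelOperad O₁ O₂ c).C.X m) (x : ∀ i, (treeColl O₁ O₂ c.swap).X (n i)),
      ev N ((stemFam O₁ O₂ coef c N).toFun e ν x) =
        ((B c).lact N).toFun e ν (fun i => (treeEval B r).map c.swap (n i) (x i)) := by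
    intro N m n e ν x
    match m, n, e, ν, x with
    | 0, n, e, ν, x =>
      have : Subsingleton ((labelOperad O₁ O₂ c).C.X 0) := (labelOperad O₁ O₂ c).zero
      rw [Subsingleton.elim ν 0]
      simp
    | 1, n, e, ν, x =>
      rw [stemFam_one O₁ O₂ coef c e ((soloNum n).symm.trans e) (fun _ => rfl), map_smul, hev]
      -- A unary label is a multiple of the identity, which acts by relabelling in every module.
      conv_rhs => rw [← hcoef c ν, map_smul, smul_apply]
      rw [(B c).unit e ((soloNum n).symm.trans e) (fun _ => rfl), (treeEval B r).map_act]
    | m + 2, n, e, ν, x =>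
      rw [stemFam_of_two_le O₁ O₂ coef c (by omega), hev]
      by_cases hn : ∀ i, 0 < n i
      · exact treeEval_vertMap B r c e (by omega) hn ν x
      · push Not at hn
        obtain ⟨i, hi⟩ := hn
        have h1 : vertMap O₁ O₂ c e ν x = 0 :=
          toFun_eq_zero_of_part_eq_zero O₁ O₂ c (vertFam O₁ O₂ c N) e ν x (Nat.le_zero.mp hi)
        rw [h1, map_zero]
        exact (toFun_eq_zero_of_part_eq_zero O₁ O₂ c ((treeEval B r).fam B c N) e ν x
          (Nat.le_zero.mp hi)).symm
  refine SlotLinear.ext_span (fun i => (stemFam O₁ O₂ coef c (n i)).val) (fun i => h.span _)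
    ((h.lactMap e ν).slotLinear.postcomp (ev N))
    ((((B c).lact N).toFun e ν).slotLinear.precomp fun i => ev (n i)) (fun s => ?_) t
  rw [h.lactMap_val]
  refine (hstem _ _ _ _ _ _).trans ?_
  have h2 : (fun i => ev (n i) ((stemFam O₁ O₂ coef c (n i)).val (s i))) = fun i =>
      ((B c).lact (n i)).toFun (s i).e (s i).a
        (fun j => (treeEval B r).map c.swap _ ((s i).x j)) := funext fun i => hstem _ _ _ _ _ _
  rw [h2]
  exact (B c).lact_idx e ν (fun i => (s i).e) (fun i => (s i).a)
    (fun i j => (treeEval B r).map c.swap _ ((s i).x j)) (sigmaNumbering fun i => (s i).m)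
    (mergeNum e s) (fun _ _ _ => rfl)

end TreeModules

/-! ## The internal hom -/

section InternalHom

variable {K : Type u} [Field K]

/-- A function that is linear in every slot, as a multilinear map. -/
def SlotLinear.toMultilinear {K : Type*} [Field K] {ι : Type*} {T : ι → Type*}
    [∀ i, AddCommGroup (T i)] [∀ i, Module K (T i)] {M : Type*} [AddCommGroup M] [Module K M]
    {f : (∀ i, T i) → M} (hf : SlotLinear K f) : MultilinearMap K T M where
  toFun := f
  map_update_add' c i x y := by
    obtain ⟨L, hL⟩ := hf.exists_update c i
    rw [← hL, ← hL, ← hL, map_add]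
  map_update_smul' c i a x := by
    obtain ⟨L, hL⟩ := hf.exists_update c i
    rw [← hL, ← hL, map_smul]

/-- The numbering of the leaves of a two-level tree, with the branches numbered by `d`. -/
def outerNum {m : ℕ} {n : Fin m → ℕ} {N : ℕ} (ε : (Σ i, Fin (n i)) ≃ Fin N) {k : Fin N → ℕ} {M : ℕ}
    (E : (Σ y, Fin (k y)) ≃ Fin M) {l : Fin m → ℕ}
    (d : ∀ i, (Σ j, Fin (k (ε ⟨i, j⟩))) ≃ Fin (l i)) : (Σ i, Fin (l i)) ≃ Fin M :=
  (Equiv.sigmaCongrRight d).symm.trans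
    ((Equiv.sigmaAssoc fun i j => Fin (k (ε ⟨i, j⟩))).symm.trans
      ((Equiv.sigmaCongrLeft (β := fun y => Fin (k y)) ε).trans E))

theorem outerNum_apply {m : ℕ} {n : Fin m → ℕ} {N : ℕ} (ε : (Σ i, Fin (n i)) ≃ Fin N)
    {k : Fin N → ℕ} {M : ℕ} (E : (Σ y, Fin (k y)) ≃ Fin M) {l : Fin m → ℕ}
    (d : ∀ i, (Σ j, Fin (k (ε ⟨i, j⟩))) ≃ Fin (l i)) (i : Fin m) (j : Fin (n i))
    (z : Fin (k (ε ⟨i, j⟩))) : outerNum ε E d ⟨i, d i ⟨j, z⟩⟩ = E ⟨ε ⟨i, j⟩, z⟩ := by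
  have h : (Equiv.sigmaCongrRight d).symm ⟨i, d i ⟨j, z⟩⟩ = ⟨i, ⟨j, z⟩⟩ :=
    (Equiv.sigmaCongrRight d).symm_apply_apply ⟨i, ⟨j, z⟩⟩
  unfold outerNum
  rw [Equiv.trans_apply, h]
  rfl

section

variable (Y : Coll.{u, v} K) (R : Coll.{u, w} K)

/-- Multilinear operations with `m` arguments in `Y` and values in `R`. -/
abbrev HomSpace (m : ℕ) : Type (max v w) :=
  ∀ n : Fin m → ℕ, MultilinearMap K (fun i => Y.X (n i)) (R.X (∑ i, n i))

variable {Y R}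

/-- The operation for an arbitrary numbering of the labels. -/
noncomputable def homEval {m : ℕ} {n : Fin m → ℕ} {N : ℕ} (e : (Σ i, Fin (n i)) ≃ Fin N) :
    HomSpace Y R m →ₗ[K] MultilinearMap K (fun i => Y.X (n i)) (R.X N) :=
  (LinearMap.compMultilinearMapₗ K (R.act ((sigmaNumbering n).symm.trans e))) ∘ₗ
    LinearMap.proj n

/-- The value of an operation, as a linear map of the operation. -/
noncomputable def homEvalAt {m : ℕ} {n : Fin m → ℕ} {N : ℕ} (e : (Σ i, Fin (n i)) ≃ Fin N)
    (y : ∀ i, Y.X (n i)) : HomSpace Y R m →ₗ[K] R.X N where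
  toFun F := homEval e F y
  map_add' F G := by rw [map_add, add_apply]
  map_smul' c F := by rw [map_smul, smul_apply, RingHom.id_apply]

theorem homEval_nat {m : ℕ} {n : Fin m → ℕ} {N N' : ℕ} (e : (Σ i, Fin (n i)) ≃ Fin N)
    (g : Fin N ≃ Fin N') (e' : (Σ i, Fin (n i)) ≃ Fin N') (he : ∀ i z, e' ⟨i, z⟩ = g (e ⟨i, z⟩))
    (F : HomSpace Y R m) (y : ∀ i, Y.X (n i)) : R.act g (homEval e F y) = homEval e' F y :=
  R.act_act_eq _ _ _ (fun _ => he _ _) _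

theorem homEval_sigmaNumbering {m : ℕ} {n : Fin m → ℕ} (F : HomSpace Y R m)
    (y : ∀ i, Y.X (n i)) : homEval (sigmaNumbering n) F y = F n y :=
  R.act_eq_self _ (fun _ => Equiv.apply_symm_apply _ _) _

theorem homEval_ext {m : ℕ} {F G : HomSpace Y R m}
    (h : ∀ (n : Fin m → ℕ) (y : ∀ i, Y.X (n i)),
      homEval (sigmaNumbering n) F y = homEval (sigmaNumbering n) G y) : F = G :=
  funext fun n => MultilinearMap.ext fun y => by
    simpa only [homEval_sigmaNumbering] using h n y

theorem homEval_congr {I : Type*} {m N : ℕ} {n : I → ℕ} (f f' : Fin m → I) (hf : ∀ y, f y = f' y)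
    (e : (Σ y, Fin (n (f y))) ≃ Fin N) (e' : (Σ y, Fin (n (f' y))) ≃ Fin N)
    (he : ∀ y z, e ⟨y, z⟩ = e' ⟨y, Fin.cast (congrArg n (hf y)) z⟩) (F : HomSpace Y R m)
    (x : ∀ i, Y.X (n i)) :
    homEval e F (fun y => x (f y)) = homEval e' F (fun y => x (f' y)) := by
  obtain rfl : f = f' := funext hf
  obtain rfl : e = e' := Equiv.ext fun ⟨y, z⟩ => he y z
  rfl

/-- The action of bijections of the arguments. -/
noncomputable def homAct {a b : ℕ} (σ : Fin a ≃ Fin b) : HomSpace Y R a →ₗ[K] HomSpace Y R b where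
  toFun F := fun n => (SlotLinear.reindex (T := fun i => Y.X (n i)) σ
    (homEval ((Equiv.sigmaCongrLeft (β := fun i => Fin (n i)) σ).trans (sigmaNumbering n))
      F).slotLinear).toMultilinear
  map_add' F G := funext fun n => MultilinearMap.ext fun y => by
    exact (homEvalAt ((Equiv.sigmaCongrLeft (β := fun i => Fin (n i)) σ).trans
      (sigmaNumbering n)) fun i => y (σ i)).map_add F G
  map_smul' c F := funext fun n => MultilinearMap.ext fun y => by
    exact (homEvalAt ((Equiv.sigmaCongrLeft (β := fun i => Fin (n i)) σ).trans
      (sigmaNumbering n)) fun i => y (σ i)).map_smul c F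

theorem homEval_homAct {a b : ℕ} (σ : Fin a ≃ Fin b) {n : Fin b → ℕ} {N : ℕ}
    (e : (Σ i, Fin (n i)) ≃ Fin N) (F : HomSpace Y R a) (y : ∀ i, Y.X (n i)) :
    homEval e (homAct σ F) y =
      homEval ((Equiv.sigmaCongrLeft (β := fun i => Fin (n i)) σ).trans e) F
        (fun i => y (σ i)) :=
  homEval_nat ((Equiv.sigmaCongrLeft (β := fun i => Fin (n i)) σ).trans (sigmaNumbering n))
    ((sigmaNumbering n).symm.trans e) _
    (fun _ _ => congrArg e ((sigmaNumbering n).symm_apply_apply _).symm) F (fun i => y (σ i))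

variable (Y R)

/-- The collection of multilinear operations with arguments in `Y` and values in `R`. -/
@[reducible] noncomputable def homColl : Coll.{u, max v w} K where
  X := HomSpace Y R
  act := homAct
  act_refl F := homEval_ext fun n y => homEval_homAct _ _ _ _
  act_trans e f F := homEval_ext fun n y => by
    rw [homEval_homAct, homEval_homAct, homEval_homAct]
    exact congrArg (fun E => homEval E F fun i => y (f (e i))) (Equiv.ext fun _ => rfl)

end

variable {Y : Coll.{u, v} K} {R : Coll.{u, w} K} {O : LOperad.{u, v} K} (B : LMod O R)

/-- The action of an operad on operations with values in a module. -/
noncomputable def homLact {m : ℕ} {n : Fin m → ℕ} {N : ℕ} (ε : (Σ i, Fin (n i)) ≃ Fin N) :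
    O.C.X m →ₗ[K] MultilinearMap K (fun i => HomSpace Y R (n i)) (HomSpace Y R N) where
  toFun ν := MultilinearMap.pi fun k =>
    let E := outerNum ε (sigmaNumbering k) fun i => sigmaNumbering fun j => k (ε ⟨i, j⟩)
    let G := fun y : (∀ x, Y.X (k x)) => ((B.lact _).toFun E ν).compLinearMap fun i =>
      homEvalAt (R := R) (sigmaNumbering fun j => k (ε ⟨i, j⟩)) (fun j => y (ε ⟨i, j⟩))
    MultilinearMap.mk' (fun F => (SlotLinear.reindex (T := fun x => Y.X (k x)) ε
      (SlotLinear.sigma (S := fun i j => Y.X (k (ε ⟨i, j⟩))) ((B.lact _).toFun E ν).slotLinear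
        fun i => (homEval (sigmaNumbering fun j => k (ε ⟨i, j⟩)) (F i)).slotLinear)).toMultilinear)
      (fun F i a b => MultilinearMap.ext fun y => by
        exact (G y).map_update_add F i a b)
      (fun F i c a => MultilinearMap.ext fun y => by
        exact (G y).map_update_smul F i c a)
  map_add' ν μ := MultilinearMap.ext fun F => funext fun k => MultilinearMap.ext fun y => by
    exact DFunLike.congr_fun (((B.lact _).toFun (outerNum ε (sigmaNumbering k) fun i =>
      sigmaNumbering fun j => k (ε ⟨i, j⟩))).map_add ν μ) fun i =>
        homEval (sigmaNumbering fun j => k (ε ⟨i, j⟩)) (F i) fun j => y (ε ⟨i, j⟩)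
  map_smul' c ν := MultilinearMap.ext fun F => funext fun k => MultilinearMap.ext fun y => by
    exact DFunLike.congr_fun (((B.lact _).toFun (outerNum ε (sigmaNumbering k) fun i =>
      sigmaNumbering fun j => k (ε ⟨i, j⟩))).map_smul c ν) fun i =>
        homEval (sigmaNumbering fun j => k (ε ⟨i, j⟩)) (F i) fun j => y (ε ⟨i, j⟩)

/-- The definition of `homLact` uses standard numberings; `nat` and `right` of the module show that
all compatible numberings give the same value. This freedom reduces the module axioms for operations
to those of `B`. -/
theorem homEval_homLact {m : ℕ} {n : Fin m → ℕ} {N : ℕ} (ε : (Σ i, Fin (n i)) ≃ Fin N)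
    {k : Fin N → ℕ} {M : ℕ} (E : (Σ y, Fin (k y)) ≃ Fin M) {l : Fin m → ℕ}
    (d : ∀ i, (Σ j, Fin (k (ε ⟨i, j⟩))) ≃ Fin (l i)) (E' : (Σ i, Fin (l i)) ≃ Fin M)
    (hE : ∀ i j z, E' ⟨i, d i ⟨j, z⟩⟩ = E ⟨ε ⟨i, j⟩, z⟩)
    (ν : O.C.X m) (F : ∀ i, HomSpace Y R (n i)) (y : ∀ x, Y.X (k x)) :
    homEval E (homLact B ε ν F) y =
      (B.lact M).toFun E' ν (fun i => homEval (d i) (F i) (fun j => y (ε ⟨i, j⟩))) := by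
  let D := fun i => sigmaNumbering fun j => k (ε ⟨i, j⟩)
  have h1 : ∀ i, homEval (d i) (F i) (fun j => y (ε ⟨i, j⟩)) =
      R.act ((D i).symm.trans (d i)) (homEval (D i) (F i) (fun j => y (ε ⟨i, j⟩))) := fun i =>
    (homEval_nat (D i) ((D i).symm.trans (d i)) (d i)
      (fun j z => congrArg (d i) ((D i).symm_apply_apply _).symm) _ _).symm
  refine Eq.trans ?_ (congrArg ((B.lact M).toFun E' ν) (funext h1)).symm
  rw [(B.lact M).right (fun i => (D i).symm.trans (d i)) E'
    ((Equiv.sigmaCongrRight fun i => (D i).symm.trans (d i)).trans E') (fun _ _ => rfl)]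
  refine B.nat (outerNum ε (sigmaNumbering k) D) ((sigmaNumbering k).symm.trans E) _
    (fun i z => ?_) ν _
  obtain ⟨⟨j, z⟩, rfl⟩ := (D i).surjective z
  rw [outerNum_apply, Equiv.trans_apply, Equiv.trans_apply, Equiv.symm_apply_apply, ← hE]
  refine congrArg (fun x => E' ⟨i, d i x⟩) ((D i).symm_apply_apply ⟨j, z⟩)

theorem homEval_homLact' {m : ℕ} {n : Fin m → ℕ} {N : ℕ} (ε : (Σ i, Fin (n i)) ≃ Fin N)
    {k : Fin N → ℕ} {M : ℕ} (E : (Σ y, Fin (k y)) ≃ Fin M)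
    (ν : O.C.X m) (F : ∀ i, HomSpace Y R (n i)) (y : ∀ x, Y.X (k x)) :
    homEval E (homLact B ε ν F) y =
      (B.lact M).toFun (outerNum ε E fun i => sigmaNumbering fun j => k (ε ⟨i, j⟩)) ν
        (fun i => homEval (sigmaNumbering fun j => k (ε ⟨i, j⟩)) (F i) (fun j => y (ε ⟨i, j⟩))) :=
  homEval_homLact B ε E _ _ (outerNum_apply _ _ _) ν F y

theorem homLact_left {m m' : ℕ} (σ : Fin m ≃ Fin m') {n : Fin m' → ℕ} {N : ℕ}
    (e : (Σ i, Fin (n i)) ≃ Fin N) (a : O.C.X m) (F : ∀ i, HomSpace Y R (n i)) :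
    homLact B e (O.C.act σ a) F =
      homLact B ((Equiv.sigmaCongrLeft (β := fun i => Fin (n i)) σ).trans e) a
        (fun i => F (σ i)) := homEval_ext fun k y => by
  let l : Fin m' → ℕ := fun i => ∑ j, k (e ⟨i, j⟩)
  let d : ∀ i, (Σ j, Fin (k (e ⟨i, j⟩))) ≃ Fin (l i) :=
    fun i => sigmaNumbering fun j => k (e ⟨i, j⟩)
  let E : (Σ i, Fin (l i)) ≃ Fin (∑ x, k x) := outerNum e (sigmaNumbering k) d
  let E' : (Σ i, Fin (l (σ i))) ≃ Fin (∑ x, k x) :=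
    (Equiv.sigmaCongrLeft (β := fun i => Fin (l i)) σ).trans E
  have h1 := homEval_homLact B e (sigmaNumbering k) d E (outerNum_apply _ _ _) (O.C.act σ a) F y
  have h2 := homEval_homLact B ((Equiv.sigmaCongrLeft (β := fun i => Fin (n i)) σ).trans e)
    (sigmaNumbering k) (fun i => d (σ i)) E'
    (fun i j z => outerNum_apply e (sigmaNumbering k) d (σ i) j z) a (fun i => F (σ i)) y
  exact h1.trans (((B.lact _).left σ E E' (fun _ _ => rfl) a _).trans h2.symm)

theorem homLact_one {n : Fin 1 → ℕ} {N : ℕ} (e : (Σ i, Fin (n i)) ≃ Fin N)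
    (F : ∀ i, HomSpace Y R (n i)) :
    homLact B e O.one F = homAct ((soloNum n).symm.trans e) (F 0) := homEval_ext fun k y => by
  let d := fun i => sigmaNumbering fun j => k (e ⟨i, j⟩)
  let E := outerNum e (sigmaNumbering k) d
  rw [homEval_homAct, homEval_homLact', B.unit E ((soloNum _).symm.trans E) (fun _ => rfl)]
  exact homEval_nat (d 0) ((soloNum fun i => ∑ j, k (e ⟨i, j⟩)).symm.trans E) _
    (fun j z => (outerNum_apply e (sigmaNumbering k) d 0 j z).symm) (F 0)
      (fun j => y (e ⟨0, j⟩))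

theorem homLact_right {m : ℕ} {n n' : Fin m → ℕ} {N : ℕ} (f : ∀ i, Fin (n i) ≃ Fin (n' i))
    (e : (Σ i, Fin (n' i)) ≃ Fin N) (a : O.C.X m) (F : ∀ i, HomSpace Y R (n i)) :
    homLact B e a (fun i => homAct (f i) (F i)) =
      homLact B ((Equiv.sigmaCongrRight f).trans e) a F := homEval_ext fun k y => by
  let d := fun i => sigmaNumbering fun j => k (e ⟨i, j⟩)
  let E := outerNum e (sigmaNumbering k) d
  have h1 := homEval_homLact B e (sigmaNumbering k) d E (outerNum_apply _ _ _) a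
    (fun i => homAct (f i) (F i)) y
  have h2 := homEval_homLact B ((Equiv.sigmaCongrRight f).trans e) (sigmaNumbering k)
    (fun i => (Equiv.sigmaCongrLeft (β := fun j => Fin (k (e ⟨i, j⟩))) (f i)).trans (d i)) E
    (fun i j z => outerNum_apply e (sigmaNumbering k) d i (f i j) z) a F y
  refine h1.trans (Eq.trans ?_ h2.symm)
  exact congrArg _ (funext fun i => homEval_homAct (f i) (d i) (F i) _)

theorem homAct_homLact {m : ℕ} {n : Fin m → ℕ} {N N' : ℕ} (e : (Σ i, Fin (n i)) ≃ Fin N)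
    (g : Fin N ≃ Fin N') (a : O.C.X m) (F : ∀ i, HomSpace Y R (n i)) :
    homAct g (homLact B e a F) = homLact B (e.trans g) a F := homEval_ext fun k y => by
  let E := (Equiv.sigmaCongrLeft (β := fun i => Fin (k i)) g).trans (sigmaNumbering k)
  let d := fun i => sigmaNumbering fun j => k (g (e ⟨i, j⟩))
  have h1 := homEval_homLact B e E d (outerNum e E d) (outerNum_apply e E d) a F
    (fun i => y (g i))
  have h2 := homEval_homLact B (e.trans g) (sigmaNumbering k) d (outerNum e E d)
    (outerNum_apply e E d) a F y
  exact (homEval_homAct g _ _ y).trans (h1.trans h2.symm)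

/-- Evaluated on arguments, both sides are three-level composites in `R`, and `B.assoc` compares
them. What remains is to match numberings whose arities agree only through `hE`, hence the casts in
`δ'`. -/
theorem homLact_assoc {m : ℕ} {n : Fin m → ℕ} {N : ℕ} (e : (Σ i, Fin (n i)) ≃ Fin N)
    {q : Fin N → ℕ} {M : ℕ} (e' : (Σ y, Fin (q y)) ≃ Fin M) {l : Fin m → ℕ}
    (d : ∀ i, (Σ j : Fin (n i), Fin (q (e ⟨i, j⟩))) ≃ Fin (l i)) (E : (Σ i, Fin (l i)) ≃ Fin M)
    (hE : ∀ i j z, E ⟨i, d i ⟨j, z⟩⟩ = e' ⟨e ⟨i, j⟩, z⟩)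
    (a : O.C.X m) (b : ∀ i, O.C.X (n i)) (F : ∀ y, HomSpace Y R (q y)) :
    homLact B e' ((O.comp N).toFun e a b) F =
      homLact B E a (fun i => homLact B (d i) (b i) (fun j => F (e ⟨i, j⟩))) :=
  homEval_ext fun k y => by
    let L := fun i => ∑ z, k (e' ⟨i, z⟩)
    let δ : ∀ i, (Σ z, Fin (k (e' ⟨i, z⟩))) ≃ Fin (L i) := fun i =>
      sigmaNumbering fun z => k (e' ⟨i, z⟩)
    let L' := fun i => ∑ s, k (E ⟨i, s⟩)
    let D : ∀ i, (Σ s, Fin (k (E ⟨i, s⟩))) ≃ Fin (L' i) := fun i =>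
      sigmaNumbering fun s => k (E ⟨i, s⟩)
    have hk : ∀ i j z, k (E ⟨i, d i ⟨j, z⟩⟩) = k (e' ⟨e ⟨i, j⟩, z⟩) := fun i j z => by rw [hE]
    let δ' : ∀ i j, (Σ z, Fin (k (E ⟨i, d i ⟨j, z⟩⟩))) ≃ Fin (L (e ⟨i, j⟩)) := fun i j =>
      (Equiv.sigmaCongrRight fun z => finCongr (hk i j z)).trans (δ (e ⟨i, j⟩))
    let Δ : ∀ i, (Σ j, Fin (L (e ⟨i, j⟩))) ≃ Fin (L' i) := fun i => outerNum (d i) (D i) (δ' i)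
    have h1 : ∀ i, homEval (D i) (homLact B (d i) (b i) fun j => F (e ⟨i, j⟩))
        (fun s => y (E ⟨i, s⟩)) = (B.lact _).toFun (Δ i) (b i)
          (fun j => homEval (δ (e ⟨i, j⟩)) (F (e ⟨i, j⟩)) fun z => y (e' ⟨e ⟨i, j⟩, z⟩)) :=
      fun i => by
        refine (homEval_homLact B (d i) (D i) (δ' i) (Δ i)
          (outerNum_apply (d i) (D i) (δ' i)) (b i)
          (fun j => F (e ⟨i, j⟩)) (fun s => y (E ⟨i, s⟩))).trans ?_
        exact congrArg _ (funext fun j => homEval_congr (n := k) (fun z => E ⟨i, d i ⟨j, z⟩⟩)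
          (fun z => e' ⟨e ⟨i, j⟩, z⟩) (hE i j) _ _ (fun _ _ => rfl) _ y)
    have h2 := homEval_homLact B e' (sigmaNumbering k) δ (outerNum e' (sigmaNumbering k) δ)
      (outerNum_apply _ _ _) ((O.comp N).toFun e a b) F y
    have h3 := homEval_homLact B E (sigmaNumbering k) D (outerNum E (sigmaNumbering k) D)
      (outerNum_apply _ _ _) a (fun i => homLact B (d i) (b i) (fun j => F (e ⟨i, j⟩))) y
    refine h2.trans (Eq.trans ?_ (h3.trans (congrArg _ (funext h1))).symm)
    refine B.assoc e (outerNum e' (sigmaNumbering k) δ) Δ (outerNum E (sigmaNumbering k) D)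
      (fun i j w => ?_) a b (fun i => homEval (δ i) (F i) fun z => y (e' ⟨i, z⟩))
    obtain ⟨⟨z, x⟩, rfl⟩ := (δ (e ⟨i, j⟩)).surjective w
    rw [outerNum_apply]
    have h4 := outerNum_apply (d i) (D i) (δ' i) j z (finCongr (hk i j z).symm x)
    refine (congrArg (fun s => outerNum E (sigmaNumbering k) D ⟨i, s⟩) h4).trans ?_
    rw [outerNum_apply]
    refine congrArg _ (Sigma.ext (hE i j z) ?_)
    exact (Fin.heq_ext_iff (hk i j z)).mpr rfl

/-- Operations with values in a module form a module. -/
noncomputable def homLMod (Y : Coll.{u, v} K) : LMod O (homColl Y R) where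
  lact N :=
    { toFun := fun {_ _} (e : _ ≃ Fin N) => homLact B e
      left := fun {m m'} σ {n} e e' he a F => by
        obtain rfl : e' = (Equiv.sigmaCongrLeft (β := fun i => Fin (n i)) σ).trans e :=
          Equiv.ext fun ⟨i, z⟩ => he i z
        exact homLact_left B σ e a F
      right := fun {m n n'} f e e' he a F => by
        obtain rfl : e' = (Equiv.sigmaCongrRight f).trans e := Equiv.ext fun ⟨i, z⟩ => he i z
        exact homLact_right B f e a F }
  nat e g e' he a F := by
    obtain rfl : e' = e.trans g := Equiv.ext fun ⟨i, z⟩ => he i z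
    exact homAct_homLact B e g a F
  unit {n N} e g hg F := by
    obtain rfl : g = (soloNum n).symm.trans e := Equiv.ext hg
    exact homLact_one B e F
  assoc := homLact_assoc B

end InternalHom

/-! ### The composition of `T(O₁, O₂)`, obtained from freeness -/

section TreeComposition

variable {K : Type u} [Field K]

/-- Linear maps that commute with the action of an operad commute with relabelling. -/
theorem LMod.map_act {O : LOperad.{u, v} K} {R : Coll.{u, v} K} {R' : Coll.{u, w} K} (B : LMod O R)
    (B' : LMod O R') (f : ∀ N, R.X N →ₗ[K] R'.X N)
    (hf : ∀ {N m : ℕ} {n : Fin m → ℕ} (e : (Σ i, Fin (n i)) ≃ Fin N) (ν : O.C.X m)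
      (t : ∀ i, R.X (n i)), f N ((B.lact N).toFun e ν t) =
        (B'.lact N).toFun e ν (fun i => f (n i) (t i))) {a b : ℕ} (g : Fin a ≃ Fin b) (x : R.X a) :
    f b (R.act g x) = R'.act g (f a x) := by
  -- Relabelling by `g` is the action of the unary identity with numbering `g`, so it is covered by
  -- `hf`.
  have h := hf ((soloNum fun _ : Fin 1 => a).trans g) O.one (fun _ => x)
  rwa [B.unit _ g (fun _ => rfl), B'.unit _ g (fun _ => rfl)] at h

/-- The operation with one argument that relabels it. -/
noncomputable def homOne (Y : Coll.{u, v} K) : HomSpace Y Y 1 := fun n =>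
  (SlotLinear.eval_unique (T := fun i => Y.X (n i))
    (g := Y.act ((soloNum n).symm.trans (sigmaNumbering n)))).toMultilinear

theorem homEval_homOne {Y : Coll.{u, v} K} {n : Fin 1 → ℕ} {N : ℕ} (e : (Σ i, Fin (n i)) ≃ Fin N)
    (g : Fin (n 0) ≃ Fin N) (hg : ∀ z, g z = e ⟨0, z⟩) (y : ∀ i, Y.X (n i)) :
    homEval e (homOne Y) y = Y.act g (y 0) :=
  Y.act_act_eq _ _ _ (fun z => (hg z).trans
    (congrArg e ((sigmaNumbering n).symm_apply_apply ⟨0, z⟩).symm)) _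

variable (O₁ O₂ : SymOperad.{u, u} K) (coef : ∀ c, (labelOperad O₁ O₂ c).C.X 1 →ₗ[K] K)
  (hcoef : ∀ c a, coef c a • (labelOperad O₁ O₂ c).one = a)
  (hone : ∀ c, coef c (labelOperad O₁ O₂ c).one = 1)

/-- Freeness is applied to the operations with arguments and values in `T`: an element of `T(N)`
becomes the operation of grafting on its leaves. -/
theorem exists_treeHom : ∃ ev : ∀ N, (treeT O₁ O₂).X N →ₗ[K] HomSpace (treeT O₁ O₂) (treeT O₁ O₂) N,
    ev 1 (treeId O₁ O₂) = homOne (treeT O₁ O₂) ∧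
      ∀ (c : Colour) {N m : ℕ} {n : Fin m → ℕ} (e : (Σ i, Fin (n i)) ≃ Fin N)
        (ν : (labelOperad O₁ O₂ c).C.X m) (t : ∀ i, (treeT O₁ O₂).X (n i)),
        ev N (((treeMod O₁ O₂ coef hcoef hone c).lact N).toFun e ν t) =
          homLact (treeMod O₁ O₂ coef hcoef hone c) e ν (fun i => ev (n i) (t i)) :=
  treeT_free O₁ O₂ coef hcoef hone (R := homColl (treeT O₁ O₂) (treeT O₁ O₂))
    (fun c => homLMod (treeMod O₁ O₂ coef hcoef hone c) (treeT O₁ O₂)) (homOne (treeT O₁ O₂))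

/-- The element of `T(O₁, O₂)` as an operation on `T(O₁, O₂)`. -/
noncomputable def treeHom (N : ℕ) :
    (treeT O₁ O₂).X N →ₗ[K] HomSpace (treeT O₁ O₂) (treeT O₁ O₂) N :=
  (exists_treeHom O₁ O₂ coef hcoef hone).choose N

theorem treeHom_act {a b : ℕ} (g : Fin a ≃ Fin b) (x : (treeT O₁ O₂).X a) :
    treeHom O₁ O₂ coef hcoef hone b ((treeT O₁ O₂).act g x) =
      homAct g (treeHom O₁ O₂ coef hcoef hone a x) :=
  (treeMod O₁ O₂ coef hcoef hone .black).map_act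
    (homLMod (treeMod O₁ O₂ coef hcoef hone .black) (treeT O₁ O₂)) _
    (fun e ν t => (exists_treeHom O₁ O₂ coef hcoef hone).choose_spec.2 .black e ν t) g x

/-- The composition of `T(O₁, O₂)`. -/
noncomputable def treeComp {m : ℕ} {n : Fin m → ℕ} {N : ℕ} (e : (Σ i, Fin (n i)) ≃ Fin N) :
    (treeT O₁ O₂).X m →ₗ[K]
      MultilinearMap K (fun i => (treeT O₁ O₂).X (n i)) ((treeT O₁ O₂).X N) :=
  homEval e ∘ₗ treeHom O₁ O₂ coef hcoef hone m

local notation "γ" => treeComp O₁ O₂ coef hcoef hone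
local notation "λₜ" => treeMod O₁ O₂ coef hcoef hone

theorem treeComp_id {n : Fin 1 → ℕ} {N : ℕ} (e : (Σ i, Fin (n i)) ≃ Fin N) (g : Fin (n 0) ≃ Fin N)
    (hg : ∀ z, g z = e ⟨0, z⟩) (y : ∀ i, (treeT O₁ O₂).X (n i)) :
    γ e (treeId O₁ O₂) y = (treeT O₁ O₂).act g (y 0) :=
  (congrArg (fun F => homEval e F y) (exists_treeHom O₁ O₂ coef hcoef hone).choose_spec.1).trans
    (homEval_homOne e g hg y)

/-- Grafting on a tree amounts to grafting on its branches and letting the root act afterwards.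
Together with `treeComp_id` this formula drives all inductions on the outer argument below. -/
theorem treeComp_lact (c : Colour) {m : ℕ} {n : Fin m → ℕ} {N : ℕ} (ε : (Σ i, Fin (n i)) ≃ Fin N)
    {k : Fin N → ℕ} {M : ℕ} (E : (Σ y, Fin (k y)) ≃ Fin M) {l : Fin m → ℕ}
    (d : ∀ i, (Σ j, Fin (k (ε ⟨i, j⟩))) ≃ Fin (l i)) (E' : (Σ i, Fin (l i)) ≃ Fin M)
    (hE : ∀ i j z, E' ⟨i, d i ⟨j, z⟩⟩ = E ⟨ε ⟨i, j⟩, z⟩)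
    (ν : (labelOperad O₁ O₂ c).C.X m) (t : ∀ i, (treeT O₁ O₂).X (n i))
    (y : ∀ x, (treeT O₁ O₂).X (k x)) :
    γ E (((λₜ c).lact N).toFun ε ν t) y =
      ((λₜ c).lact M).toFun E' ν (fun i => γ (d i) (t i) (fun j => y (ε ⟨i, j⟩))) :=
  (congrArg (fun F => homEval E F y)
    ((exists_treeHom O₁ O₂ coef hcoef hone).choose_spec.2 c ε ν t)).trans
    (homEval_homLact _ ε E d E' hE ν _ y)

theorem treeComp_nat {m : ℕ} {n : Fin m → ℕ} {N N' : ℕ} (e : (Σ i, Fin (n i)) ≃ Fin N)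
    (g : Fin N ≃ Fin N') (e' : (Σ i, Fin (n i)) ≃ Fin N') (he : ∀ i z, e' ⟨i, z⟩ = g (e ⟨i, z⟩))
    (a : (treeT O₁ O₂).X m) (y : ∀ i, (treeT O₁ O₂).X (n i)) :
    (treeT O₁ O₂).act g (γ e a y) = γ e' a y :=
  homEval_nat e g e' he _ y

theorem treeComp_left {m m' : ℕ} (σ : Fin m ≃ Fin m') {n : Fin m' → ℕ} {N : ℕ}
    (e : (Σ i, Fin (n i)) ≃ Fin N) (e' : (Σ i, Fin (n (σ i))) ≃ Fin N)
    (he : ∀ i z, e' ⟨i, z⟩ = e ⟨σ i, z⟩) (a : (treeT O₁ O₂).X m)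
    (y : ∀ i, (treeT O₁ O₂).X (n i)) :
    γ e ((treeT O₁ O₂).act σ a) y = γ e' a (fun i => y (σ i)) := by
  obtain rfl : e' = (Equiv.sigmaCongrLeft (β := fun i => Fin (n i)) σ).trans e :=
    Equiv.ext fun ⟨i, z⟩ => he i z
  exact (congrArg (fun F => homEval e F y) (treeHom_act O₁ O₂ coef hcoef hone σ a)).trans
    (homEval_homAct σ e _ y)

theorem treeComp_right {m : ℕ} {n n' : Fin m → ℕ} {N : ℕ} (f : ∀ i, Fin (n i) ≃ Fin (n' i))
    (e : (Σ i, Fin (n' i)) ≃ Fin N) (e' : (Σ i, Fin (n i)) ≃ Fin N)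
    (he : ∀ i z, e' ⟨i, z⟩ = e ⟨i, f i z⟩) (a : (treeT O₁ O₂).X m)
    (y : ∀ i, (treeT O₁ O₂).X (n i)) :
    γ e a (fun i => (treeT O₁ O₂).act (f i) (y i)) = γ e' a y := by
  obtain rfl : e' = (Equiv.sigmaCongrRight f).trans e := Equiv.ext fun ⟨i, z⟩ => he i z
  clear he
  -- The numberings and inner arguments are quantified inside `Q`, because the induction hypothesis
  -- for a branch concerns other arities and numberings.
  let Q : ∀ m, Submodule K ((treeT O₁ O₂).X m) := fun m =>
    { carrier := {a | ∀ (n n' : Fin m → ℕ) (N : ℕ) (f : ∀ i, Fin (n i) ≃ Fin (n' i))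
        (e : (Σ i, Fin (n' i)) ≃ Fin N) (y : ∀ i, (treeT O₁ O₂).X (n i)),
        γ e a (fun i => (treeT O₁ O₂).act (f i) (y i)) = γ ((Equiv.sigmaCongrRight f).trans e) a y}
      zero_mem' := fun n n' N f e y => by simp
      add_mem' := fun ha hb n n' N f e y => by
        rw [map_add, map_add, add_apply, add_apply, ha, hb]
      smul_mem' := fun c a ha n n' N f e y => by
        rw [map_smul, map_smul, smul_apply, smul_apply, ha] }
  refine treeT_induction O₁ O₂ coef hcoef hone Q ?_ ?_ m a n n' N f e y
  · intro n n' N f e y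
    rw [treeComp_id O₁ O₂ coef hcoef hone e ((soloNum n').symm.trans e) (fun _ => rfl),
      treeComp_id O₁ O₂ coef hcoef hone _ ((f 0).trans ((soloNum n').symm.trans e)) (fun _ => rfl)]
    exact ((treeT O₁ O₂).act_trans _ _ _).symm
  · intro c m k p ε ν t ht n n' N f e y
    let d := fun i => sigmaNumbering fun j => n' (ε ⟨i, j⟩)
    have h1 := treeComp_lact O₁ O₂ coef hcoef hone c ε e d (outerNum ε e d) (outerNum_apply ε e d)
      ν t (fun i => (treeT O₁ O₂).act (f i) (y i))
    have h2 := treeComp_lact O₁ O₂ coef hcoef hone c ε ((Equiv.sigmaCongrRight f).trans e)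
      (fun i => (Equiv.sigmaCongrRight fun j => f (ε ⟨i, j⟩)).trans (d i)) (outerNum ε e d)
      (fun i j z => outerNum_apply ε e d i j (f (ε ⟨i, j⟩) z)) ν t y
    refine h1.trans (Eq.trans ?_ h2.symm)
    exact congrArg _ (funext fun i => ht i _ _ _ (fun j => f (ε ⟨i, j⟩)) (d i) fun j => y (ε ⟨i, j⟩))

theorem treeComp_one {m N : ℕ} (e : (Σ _ : Fin m, Fin 1) ≃ Fin N) (g : Fin m ≃ Fin N)
    (hg : ∀ i, g i = e ⟨i, 0⟩) (a : (treeT O₁ O₂).X m) :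
    γ e a (fun _ => treeId O₁ O₂) = (treeT O₁ O₂).act g a := by
  let Q : ∀ m, Submodule K ((treeT O₁ O₂).X m) := fun m =>
    { carrier := {a | ∀ (N : ℕ) (e : (Σ _ : Fin m, Fin 1) ≃ Fin N) (g : Fin m ≃ Fin N),
        (∀ i, g i = e ⟨i, 0⟩) → γ e a (fun _ => treeId O₁ O₂) = (treeT O₁ O₂).act g a}
      zero_mem' := fun N e g hg => by simp
      add_mem' := fun ha hb N e g hg => by
        rw [map_add, map_add, add_apply, ha N e g hg, hb N e g hg]
      smul_mem' := fun c a ha N e g hg => by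
        rw [map_smul, map_smul, smul_apply, ha N e g hg] }
  refine treeT_induction O₁ O₂ coef hcoef hone Q ?_ ?_ m a N e g hg
  · intro N e g hg
    exact treeComp_id O₁ O₂ coef hcoef hone e g (fun z => by rw [hg, Subsingleton.elim z 0]) _
  · intro c m k p ε ν t ht N e g hg
    let d : ∀ i, (Σ _ : Fin (p i), Fin 1) ≃ Fin (p i) := fun i => Equiv.sigmaUnique _ _
    refine (treeComp_lact O₁ O₂ coef hcoef hone c ε e d (ε.trans g) (fun i j z => ?_) ν t
      (fun _ => treeId O₁ O₂)).trans ?_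
    · rw [Subsingleton.elim z 0]
      exact hg _
    · rw [(λₜ c).nat ε g (ε.trans g) (fun _ _ => rfl) ν t]
      refine congrArg _ (funext fun i => ?_)
      exact (ht i _ (d i) (Equiv.refl _) (fun _ => rfl)).trans ((treeT O₁ O₂).act_refl _)

theorem treeComp_congr {I : Type*} {m N : ℕ} {n : I → ℕ} (f f' : Fin m → I)
    (hf : ∀ y, f y = f' y) (e : (Σ y, Fin (n (f y))) ≃ Fin N) (e' : (Σ y, Fin (n (f' y))) ≃ Fin N)
    (he : ∀ y z, e ⟨y, z⟩ = e' ⟨y, Fin.cast (congrArg n (hf y)) z⟩) (a : (treeT O₁ O₂).X m)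
    (x : ∀ i, (treeT O₁ O₂).X (n i)) :
    γ e a (fun y => x (f y)) = γ e' a (fun y => x (f' y)) :=
  homEval_congr f f' hf e e' he _ x

/-- Induction on the outer element. If it is a root acting on branches, `treeComp_lact` pushes each
of the three outer compositions into the branches, where the induction hypothesis applies. The
numberings `η`, `η'` and `Δ` describe the leaves after the root has been split off. -/
theorem treeComp_assoc {m : ℕ} {n : Fin m → ℕ} {N : ℕ} (e : (Σ i, Fin (n i)) ≃ Fin N)
    {k : Fin N → ℕ} {M : ℕ} (e' : (Σ y, Fin (k y)) ≃ Fin M) {l : Fin m → ℕ}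
    (d : ∀ i, (Σ j : Fin (n i), Fin (k (e ⟨i, j⟩))) ≃ Fin (l i)) (E : (Σ i, Fin (l i)) ≃ Fin M)
    (hE : ∀ i j z, E ⟨i, d i ⟨j, z⟩⟩ = e' ⟨e ⟨i, j⟩, z⟩)
    (a : (treeT O₁ O₂).X m) (b : ∀ i, (treeT O₁ O₂).X (n i)) (y : ∀ x, (treeT O₁ O₂).X (k x)) :
    γ e' (γ e a b) y = γ E a (fun i => γ (d i) (b i) (fun j => y (e ⟨i, j⟩))) := by
  let Q : ∀ m, Submodule K ((treeT O₁ O₂).X m) := fun m =>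
    { carrier := {a | ∀ (n : Fin m → ℕ) (N : ℕ) (e : (Σ i, Fin (n i)) ≃ Fin N)
        (k : Fin N → ℕ) (M : ℕ) (e' : (Σ y, Fin (k y)) ≃ Fin M) (l : Fin m → ℕ)
        (d : ∀ i, (Σ j : Fin (n i), Fin (k (e ⟨i, j⟩))) ≃ Fin (l i)) (E : (Σ i, Fin (l i)) ≃ Fin M),
        (∀ i j z, E ⟨i, d i ⟨j, z⟩⟩ = e' ⟨e ⟨i, j⟩, z⟩) →
        ∀ (b : ∀ i, (treeT O₁ O₂).X (n i)) (y : ∀ x, (treeT O₁ O₂).X (k x)),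
        γ e' (γ e a b) y = γ E a (fun i => γ (d i) (b i) (fun j => y (e ⟨i, j⟩)))}
      zero_mem' := fun _ _ _ _ _ _ _ _ _ _ b y => by simp
      add_mem' := fun ha hb n N e k M e' l d E hE b y => by
        rw [map_add, map_add, add_apply, add_apply, map_add, add_apply, ha n N e k M e' l d E hE,
          hb n N e k M e' l d E hE]
      smul_mem' := fun c a ha n N e k M e' l d E hE b y => by
        rw [map_smul, map_smul, smul_apply, smul_apply, map_smul, smul_apply,
          ha n N e k M e' l d E hE] }
  refine treeT_induction O₁ O₂ coef hcoef hone Q ?_ ?_ m a n N e k M e' l d E hE b y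
  · intro n N e k M e' l d E hE b y
    let g := (soloNum n).symm.trans e
    let g' := (soloNum l).symm.trans E
    rw [treeComp_id O₁ O₂ coef hcoef hone e g (fun _ => rfl),
      treeComp_id O₁ O₂ coef hcoef hone E g' (fun _ => rfl),
      treeComp_left O₁ O₂ coef hcoef hone g e'
        ((Equiv.sigmaCongrLeft (β := fun i => Fin (k i)) g).trans e') (fun _ _ => rfl)]
    exact (treeComp_nat O₁ O₂ coef hcoef hone (d 0) g' _ (fun i z => (hE 0 i z).symm) (b 0) _).symm
  · intro c m r p ε ν t ht n N e k M e' l d E hE b y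
    let L := fun i => ∑ j, n (ε ⟨i, j⟩)
    let δ : ∀ i, (Σ j, Fin (n (ε ⟨i, j⟩))) ≃ Fin (L i) := fun i => sigmaNumbering _
    let η : (Σ i, Fin (L i)) ≃ Fin N := outerNum ε e δ
    have hη : ∀ i j z, η ⟨i, δ i ⟨j, z⟩⟩ = e ⟨ε ⟨i, j⟩, z⟩ := outerNum_apply ε e δ
    let L' := fun i => ∑ s, k (η ⟨i, s⟩)
    let δ' : ∀ i, (Σ s, Fin (k (η ⟨i, s⟩))) ≃ Fin (L' i) := fun i => sigmaNumbering _
    let η' : (Σ i, Fin (L' i)) ≃ Fin M := outerNum η e' δ'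
    have hη' : ∀ i s z, η' ⟨i, δ' i ⟨s, z⟩⟩ = e' ⟨η ⟨i, s⟩, z⟩ := outerNum_apply η e' δ'
    have hk : ∀ i j z, k (η ⟨i, δ i ⟨j, z⟩⟩) = k (e ⟨ε ⟨i, j⟩, z⟩) := fun i j z => by rw [hη]
    let D : ∀ i j, (Σ z, Fin (k (η ⟨i, δ i ⟨j, z⟩⟩))) ≃ Fin (l (ε ⟨i, j⟩)) := fun i j =>
      (Equiv.sigmaCongrRight fun z => finCongr (hk i j z)).trans (d (ε ⟨i, j⟩))
    let Δ : ∀ i, (Σ j, Fin (l (ε ⟨i, j⟩))) ≃ Fin (L' i) := fun i => outerNum (δ i) (δ' i) (D i)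
    have hΔ : ∀ i j z x, Δ i ⟨j, D i j ⟨z, x⟩⟩ = δ' i ⟨δ i ⟨j, z⟩, x⟩ := fun i =>
      outerNum_apply (δ i) (δ' i) (D i)
    have h1 := treeComp_lact O₁ O₂ coef hcoef hone c ε e δ η hη ν t b
    have h2 := treeComp_lact O₁ O₂ coef hcoef hone c η e' δ' η' hη' ν
      (fun i => γ (δ i) (t i) (fun j => b (ε ⟨i, j⟩))) y
    have h3 := treeComp_lact O₁ O₂ coef hcoef hone c ε E Δ η' (fun i j w => by
      obtain ⟨⟨z, x⟩, rfl⟩ := (d (ε ⟨i, j⟩)).surjective w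
      have h4 := hΔ i j z (finCongr (hk i j z).symm x)
      refine (congrArg (fun s => η' ⟨i, s⟩) h4).trans ?_
      rw [hη', hE]
      refine congrArg _ (Sigma.ext (hη i j z) ?_)
      exact (Fin.heq_ext_iff (hk i j z)).mpr rfl) ν t
      (fun i => γ (d i) (b i) (fun j => y (e ⟨i, j⟩)))
    refine (congrArg (fun x => γ e' x y) h1).trans (h2.trans (Eq.trans ?_ h3.symm))
    refine congrArg _ (funext fun i => ?_)
    refine (ht i _ _ (δ i) _ _ (δ' i) _ (D i) (Δ i) (hΔ i) (fun j => b (ε ⟨i, j⟩))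
      (fun s => y (η ⟨i, s⟩))).trans ?_
    refine congrArg _ (funext fun j => ?_)
    exact treeComp_congr O₁ O₂ coef hcoef hone (n := k) (fun z => η ⟨i, δ i ⟨j, z⟩⟩)
      (fun z => e ⟨ε ⟨i, j⟩, z⟩) (hη i j) _ _ (fun _ _ => rfl) _ y

end TreeComposition

/-! ### The operad of trees and its agreement with grafting -/

section TreeOperad

variable {K : Type u} [Field K]

theorem blockEquiv_one_left (n : ℕ) (h : ∑ _i : Fin 1, n = n) (z : Fin n) :
    blockEquiv (fun _ : Fin 1 => n) n h ⟨0, z⟩ = z := by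
  refine Fin.ext ?_
  rw [blockEquiv_val]
  simp

theorem blockEquiv_one_right (n : ℕ) (h : ∑ _i : Fin n, 1 = n) (i : Fin n) :
    blockEquiv (fun _ : Fin n => 1) n h ⟨i, 0⟩ = i := by
  refine Fin.ext ?_
  rw [blockEquiv_val]
  simp [Finset.filter_gt_eq_Iio]

/-- The numbering of the leaves of a tree is not changed when edges are suppressed. -/
theorem blockEquiv_merge {m : ℕ} (n : Fin m → ℕ) (N : ℕ) (h : ∑ i, n i = N) (r : Fin m → ℕ)
    (p : ∀ i, Fin (r i) → ℕ) (hp : ∀ i, ∑ j, p i j = n i) (R : ℕ) (hR : ∑ i, r i = R)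
    (hN : ∑ x, p ((blockEquiv r R hR).symm x).1 ((blockEquiv r R hR).symm x).2 = N)
    (E : (Σ q : (Σ i, Fin (r i)), Fin (p q.1 q.2)) ≃ Fin N)
    (hE : ∀ i j z, E ⟨⟨i, j⟩, z⟩ = blockEquiv n N h ⟨i, blockEquiv (p i) (n i) (hp i) ⟨j, z⟩⟩) :
    (Equiv.sigmaCongrLeft (β := fun q => Fin (p q.1 q.2)) (blockEquiv r R hR).symm).trans E =
      blockEquiv (fun x => p ((blockEquiv r R hR).symm x).1 ((blockEquiv r R hR).symm x).2) N hN := by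
  -- Both numberings are lexicographic, first in the branch and then in the leaf, and this order
  -- determines a bijection onto `Fin N`.
  have hlt : ∀ (y y' : Σ i, Fin (r i)) (z : Fin (p y.1 y.2)) (z' : Fin (p y'.1 y'.2)),
      blockEquiv r R hR y < blockEquiv r R hR y' → E ⟨y, z⟩ < E ⟨y', z'⟩ := by
    rintro ⟨i, j⟩ ⟨i', j'⟩ z z' hy
    rw [hE, hE]
    rcases lt_trichotomy i i' with hi | rfl | hi
    · exact blockEquiv_lt_of_lt _ _ _ hi _ _
    · refine blockEquiv_lt_of_lt_right _ _ _ ?_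
      rcases lt_trichotomy j j' with hj | rfl | hj
      · exact blockEquiv_lt_of_lt _ _ _ hj _ _
      · exact absurd hy (lt_irrefl _)
      · exact absurd hy (lt_asymm (blockEquiv_lt_of_lt_right r R hR hj))
    · exact absurd hy (lt_asymm (blockEquiv_lt_of_lt r R hR hi _ _))
  have hz' : ∀ (y : Σ i, Fin (r i)) (z z' : Fin (p y.1 y.2)), z < z' → E ⟨y, z⟩ < E ⟨y, z'⟩ := by
    rintro ⟨i, j⟩ z z' hz
    rw [hE, hE]
    exact blockEquiv_lt_of_lt_right _ _ _ (blockEquiv_lt_of_lt_right _ _ _ hz)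
  refine Fin.equiv_eq_of_lt_imp_lt _ _ ?_
  rintro ⟨x, z⟩ ⟨x', z'⟩ hx
  have hlt' : ∀ x x' z z', x < x' → E ⟨(blockEquiv r R hR).symm x, z⟩ <
      E ⟨(blockEquiv r R hR).symm x', z'⟩ := fun x x' z z' h => hlt _ _ _ _ (by simpa using h)
  rcases lt_trichotomy x x' with h1 | rfl | h1
  · exact blockEquiv_lt_of_lt _ _ _ h1 _ _
  · refine blockEquiv_lt_of_lt_right _ _ _ ?_
    rcases lt_trichotomy z z' with hz | rfl | hz
    · exact hz
    · exact absurd hx (lt_irrefl _)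
    · refine absurd hx (lt_asymm ?_)
      change E ⟨(blockEquiv r R hR).symm x, z'⟩ < E ⟨(blockEquiv r R hR).symm x, z⟩
      exact hz' _ _ _ hz
  · exact absurd hx (lt_asymm (hlt' x' x z' z h1))

variable (O₁ O₂ : SymOperad.{u, u} K) (coef : ∀ c, (labelOperad O₁ O₂ c).C.X 1 →ₗ[K] K)
  (hcoef : ∀ c a, coef c a • (labelOperad O₁ O₂ c).one = a)
  (hone : ∀ c, coef c (labelOperad O₁ O₂ c).one = 1)

/-- The operad structure on `T(O₁, O₂)`. -/
noncomputable def treeStructure : OperadStructure (treeCollection O₁ O₂) where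
  one := treeId O₁ O₂
  comp n N h := treeComp O₁ O₂ coef hcoef hone (blockEquiv n N h)
  one_comp n a := (treeComp_id O₁ O₂ coef hcoef hone _ (Equiv.refl _)
    (fun z => (blockEquiv_one_left n _ z).symm) _).trans ((treeT O₁ O₂).act_refl a)
  comp_one n a := (treeComp_one O₁ O₂ coef hcoef hone _ (Equiv.refl _)
    (fun i => (blockEquiv_one_right n _ i).symm) a).trans ((treeT O₁ O₂).act_refl a)
  assoc n N hN k M hM a b c := treeComp_assoc O₁ O₂ coef hcoef hone _ _
    (fun i => blockEquiv (fun j => k (blockEquiv n N hN ⟨i, j⟩)) _ rfl) _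
    (blockEquiv_assoc n N hN k M hM) a b c
  comp_perm_right n N h σ a b :=
    (treeComp_right O₁ O₂ coef hcoef hone σ (blockEquiv n N h)
      ((Equiv.sigmaCongrRight σ).trans (blockEquiv n N h)) (fun _ _ => rfl) a b).trans
      (treeComp_nat O₁ O₂ coef hcoef hone (blockEquiv n N h)
        ((blockEquiv n N h).permCongr (Equiv.sigmaCongrRight σ))
        ((Equiv.sigmaCongrRight σ).trans (blockEquiv n N h)) (fun i z => by
          rw [Equiv.permCongr_apply, Equiv.symm_apply_apply]; rfl) a b).symm
  comp_perm_left n N h σ a b :=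
    (treeComp_left O₁ O₂ coef hcoef hone σ (blockEquiv n N h)
      ((Equiv.sigmaCongrLeft (β := fun i => Fin (n i)) σ).trans (blockEquiv n N h))
        (fun _ _ => rfl) a b).trans
      (treeComp_nat O₁ O₂ coef hcoef hone
        (blockEquiv (fun i => n (σ i)) N (sum_comp_perm n N h σ)) (blockPerm n N h σ)
        ((Equiv.sigmaCongrLeft (β := fun i => Fin (n i)) σ).trans (blockEquiv n N h))
        (fun i z => congrArg (fun y => blockEquiv n N h (Equiv.sigmaCongrLeft σ y))
          (Equiv.symm_apply_apply _ _).symm) a _).symm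

/-- The operad `T(O₁, O₂)`. -/
@[reducible] noncomputable def treeOperad : SymOperad.{u, u} K :=
  ⟨treeCollection O₁ O₂, treeStructure O₁ O₂ coef hcoef hone⟩

local notation "γ" => treeComp O₁ O₂ coef hcoef hone
local notation "λₜ" => treeMod O₁ O₂ coef hcoef hone

theorem treeOperad_lcomp {m : ℕ} {n : Fin m → ℕ} {N : ℕ} (e : (Σ i, Fin (n i)) ≃ Fin N)
    (a : (treeT O₁ O₂).X m) (x : ∀ i, (treeT O₁ O₂).X (n i)) :
    (treeOperad O₁ O₂ coef hcoef hone).lcomp e a x = γ e a x :=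
  treeComp_nat O₁ O₂ coef hcoef hone (blockEquiv n _ rfl) ((blockEquiv n _ rfl).symm.trans e) e
    (fun _ _ => congrArg e ((blockEquiv n _ rfl).symm_apply_apply _).symm) a x

/-! ### Trees -/

theorem toT_leaf (c : Colour) :
    LTree.toT (O₁ := O₁) (O₂ := O₂) (n := 1) ⟨c, LTree.leaf⟩ = treeId O₁ O₂ := inc_treeOne_eq O₁ O₂ c

theorem toT_node (c : Colour) {m : ℕ} (hm : 2 ≤ m) (n : Fin m → ℕ) (N : ℕ) (hN : ∑ i, n i = N)
    (ν : (c.label O₁ O₂).obj m) (t : ∀ i, LTree O₁ O₂ c.swap (n i)) :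
    LTree.toT ⟨c, LTree.node hm n N hN ν t⟩ =
      (stemFam O₁ O₂ coef c N).toFun (blockEquiv n N hN) ν (fun i => (t i).eval) := by
  rw [stemFam_of_two_le O₁ O₂ coef c hm,
    vertMap_blockEquiv O₁ O₂ c n N hN hm (fun i => (t i).pos)]
  rfl

theorem toT_node_eq_lact (c : Colour) {m : ℕ} (hm : 2 ≤ m) (n : Fin m → ℕ) (N : ℕ)
    (hN : ∑ i, n i = N) (ν : (c.label O₁ O₂).obj m) (t : ∀ i, LTree O₁ O₂ c.swap (n i)) :
    LTree.toT ⟨c, LTree.node hm n N hN ν t⟩ =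
      ((λₜ c).lact N).toFun (blockEquiv n N hN) ν (fun i => LTree.toT ⟨c.swap, t i⟩) :=
  (toT_node O₁ O₂ coef c hm n N hN ν t).trans
    (treeMod_inc O₁ O₂ coef hcoef hone c (blockEquiv n N hN) ν fun i => (t i).eval).symm

theorem toT_single (hone : ∀ c, coef c (labelOperad O₁ O₂ c).one = 1) (c : Colour) {n : ℕ} (t : LTree O₁ O₂ c.swap n) :
    LTree.toT ⟨c.swap, t⟩ = (stemFam O₁ O₂ coef c n).toFun
      (blockEquiv (LTree.Stem.single t).part n (LTree.Stem.single t).sum_eq)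
      (LTree.Stem.single t).ν (fun i => ((LTree.Stem.single t).branch i).eval) := by
  refine Eq.symm ((stemFam_one O₁ O₂ coef c (n := fun _ => n) _ (Equiv.refl _)
    (fun z => (blockEquiv_one_left n _ z).symm) _ fun _ => t.eval).trans ?_)
  rw [(treeColl O₁ O₂ c.swap).act_refl]
  exact (congrArg (· • _) (hone c)).trans (one_smul K _)

theorem toT_root (hone : ∀ c, coef c (labelOperad O₁ O₂ c).one = 1) (c : Colour) {n : ℕ} (t : LTree O₁ O₂ c n) :
    LTree.toT ⟨c, t⟩ = (stemFam O₁ O₂ coef c n).toFun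
      (blockEquiv (LTree.Stem.root t).part n (LTree.Stem.root t).sum_eq)
      (LTree.Stem.root t).ν (fun i => ((LTree.Stem.root t).branch i).eval) :=
  match t with
  | .leaf => ((toT_leaf O₁ O₂ c).trans (toT_leaf O₁ O₂ c.swap).symm).trans
      (toT_single O₁ O₂ coef hone c LTree.leaf)
  | .node hm n N hN ν t => toT_node O₁ O₂ coef c hm n N hN ν t

/-- Adjoining an identity vertex does not change the element of `T`, because by `hone` this vertex
contributes the scalar `1`. -/
theorem toT_ofTree (hone : ∀ c, coef c (labelOperad O₁ O₂ c).one = 1) (c : Colour) {n : ℕ} (t : Σ d, LTree O₁ O₂ d n) :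
    LTree.toT t = (stemFam O₁ O₂ coef c n).toFun
      (blockEquiv (LTree.Stem.ofTree c t).part n (LTree.Stem.ofTree c t).sum_eq)
      (LTree.Stem.ofTree c t).ν (fun i => ((LTree.Stem.ofTree c t).branch i).eval) :=
  match c, t with
  | .black, ⟨.black, t⟩ => toT_root O₁ O₂ coef hone .black t
  | .black, ⟨.white, t⟩ => toT_single O₁ O₂ coef hone .black t
  | .white, ⟨.black, t⟩ => toT_single O₁ O₂ coef hone .white t
  | .white, ⟨.white, t⟩ => toT_root O₁ O₂ coef hone .white t

/-- The action on `T` composes the labels of stems, and `merge` does the same to the stems that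
present the given trees. It remains to compare the numberings of the leaves, which is
`blockEquiv_merge`. -/
theorem toT_merge (c : Colour) {m : ℕ} (hm : 2 ≤ m) (n : Fin m → ℕ) (N : ℕ)
    (hN : ∑ i, n i = N) (ν : (c.label O₁ O₂).obj m) (t : ∀ i, Σ d, LTree O₁ O₂ d (n i)) :
    LTree.toT ⟨c, LTree.merge c hm n N hN ν t⟩ =
      ((λₜ c).lact N).toFun (blockEquiv n N hN) ν (fun i => LTree.toT (t i)) := by
  let s := fun i => LTree.Stem.ofTree c (t i)
  let r : Fin m → ℕ := fun i => (s i).r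
  let p : ∀ i, Fin (r i) → ℕ := fun i => (s i).part
  let d : ∀ i, (Σ j, Fin (p i j)) ≃ Fin (n i) := fun i => blockEquiv (p i) (n i) (s i).sum_eq
  let E : (Σ q : (Σ i, Fin (r i)), Fin (p q.1 q.2)) ≃ Fin N :=
    (Equiv.sigmaAssoc fun i j => Fin (p i j)).trans
      ((Equiv.sigmaCongrRight d).trans (blockEquiv n N hN))
  let b := blockEquiv r _ rfl
  have h1 := (isComposite_treeT O₁ O₂ coef hcoef hone c).lactMap_idx (blockEquiv n N hN) ν
    (fun i => Equiv.refl (Fin (r i))) d (fun i => (s i).ν) (fun i j => ((s i).branch j).eval)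
    b b (fun _ _ => rfl) E (fun _ _ _ => rfl)
  have h2 : (fun i => LTree.toT (t i)) = fun i => (stemFam O₁ O₂ coef c (n i)).idx
      (Equiv.refl (Fin (r i))) (d i) (s i).ν (fun j => ((s i).branch j).eval) :=
    funext fun i => (toT_ofTree O₁ O₂ coef hone c (t i)).trans (Fam.idx_refl _ _ _ _).symm
  rw [h2]
  refine Eq.trans ?_ h1.symm
  refine (toT_node O₁ O₂ coef c _ _ N _ _ _).trans ?_
  have hp : ∑ x, p (b.symm x).1 (b.symm x).2 = N := SymOperad.sum_eq_of_sigma_equiv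
    ((Equiv.sigmaCongrLeft (β := fun q => Fin (p q.1 q.2)) b.symm).trans E)
  have h3 : (Equiv.sigmaCongrLeft (β := fun q => Fin (p q.1 q.2)) b.symm).trans E =
      blockEquiv (fun x => p (b.symm x).1 (b.symm x).2) N hp :=
    blockEquiv_merge n N hN r p (fun i => (s i).sum_eq) _ rfl hp E (fun _ _ _ => rfl)
  unfold Fam.idx
  refine Eq.trans ?_ (congrArg (fun e' => (stemFam O₁ O₂ coef c N).toFun
    (n := fun x => p (b.symm x).1 (b.symm x).2) e' ((labelOperad O₁ O₂ c).comp _ |>.toFun b ν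
      fun i => (s i).ν) fun x => ((s (b.symm x).1).branch (b.symm x).2).eval) h3).symm
  refine congrArg (fun a => (stemFam O₁ O₂ coef c N).toFun
    (n := fun x => p (b.symm x).1 (b.symm x).2) _ a
    fun x => ((s (b.symm x).1).branch (b.symm x).2).eval) ?_
  exact ((c.label O₁ O₂).lcomp_blockEquiv rfl ν _).symm

/-- Both sides satisfy the same recursion over the root of `t`: `treeComp_lact` for the composition
and `toT_merge` for grafting. -/
theorem treeComp_toT {c : Colour} {n : ℕ} (t : LTree O₁ O₂ c n) (k : Fin n → ℕ) (N : ℕ)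
    (h : ∑ x, k x = N) (s : ∀ x, Σ d, LTree O₁ O₂ d (k x)) :
    γ (blockEquiv k N h) (LTree.toT ⟨c, t⟩) (fun x => LTree.toT (s x)) =
      LTree.toT (t.graft k N h s) := by
  induction t generalizing N with
  | leaf =>
    obtain rfl : k 0 = N := (Fin.sum_univ_one k).symm.trans h
    rw [toT_leaf, treeComp_id O₁ O₂ coef hcoef hone _ (Equiv.refl _) (fun z => ?_)]
    · exact (treeT O₁ O₂).act_refl _
    · refine Fin.ext ?_
      rw [blockEquiv_val]
      simp
  | node hm n M hn ν t ih =>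
    rw [toT_node_eq_lact O₁ O₂ coef hcoef hone]
    refine (treeComp_lact O₁ O₂ coef hcoef hone _ (blockEquiv n M hn) (blockEquiv k N h)
      (fun i => blockEquiv (fun j => k (blockEquiv n M hn ⟨i, j⟩)) _ rfl) _
      (blockEquiv_assoc n M hn k N h) ν _ _).trans ?_
    refine Eq.trans ?_ (toT_merge O₁ O₂ coef hcoef hone _ hm _ N _ ν _).symm
    exact congrArg _ (funext fun i => ih i _ _ _ _)

theorem isTreeComposition_treeStructure :
    IsTreeComposition (treeStructure O₁ O₂ coef hcoef hone) where
  one_eq := (toT_leaf O₁ O₂ .black).symm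
  comp_eq t k N h s := treeComp_toT O₁ O₂ coef hcoef hone t k N h s

end TreeOperad

/-! ### Unary elements of a binary operad -/

section FreeProduct

variable {K : Type u} [Field K]

namespace SymOperad

theorem Hom.ext_map {P : SymOperad.{u, v} K} {Q : SymOperad.{u, w} K} {φ φ' : Hom P Q}
    (h : ∀ n x, φ.map n x = φ'.map n x) : φ = φ' := by
  obtain ⟨f, _, _, _⟩ := φ
  obtain ⟨f', _, _, _⟩ := φ'
  obtain rfl : f = f' := funext fun n => LinearMap.ext (h n)
  rfl

/-- The subspaces of `P(n)` that contain only multiples of the identity for `n = 1`. -/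
def unarySpan (P : SymOperad.{u, v} K) : ∀ n, Submodule K (P.obj n)
  | 0 => ⊤
  | 1 => Submodule.span K {P.str.one}
  | _ + 2 => ⊤

theorem unarySpan_eq_top (P : SymOperad.{u, v} K) {n : ℕ} (h : n ≠ 1) : P.unarySpan n = ⊤ :=
  match n, h with
  | 0, _ => rfl
  | _ + 2, _ => rfl

/-- Only composites of total arity `1` matter. An argument of arity `0` makes such a composite
vanish; otherwise there is a single argument, of arity `1`, and the outer element is a multiple of
the identity. -/
theorem isSuboperad_unarySpan (P : SymOperad.{u, v} K) : P.IsSuboperad P.unarySpan where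
  one_mem := Submodule.mem_span_singleton_self _
  perm_mem n σ a ha := by
    by_cases h : n = 1
    · subst h
      obtain rfl : σ = 1 := Subsingleton.elim _ _
      rw [map_one]
      exact ha
    · rw [P.unarySpan_eq_top h]
      trivial
  comp_mem {m} n N h a b ha hb := by
    by_cases hN : N = 1
    · subst hN
      by_cases hn : ∃ i, n i = 0
      · obtain ⟨i, hi⟩ := hn
        have : Subsingleton (P.obj (n i)) := by
          rw [hi]
          exact P.coll.subsingleton_zero
        rw [MultilinearMap.map_coord_zero _ i (Subsingleton.elim (b i) 0)]
        exact zero_mem _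
      · have h1 : m ≤ ∑ i, n i := by
          calc m = ∑ _i : Fin m, 1 := by simp
            _ ≤ ∑ i, n i := Finset.sum_le_sum fun i _ =>
              Nat.one_le_iff_ne_zero.mpr fun h => hn ⟨i, h⟩
        have h2 : m ≠ 0 := by
          rintro rfl
          simp at h
        obtain rfl : m = 1 := by omega
        obtain ⟨k, rfl⟩ := Submodule.mem_span_singleton.mp ha
        have h3 : n 0 = 1 := by simpa using h
        rw [map_smul, smul_apply, ← P.lcomp_blockEquiv, P.lcomp_one_left _ (finCongr h3)
          (fun _ => Subsingleton.elim _ _)]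
        refine Submodule.smul_mem _ _ ?_
        have h4 : ∀ (r : ℕ) (hr : r = 1) (y : P.toColl.X r), y ∈ P.unarySpan r →
            P.toColl.act (finCongr hr) y ∈ P.unarySpan 1 := by
          rintro r rfl y hy
          rwa [P.toColl.act_eq_self (finCongr rfl) (fun _ => rfl)]
        exact h4 _ h3 _ (hb 0)
    · rw [P.unarySpan_eq_top hN]
      trivial

/-- Generation by arity `2` forces the suboperad `unarySpan` to be everything, so `P(1)` is spanned
by the identity; as the identity is nonzero, coefficients are well defined. Binarity enters the
proof only through this statement. -/
theorem IsBinary.exists_coef {P : SymOperad.{u, v} K} (hP : P.IsBinary) :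
    ∃ coef : P.obj 1 →ₗ[K] K, (∀ a, coef a • P.str.one = a) ∧ coef P.str.one = 1 := by
  have h := hP.generated P.unarySpan P.isSuboperad_unarySpan rfl 1
  have hb : Function.Bijective (LinearMap.toSpanSingleton K (P.obj 1) P.str.one) := by
    refine ⟨(injective_iff_map_eq_zero _).mpr fun k hk => ?_, fun a => ?_⟩
    · exact (smul_eq_zero.mp hk).resolve_right hP.one_ne_zero
    · have ha : a ∈ P.unarySpan 1 := by rw [h]; trivial
      exact Submodule.mem_span_singleton.mp ha
  let L := LinearEquiv.ofBijective _ hb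
  refine ⟨L.symm.toLinearMap, fun a => L.apply_symm_apply a, ?_⟩
  refine L.injective ((L.apply_symm_apply _).trans ?_)
  exact (one_smul K _).symm

end SymOperad

variable (O₁ O₂ : SymOperad.{u, u} K)

/-! ### Uniqueness of the operad structure -/

/-- The element of `T(N)` given by a tree with numbered leaves. -/
noncomputable def numberedTree (N : ℕ) (p : (Fin N ≃ Fin N) × Σ c, LTree O₁ O₂ c N) :
    (treeT O₁ O₂).X N :=
  (treeT O₁ O₂).act p.1 (LTree.toT p.2)

/-- By induction it suffices to let a vertex act on numbered trees. The numberings of the branches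
are moved into that of the vertex by `right`, and the remaining planar element is a merged tree by
`toT_merge`. -/
theorem span_numberedTree
    (coef : ∀ c, (labelOperad O₁ O₂ c).C.X 1 →ₗ[K] K)
    (hcoef : ∀ c a, coef c a • (labelOperad O₁ O₂ c).one = a)
    (hone : ∀ c, coef c (labelOperad O₁ O₂ c).one = 1) (N : ℕ) :
    ⊤ ≤ Submodule.span K (Set.range (numberedTree O₁ O₂ N)) := by
  intro t _
  refine treeT_induction_of_top O₁ O₂ coef hcoef hone
    (fun N => Submodule.span K (Set.range (numberedTree O₁ O₂ N))) ?_ ?_ N t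
  · refine Submodule.subset_span ⟨(Equiv.refl _, ⟨.black, .leaf⟩), ?_⟩
    exact ((treeT O₁ O₂).act_refl _).trans (toT_leaf O₁ O₂ .black)
  · intro c N m n e ν t hm hn
    refine MultilinearMap.mem_of_span (fun i => numberedTree O₁ O₂ (n i)) (fun i x _ => hn i x)
      (((treeMod O₁ O₂ coef hcoef hone c).lact N).toFun e ν) _ (fun g => Submodule.subset_span ?_) t
    have h := SymOperad.sum_eq_of_sigma_equiv e
    let e' := (Equiv.sigmaCongrRight fun i => (g i).1).trans e
    refine ⟨((blockEquiv n N h).symm.trans e', ⟨c, LTree.merge c hm n N h ν fun i => (g i).2⟩), ?_⟩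
    refine Eq.trans ?_ (((treeMod O₁ O₂ coef hcoef hone c).lact N).right (fun i => (g i).1) e e' (fun _ _ => rfl) ν
      fun i => LTree.toT (g i).2).symm
    refine (congrArg _ (toT_merge O₁ O₂ coef hcoef hone c hm n N h ν fun i => (g i).2)).trans ?_
    exact (treeMod O₁ O₂ coef hcoef hone c).nat (blockEquiv n N h) _ e'
      (fun _ _ => congrArg e' (Equiv.symm_apply_apply _ _).symm) ν _

/-- Equivariance in the outer and inner arguments moves all renumberings outside, which leaves a
composition of planar trees, prescribed by `comp_eq`. -/
theorem IsTreeComposition.comp_numberedTree {S : OperadStructure (treeCollection O₁ O₂)}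
    (hS : IsTreeComposition S) {m : ℕ} (n : Fin m → ℕ) (N : ℕ) (h : ∑ i, n i = N)
    (p : (Fin m ≃ Fin m) × Σ c, LTree O₁ O₂ c m)
    (q : ∀ i, (Fin (n i) ≃ Fin (n i)) × Σ c, LTree O₁ O₂ c (n i)) :
    S.comp n N h (numberedTree O₁ O₂ m p) (fun i => numberedTree O₁ O₂ (n i) (q i)) =
      (treeT O₁ O₂).act ((blockEquiv (fun i => n (p.1 i)) N (sum_comp_perm n N h p.1)).symm.trans
        ((Equiv.sigmaCongrRight fun i => (q (p.1 i)).1).trans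
          ((Equiv.sigmaCongrLeft (β := fun i => Fin (n i)) p.1).trans (blockEquiv n N h))))
        (LTree.toT (p.2.2.graft (fun i => n (p.1 i)) N (sum_comp_perm n N h p.1)
          fun i => (q (p.1 i)).2)) := by
  let P : SymOperad.{u, u} K := ⟨treeCollection O₁ O₂, S⟩
  let e := (Equiv.sigmaCongrLeft (β := fun i => Fin (n i)) p.1).trans (blockEquiv n N h)
  let e' := (Equiv.sigmaCongrRight fun i => (q (p.1 i)).1).trans e
  have h1 := P.lcomp_blockEquiv h (numberedTree O₁ O₂ m p)
    (fun i => numberedTree O₁ O₂ (n i) (q i))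
  have h2 := P.lcomp_left p.1 (blockEquiv n N h) e (fun _ _ => rfl) (LTree.toT p.2)
    (fun i => numberedTree O₁ O₂ (n i) (q i))
  have h3 := P.lcomp_right (fun i => (q (p.1 i)).1) e e' (fun _ _ => rfl) (LTree.toT p.2)
    (fun i => LTree.toT (q (p.1 i)).2)
  have h4 := P.lcomp_eq (sum_comp_perm n N h p.1) e'
    ((blockEquiv (fun i => n (p.1 i)) N (sum_comp_perm n N h p.1)).symm.trans e')
    (fun _ _ => congrArg e' (Equiv.symm_apply_apply _ _).symm) (LTree.toT p.2)
    (fun i => LTree.toT (q (p.1 i)).2)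
  refine h1.symm.trans (h2.trans (h3.trans (h4.trans (congrArg _ ?_))))
  exact hS.comp_eq p.2.2 _ N _ _

theorem isTreeComposition_unique
    (coef : ∀ c, (labelOperad O₁ O₂ c).C.X 1 →ₗ[K] K)
    (hcoef : ∀ c a, coef c a • (labelOperad O₁ O₂ c).one = a)
    (hone : ∀ c, coef c (labelOperad O₁ O₂ c).one = 1)
    (S S' : OperadStructure (treeCollection O₁ O₂))
    (hS : IsTreeComposition S) (hS' : IsTreeComposition S') : S' = S := by
  refine OperadStructure.ext (hS'.one_eq.trans hS.one_eq.symm) ?_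
  funext m n N h
  refine LinearMap.ext_on_range (v := numberedTree O₁ O₂ m)
    (eq_top_iff.mpr (span_numberedTree O₁ O₂ coef hcoef hone m)) fun p => ?_
  refine MultilinearMap.ext_span (fun i => numberedTree O₁ O₂ (n i))
    (fun i => span_numberedTree O₁ O₂ coef hcoef hone (n i)) _ _ fun q => ?_
  exact (hS'.comp_numberedTree O₁ O₂ n N h p q).trans (hS.comp_numberedTree O₁ O₂ n N h p q).symm

/-! ### The universal property -/

variable (coef : ∀ c, (labelOperad O₁ O₂ c).C.X 1 →ₗ[K] K)
  (hcoef : ∀ c a, coef c a • (labelOperad O₁ O₂ c).one = a)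
  (hone : ∀ c, coef c (labelOperad O₁ O₂ c).one = 1)

local notation "γ" => treeComp O₁ O₂ coef hcoef hone
local notation "λₜ" => treeMod O₁ O₂ coef hcoef hone

/-- The numbering of the leaves of a corolla. -/
def corollaNum (m : ℕ) : (Σ _ : Fin m, Fin 1) ≃ Fin m := Equiv.sigmaUnique _ _

/-- The inclusion of the labels as trees with one internal vertex. -/
noncomputable def corollaMap (c : Colour) (m : ℕ) :
    (labelOperad O₁ O₂ c).C.X m →ₗ[K] (treeT O₁ O₂).X m where
  toFun ν := ((λₜ c).lact m).toFun (corollaNum m) ν (fun _ => treeId O₁ O₂)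
  map_add' ν μ := by rw [map_add, add_apply]
  map_smul' k ν := by rw [map_smul, smul_apply, RingHom.id_apply]

/-- The branches of a corolla are identities, so grafting on it is the action of its label. Thus
both actions can be recovered from the operad structure and the corollas, which is what uniqueness
in the universal property needs. -/
theorem treeComp_corollaMap (c : Colour) {m : ℕ} {n : Fin m → ℕ} {N : ℕ}
    (e : (Σ i, Fin (n i)) ≃ Fin N) (ν : (labelOperad O₁ O₂ c).C.X m)
    (t : ∀ i, (treeT O₁ O₂).X (n i)) :
    γ e (corollaMap O₁ O₂ coef hcoef hone c m ν) t = ((λₜ c).lact N).toFun e ν t := by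
  refine (treeComp_lact O₁ O₂ coef hcoef hone c (corollaNum m) e
    (fun i => soloNum fun j => n (corollaNum m ⟨i, j⟩)) e (fun i j z => ?_) ν _ t).trans ?_
  · obtain rfl := Subsingleton.elim j 0
    rfl
  · refine congrArg _ (funext fun i => ?_)
    exact (treeComp_id O₁ O₂ coef hcoef hone _ (Equiv.refl _) (fun _ => rfl) _).trans
      ((treeT O₁ O₂).act_refl _)

/-- The morphisms `π₁` and `π₂`. -/
noncomputable def corollaHom (c : Colour) :
    SymOperad.Hom (c.label O₁ O₂) (treeOperad O₁ O₂ coef hcoef hone) where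
  map := corollaMap O₁ O₂ coef hcoef hone c
  map_perm n σ a := by
    let e : (Σ _ : Fin n, Fin 1) ≃ Fin n := (corollaNum n).trans σ
    exact (((λₜ c).lact n).left σ (corollaNum n) e (fun _ _ => rfl) a _).trans
      ((λₜ c).nat (corollaNum n) σ e (fun _ _ => rfl) a _).symm
  map_one := ((λₜ c).unit (corollaNum 1) (Equiv.refl _) (fun _ => Subsingleton.elim _ _) _).trans
    ((treeT O₁ O₂).act_refl _)
  map_comp {m} n N h a b := by
    have h1 := (λₜ c).assoc (blockEquiv n N h) (corollaNum N) (fun i => corollaNum (n i))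
      (blockEquiv n N h) (fun _ _ _ => rfl) a b (fun _ => treeId O₁ O₂)
    refine Eq.trans ?_ (h1.trans
      (treeComp_corollaMap O₁ O₂ coef hcoef hone c (blockEquiv n N h) a _).symm)
    exact congrArg (fun x => ((λₜ c).lact N).toFun (corollaNum N) x fun _ => treeId O₁ O₂)
      ((c.label O₁ O₂).lcomp_blockEquiv h a b).symm

theorem corollaMap_eq_toT (c : Colour) {m : ℕ} (hm : 2 ≤ m) (ν : (c.label O₁ O₂).obj m) :
    corollaMap O₁ O₂ coef hcoef hone c m ν = LTree.toT ⟨c, LTree.corolla O₁ O₂ c hm ν⟩ := by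
  refine Eq.trans ?_ (toT_node_eq_lact O₁ O₂ coef hcoef hone c hm (fun _ => 1) m (by simp) ν
    fun _ => LTree.leaf).symm
  rw [toT_leaf]
  have h : corollaNum m = blockEquiv (fun _ => 1) m (by simp) := Equiv.ext fun ⟨i, z⟩ => by
    obtain rfl := Subsingleton.elim z 0
    exact (blockEquiv_one_right m _ i).symm
  exact congrArg (fun e => ((λₜ c).lact m).toFun (n := fun _ => 1) e ν fun _ => treeId O₁ O₂) h

/-- Through `ψ` the operad `P` is a left module over both operads of labels, and freeness yields
`ev`. It respects compositions by induction on the outer element. Any other such morphism respects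
the two actions, these being compositions with corollas, and so agrees with `ev` on all that the
identity generates. -/
theorem existsUnique_treeOperad_hom {P : SymOperad.{u, w} K}
    (ψ : ∀ c : Colour, SymOperad.Hom (c.label O₁ O₂) P) :
    ∃! φ : SymOperad.Hom (treeOperad O₁ O₂ coef hcoef hone) P,
      ∀ c n x, φ.map n (corollaMap O₁ O₂ coef hcoef hone c n x) = (ψ c).map n x := by
  obtain ⟨ev, h1, h2⟩ := treeT_free O₁ O₂ coef hcoef hone (fun c => (ψ c).lmod) P.str.one
  have hact : ∀ {a b : ℕ} (g : Fin a ≃ Fin b) (x : (treeT O₁ O₂).X a),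
      ev b ((treeT O₁ O₂).act g x) = P.toColl.act g (ev a x) := fun g x =>
    (λₜ .black).map_act (ψ .black).lmod ev (fun e ν t => h2 .black e ν t) g x
  have hcomp : ∀ (m : ℕ) (a : (treeT O₁ O₂).X m) (n : Fin m → ℕ) (N : ℕ)
      (e : (Σ i, Fin (n i)) ≃ Fin N) (b : ∀ i, (treeT O₁ O₂).X (n i)),
      ev N (γ e a b) = P.lcomp e (ev m a) (fun i => ev (n i) (b i)) := by
    let Q : ∀ m, Submodule K ((treeT O₁ O₂).X m) := fun m =>
      { carrier := {a | ∀ (n : Fin m → ℕ) (N : ℕ) (e : (Σ i, Fin (n i)) ≃ Fin N)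
          (b : ∀ i, (treeT O₁ O₂).X (n i)),
          ev N (γ e a b) = P.lcomp e (ev m a) (fun i => ev (n i) (b i))}
        zero_mem' := fun n N e b => by simp
        add_mem' := fun ha hb n N e b => by
          rw [map_add, add_apply, map_add, map_add, map_add, add_apply, ha, hb]
        smul_mem' := fun c a ha n N e b => by
          rw [map_smul, smul_apply, map_smul, map_smul, map_smul, smul_apply, ha] }
    refine treeT_induction O₁ O₂ coef hcoef hone Q ?_ ?_
    · intro n N e b
      rw [treeComp_id O₁ O₂ coef hcoef hone e ((soloNum n).symm.trans e) (fun _ => rfl), hact, h1]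
      exact (P.lcomp_one_left e ((soloNum n).symm.trans e) (fun _ => rfl)
        fun i => ev (n i) (b i)).symm
    · intro c m k p ε ν t ht n N e b
      let d := fun i => sigmaNumbering fun j => n (ε ⟨i, j⟩)
      rw [treeComp_lact O₁ O₂ coef hcoef hone c ε e d (outerNum ε e d) (outerNum_apply ε e d) ν t b,
        h2, h2]
      refine Eq.trans ?_ (P.lcomp_assoc ε e d (outerNum ε e d) (outerNum_apply ε e d)
        ((ψ c).map k ν) (fun i => ev (p i) (t i)) (fun i => ev (n i) (b i))).symm
      exact congrArg (P.lcomp (outerNum ε e d) ((ψ c).map k ν))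
        (funext fun i => ht i _ _ (d i) fun j => b (ε ⟨i, j⟩))
  let φ : SymOperad.Hom (treeOperad O₁ O₂ coef hcoef hone) P :=
    { map := ev
      map_perm := fun n σ a => hact σ a
      map_one := h1
      map_comp := fun n N h a b => (hcomp _ a n N (blockEquiv n N h) b).trans
        (P.lcomp_blockEquiv h _ _) }
  refine ⟨φ, fun c n x => ?_, fun φ' hφ' => SymOperad.Hom.ext_map fun n x => ?_⟩
  · refine (h2 c (corollaNum n) x _).trans ?_
    rw [h1]
    exact (P.lcomp_one_right (corollaNum n) (Equiv.refl _) (fun _ => rfl) _).trans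
      (P.toColl.act_refl _)
  · refine treeT_induction O₁ O₂ coef hcoef hone
      (fun n => LinearMap.eqLocus (φ'.map n) (ev n)) ?_ ?_ n x
    · exact φ'.map_one.trans h1.symm
    · intro c N m n e ν t ht
      rw [LinearMap.mem_eqLocus, h2, ← treeComp_corollaMap O₁ O₂ coef hcoef hone c e ν t,
        ← treeOperad_lcomp O₁ O₂ coef hcoef hone]
      refine (φ'.map_lcomp e _ t).trans ?_
      rw [hφ']
      exact congrArg (P.lcomp e ((ψ c).map m ν)) (funext ht)

theorem isFreeProduct_treeOperad :
    SymOperad.IsFreeProduct.{u, u, w} (corollaHom O₁ O₂ coef hcoef hone .black)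
      (corollaHom O₁ O₂ coef hcoef hone .white) := by
  intro P ψ₁ ψ₂
  let ψ : ∀ c : Colour, SymOperad.Hom (c.label O₁ O₂) P := fun c => match c with
    | .black => ψ₁
    | .white => ψ₂
  obtain ⟨φ, h, hu⟩ := existsUnique_treeOperad_hom O₁ O₂ coef hcoef hone ψ
  exact ⟨φ, ⟨h .black, h .white⟩, fun φ' h' => hu φ' fun c => match c with
    | .black => h'.1
    | .white => h'.2⟩

end FreeProduct

/-! ### Free products are unique up to isomorphism -/

namespace SymOperad

variable {K : Type u} [Field K]

/-- The identity morphism. -/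
def Hom.id (P : SymOperad.{u, v} K) : Hom P P :=
  ⟨fun _ => LinearMap.id, fun _ _ _ => rfl, rfl, fun _ _ _ _ _ => rfl⟩

/-- The composition of morphisms. -/
def Hom.trans {P Q R : SymOperad.{u, v} K} (φ : Hom P Q) (ψ : Hom Q R) : Hom P R where
  map n := ψ.map n ∘ₗ φ.map n
  map_perm n σ a := (congrArg _ (φ.map_perm n σ a)).trans (ψ.map_perm n σ _)
  map_one := (congrArg _ φ.map_one).trans ψ.map_one
  map_comp n N h a b := (congrArg _ (φ.map_comp n N h a b)).trans (ψ.map_comp n N h _ _)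

theorem IsFreeProduct.map_eq_self {O₁ O₂ O : SymOperad.{u, u} K} {π₁ : Hom O₁ O} {π₂ : Hom O₂ O}
    (h : IsFreeProduct.{u, u, u} π₁ π₂) (φ : Hom O O) (h₁ : ∀ n x, φ.map n (π₁.map n x) = π₁.map n x)
    (h₂ : ∀ n x, φ.map n (π₂.map n x) = π₂.map n x) (n : ℕ) (x : O.obj n) : φ.map n x = x :=
  congrArg (fun f => f.map n x)
    ((h O π₁ π₂).unique (y₂ := Hom.id O) ⟨h₁, h₂⟩ ⟨fun _ _ => rfl, fun _ _ => rfl⟩)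

/-- Each universal property gives a morphism in one direction; both composites fix the images of
`O₁` and `O₂`, hence are identities by `map_eq_self`. -/
theorem IsFreeProduct.exists_iso {O₁ O₂ O F : SymOperad.{u, u} K} {π₁ : Hom O₁ O} {π₂ : Hom O₂ O}
    {j₁ : Hom O₁ F} {j₂ : Hom O₂ F} (h : IsFreeProduct.{u, u, u} π₁ π₂)
    (hj : IsFreeProduct.{u, u, u} j₁ j₂) :
    ∃ f : Hom O F, (∀ n, Function.Bijective (f.map n)) ∧
      (∀ n x, f.map n (π₁.map n x) = j₁.map n x) ∧ ∀ n x, f.map n (π₂.map n x) = j₂.map n x := by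
  obtain ⟨f, ⟨hf₁, hf₂⟩, -⟩ := h F j₁ j₂
  obtain ⟨g, ⟨hg₁, hg₂⟩, -⟩ := hj O π₁ π₂
  refine ⟨f, fun n => ?_, hf₁, hf₂⟩
  have h1 := h.map_eq_self (f.trans g) (fun n x => (congrArg _ (hf₁ n x)).trans (hg₁ n x))
    (fun n x => (congrArg _ (hf₂ n x)).trans (hg₂ n x)) n
  have h2 := hj.map_eq_self (g.trans f) (fun n x => (congrArg _ (hg₁ n x)).trans (hf₁ n x))
    (fun n x => (congrArg _ (hg₂ n x)).trans (hf₂ n x)) n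
  exact Function.bijective_iff_has_inverse.mpr ⟨g.map n, h1, h2⟩

end SymOperad

/-- For binary symmetric operads `O₁` and `O₂` over a field `K`, the composition of labelled trees
makes the collection `T(O₁, O₂)` an operad, and this operad is the free product of `O₁` and `O₂`, with
respect to the morphisms that send an element `ν` of arity `m ≥ 2` to the tree with a single internal
vertex labelled by `ν`. Hence it is isomorphic to every free product of `O₁` and `O₂`. -/
theorem mainTheorem1 {K : Type u} [Field K] (O₁ O₂ : SymOperad.{u, u} K)
    (h₁ : O₁.IsBinary) (h₂ : O₂.IsBinary) :
    ∃ S : OperadStructure (treeCollection O₁ O₂),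
      IsTreeComposition S ∧
      (∀ S' : OperadStructure (treeCollection O₁ O₂), IsTreeComposition S' → S' = S) ∧
      ∃ (π₁ : SymOperad.Hom O₁ ⟨treeCollection O₁ O₂, S⟩)
        (π₂ : SymOperad.Hom O₂ ⟨treeCollection O₁ O₂, S⟩),
        (∀ (m : ℕ) (hm : 2 ≤ m) (ν : O₁.obj m),
          π₁.map m ν = LTree.toT ⟨Colour.black, LTree.corolla O₁ O₂ Colour.black hm ν⟩) ∧
        (∀ (m : ℕ) (hm : 2 ≤ m) (ν : O₂.obj m),
          π₂.map m ν = LTree.toT ⟨Colour.white, LTree.corolla O₁ O₂ Colour.white hm ν⟩) ∧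
        SymOperad.IsFreeProduct.{u, u, w} π₁ π₂ ∧
        ∀ (F : SymOperad.{u, u} K) (j₁ : SymOperad.Hom O₁ F) (j₂ : SymOperad.Hom O₂ F),
          SymOperad.IsFreeProduct.{u, u, u} j₁ j₂ →
          ∃ f : SymOperad.Hom ⟨treeCollection O₁ O₂, S⟩ F,
            (∀ n, Function.Bijective (f.map n)) ∧
            (∀ (n : ℕ) (x : O₁.obj n), f.map n (π₁.map n x) = j₁.map n x) ∧
            (∀ (n : ℕ) (x : O₂.obj n), f.map n (π₂.map n x) = j₂.map n x) := by
  have h : ∀ c : Colour, ∃ coef : (labelOperad O₁ O₂ c).C.X 1 →ₗ[K] K,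
      (∀ a, coef a • (labelOperad O₁ O₂ c).one = a) ∧ coef (labelOperad O₁ O₂ c).one = 1 :=
    fun c => match c with
    | .black => h₁.exists_coef
    | .white => h₂.exists_coef
  choose coef hcoef hone using h
  have hS := isTreeComposition_treeStructure O₁ O₂ coef hcoef hone
  exact ⟨treeStructure O₁ O₂ coef hcoef hone, hS,
    fun S' hS' => isTreeComposition_unique O₁ O₂ coef hcoef hone _ S' hS hS',
    corollaHom O₁ O₂ coef hcoef hone .black, corollaHom O₁ O₂ coef hcoef hone .white,
    fun m hm ν => corollaMap_eq_toT O₁ O₂ coef hcoef hone .black hm ν,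
    fun m hm ν => corollaMap_eq_toT O₁ O₂ coef hcoef hone .white hm ν,
    isFreeProduct_treeOperad O₁ O₂ coef hcoef hone,
    fun F j₁ j₂ hj => (isFreeProduct_treeOperad O₁ O₂ coef hcoef hone).exists_iso hj⟩
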